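/- Let $\mathbb{C}_q=\mathbb{C}[q,q^{-1}]$ with $q$ an indeterminate, put $p(1)=\dots=p(4)=0$, $p(5)=1$ and $\pi(a_{ij})=p(i)+p(j) \bmod 2$. All tensor products are over $\mathbb{C}_q$, and $(a\otimes b)(a'\otimes b')=(-1)^{|b||a'|}aa'\otimes bb'$. Let $\mathrm{M}_q(4|1)$ be the superalgebra over $\mathbb{C}_q$ generated by $a_{ij}$ ($1\le i,j\le 5$), of parity $\pi(a_{ij})$, with the relations: $a_{ij}^2=0$ for $a_{ij}$ odd; $a_{ij}a_{il}=(-1)^{\pi(a_{ij})\pi(a_{il})}q^{(-1)^{p(i)+1}}a_{il}a_{ij}$ for $j<l$; $a_{ij}a_{kj}=(-1)^{\pi(a_{ij})\pi(a_{kj})}q^{(-1)^{p(j)+1}}a_{kj}a_{ij}$ for $i<k$; $a_{ij}a_{kl}=(-1)^{\pi(a_{ij})\pi(a_{kl})}a_{kl}a_{ij}$ for $i<k,\ j>l$ or $i>k,\ j<l$; and $a_{ij}a_{kl}-(-1)^{\pi(a_{ij})\pi(a_{kl})}a_{kl}a_{ij}=(-1)^{\pi(a_{ij})\pi(a_{kj})}(q^{-1}-q)a_{kj}a_{il}$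 for $i<k,\ j<l$. For a square matrix $M$ put $\det_q M=\sum_\sigma(-q)^{-\ell(\sigma)}M_{1\sigma(1)}\cdots M_{n\sigma(n)}$. Let $\mathrm{GL}_q(4|1)$ be obtained from $\mathrm{M}_q(4|1)$ by adjoining two-sided inverses of $D_1=\det_q(a_{ij})_{i,j\le 4}$ and of $D_2=a_{55}$, and let $\mathcal{O}(\mathrm{SL}_q(4|1))$ be its quotient by $\mathrm{Ber}_q=1$, where $\mathrm{Ber}_q=\det_q\big(a_{ij}-a_{i5}a_{55}^{-1}a_{5j}\big)_{i,j\le 4}\,a_{55}^{-1}$. Finally, let $\mathcal{O}(P_{l,q})$ be the quotient of $\mathcal{O}(\mathrm{SL}_q(4|1))$ by the two-sided ideal generated by $a_{ij}$, $i\in\{1,2\}$, $j\in\{3,4,5\}$, and write its generating matrix in blocks of sizes $2,2,1$ as $$g=\begin{pmatrix}x&0&0\\ tx&y&y\eta\\ \tilde\tau x&d\xi&d\end{pmatrix},\qquad d\tau=\tilde\tau x .$$ **Proposition.** The matrices $x,y$ and the element $d$ are invertible over $\mathcal{O}(P_{l,q})$, so that $t,\tilde\tau,\tau,\xi,\eta$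 are well defined. Let $\mathcal{O}_q(U_{12})$ be the subalgebra of $\mathcal{O}(P_{l,q})$ generated by the entries of $t$ and $\tilde\tau$ (the quantum big cell). The superalgebra $\mathcal{O}(P_{l,q})$ is a Hopf superalgebra with comultiplication $\Delta(g_{ij})=\sum_k g_{ik}\otimes g_{kj}$ and counit $\varepsilon(g_{ij})=\delta_{ij}$; its antipode $S$ satisfies $S(x)=x^{-1}$ (entrywise). The restriction of $\Delta$ to $\mathcal{O}_q(U_{12})$ gives a morphism of superalgebras $$\tilde\Delta:\mathcal{O}_q(U_{12})\to\mathcal{O}(P_{l,q})\otimes\mathcal{O}_q(U_{12}),$$ whose composition with the map to $\mathcal{O}(P_{l,q})\otimes\mathcal{O}(P_{l,q})$ is $\Delta|_{\mathcal{O}_q(U_{12})}$, and $\tilde\Delta$ is a coaction of $\mathcal{O}(P_{l,q})$ (coassociative and counital). Explicitly, for $i,j\in\{1,2\}$ (rows of $t,y,\eta$ renumbered $1,2$), $$\tilde\Delta t_{ij}=t_{ij}\otimes 1+\sum_{a,b}y_{ia}S(x_{bj})\otimes t_{ab}+\sum_{a,b}y_{ia}\eta_aS(x_{bj})\otimes\tilde\tau_b,$$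 $$\tilde\Delta\tilde\tau_j=\sum_a(d\otimes1)\Big(\tau_a\otimes1+\sum_b\xi_b\otimes t_{ba}+1\otimes\tilde\tau_a\Big)(S(x_{aj})\otimes1).$$ The coaction is dual to the action of the supergroup on the big cell: for every supercommutative superalgebra $C$ over $\mathbb{C}_q$ and all parity-preserving $\mathbb{C}_q$-algebra homomorphisms $f:\mathcal{O}(P_{l,q})\to C$ and $u:\mathcal{O}_q(U_{12})\to C$, with $A=u(t)$ and $\alpha=u(\tilde\tau)$, the map $m_C\circ(f\otimes u)\circ\tilde\Delta$ sends $t$ to $f(y)\big(A+f(\eta)\alpha\big)f(x)^{-1}+f(t)$ and $\tilde\tau$ to $f(d)\big(\alpha+f(\tau)+f(\xi)A\big)f(x)^{-1}$. -/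

import Mathlib

open scoped TensorProduct

noncomputable section

namespace QuantumBigCell

/-! ### Superalgebras over `ℂ[q, q⁻¹]` -/

/-- The ground ring `ℂ_q = ℂ[q, q⁻¹]`, with `q` an indeterminate. -/
abbrev Cq : Type := LaurentPolynomial ℂ

/-- The integer power `q ^ n` of the indeterminate. -/
def qpow (n : ℤ) : Cq := LaurentPolynomial.T n

/-- A superalgebra over `ℂ_q`. Since `2` is invertible, a `ℤ/2`-grading of an algebra `A` is the
same as an involutive algebra endomorphism, the parity `a ↦ (-1)^|a| a`. -/
class SuperAlgebra (A : Type*) [Ring A] [Algebra Cq A] where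
  parity : A →ₐ[Cq] A
  parity_parity : ∀ a, parity (parity a) = a

open SuperAlgebra

/-- The homogeneous parts of a superalgebra: `a` has degree `i` when `parity a = (-1)^i a`. -/
def homog (A : Type*) [Ring A] [Algebra Cq A] [SuperAlgebra A] (i : ZMod 2) : Submodule Cq A :=
  LinearMap.eqLocus (parity : A →ₐ[Cq] A).toLinearMap ((-1 : Cq) ^ i.val • LinearMap.id)

section Graded

variable {A : Type*} [Ring A] [Algebra Cq A] [SuperAlgebra A]

theorem mem_homog {i : ZMod 2} {a : A} :
    a ∈ homog A i ↔ parity a = (-1 : Cq) ^ i.val • a := Iff.rfl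

theorem mem_homog_zero {a : A} : a ∈ homog A 0 ↔ parity a = a := by
  simp [mem_homog]

theorem mem_homog_one {a : A} : a ∈ homog A 1 ↔ parity a = -a := by
  simp [mem_homog, ZMod.val_one]

/-- The scalar `1/2`. -/
def half : Cq := LaurentPolynomial.C (1 / 2)

theorem half_add_half : half + half = 1 := by
  rw [half, ← map_add]; norm_num

instance : SetLike.GradedMonoid (homog A) where
  one_mem := by simp [mem_homog_zero]
  mul_mem := by
    intro i j a b ha hb
    have key : ∀ i : ZMod 2, i = 0 ∨ i = 1 := by decide
    have h11 : (1 : ZMod 2) + 1 = 0 := by decide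
    rcases key i with rfl | rfl <;> rcases key j with rfl | rfl <;>
      simp_all [mem_homog_zero, mem_homog_one]

/-- The even part of an element. -/
def evenPart : A →ₗ[Cq] homog A 0 :=
  LinearMap.codRestrict _ (half • (LinearMap.id + (parity : A →ₐ[Cq] A).toLinearMap)) (by
    intro a; simp [mem_homog_zero, parity_parity, add_comm])

/-- The odd part of an element. -/
def oddPart : A →ₗ[Cq] homog A 1 :=
  LinearMap.codRestrict _ (half • (LinearMap.id - (parity : A →ₐ[Cq] A).toLinearMap)) (by
    intro a
    simp [mem_homog_one, parity_parity, ← smul_neg])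

theorem even_add_odd (a : A) : (evenPart a : A) + (oddPart a : A) = a := by
  have : half • (a + parity a) + half • (a - parity a) = a := by
    rw [← smul_add]
    have : a + parity a + (a - parity a) = a + a := by abel
    rw [this, smul_add, ← add_smul, half_add_half, one_smul]
  exact this

instance : DirectSum.Decomposition (homog A) where
  decompose' a := DirectSum.of (fun i => homog A i) 0 (evenPart a) +
    DirectSum.of (fun i => homog A i) 1 (oddPart a)
  left_inv a := by
    simp [even_add_odd]
  right_inv x := by
    induction x using DirectSum.induction_on with
    | zero => simp
    | add x y hx hy =>
      have : ∀ u v : A, (DirectSum.of (fun i => homog A i) 0 (evenPart (u + v)) +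
          DirectSum.of (fun i => homog A i) 1 (oddPart (u + v))) =
          (DirectSum.of (fun i => homog A i) 0 (evenPart u) +
          DirectSum.of (fun i => homog A i) 1 (oddPart u)) +
          (DirectSum.of (fun i => homog A i) 0 (evenPart v) +
          DirectSum.of (fun i => homog A i) 1 (oddPart v)) := by
        intro u v; simp only [map_add]; abel
      rw [map_add]
      exact (this _ _).trans (congrArg₂ (· + ·) hx hy)
    | of i a =>
      have key : ∀ i : ZMod 2, i = 0 ∨ i = 1 := by decide
      rcases key i with rfl | rfl
      · have h := mem_homog_zero.1 a.2
        have e : evenPart (a : A) = a := by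
          ext; simp [evenPart, h, smul_add, ← add_smul, half_add_half]
        have o : oddPart (a : A) = 0 := by
          ext
          change half • ((a : A) - parity (a : A)) = 0
          simp [h]
        simp [e, o]
      · have h := mem_homog_one.1 a.2
        have e : evenPart (a : A) = 0 := by
          ext; simp [evenPart, h]
        have o : oddPart (a : A) = a := by
          ext
          change half • ((a : A) - parity (a : A)) = a
          simp [h, smul_add, ← add_smul, half_add_half]
        simp [e, o]

instance : GradedAlgebra (homog A) where

end Graded

/-- The tensor product of superalgebras, with
`(a ⊗ b) (a' ⊗ b') = (-1)^(|b| |a'|) a a' ⊗ b b'`. -/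
abbrev STensor (A B : Type*) [Ring A] [Algebra Cq A] [SuperAlgebra A]
    [Ring B] [Algebra Cq B] [SuperAlgebra B] : Type _ :=
  GradedTensorProduct Cq (homog A) (homog B)

section Structures

variable {A V : Type*} [Ring A] [Algebra Cq A] [SuperAlgebra A]
  [Ring V] [Algebra Cq V] [SuperAlgebra V]

/-- The pure tensor `a ⊗ v` in the super tensor product. -/
def st (a : A) (v : V) : STensor A V := GradedTensorProduct.tmul Cq a v

/-- The linear map underlying an algebra map into a super tensor product. -/
def lin {W : Type*} [Ring W] [Algebra Cq W] (f : W →ₐ[Cq] STensor A V) : W →ₗ[Cq] A ⊗[Cq] V :=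
  (GradedTensorProduct.of Cq (homog A) (homog V)).symm.toLinearMap ∘ₗ f.toLinearMap

/-- The linear map underlying the parity. -/
def par (A : Type*) [Ring A] [Algebra Cq A] [SuperAlgebra A] : A →ₗ[Cq] A :=
  (parity : A →ₐ[Cq] A).toLinearMap

/-- `Δ`, `ε`, `S` are the comultiplication, the counit and the antipode of a Hopf superalgebra
structure on the superalgebra `A`. -/
structure IsHopfSuperalgebra (Δ : A →ₐ[Cq] STensor A A) (ε : A →ₐ[Cq] Cq) (S : A →ₗ[Cq] A) :
    Prop where
  comul_even : lin Δ ∘ₗ par A = TensorProduct.map (par A) (par A) ∘ₗ lin Δ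
  counit_even : ε.toLinearMap ∘ₗ par A = ε.toLinearMap
  antipode_even : S ∘ₗ par A = par A ∘ₗ S
  coassoc : (TensorProduct.assoc Cq A A A).toLinearMap ∘ₗ
      TensorProduct.map (lin Δ) LinearMap.id ∘ₗ lin Δ =
    TensorProduct.map LinearMap.id (lin Δ) ∘ₗ lin Δ
  counit_left : (TensorProduct.lid Cq A).toLinearMap ∘ₗ
      TensorProduct.map ε.toLinearMap LinearMap.id ∘ₗ lin Δ = LinearMap.id
  counit_right : (TensorProduct.rid Cq A).toLinearMap ∘ₗ
      TensorProduct.map LinearMap.id ε.toLinearMap ∘ₗ lin Δ = LinearMap.id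
  antipode_left : LinearMap.mul' Cq A ∘ₗ TensorProduct.map S LinearMap.id ∘ₗ lin Δ =
    Algebra.linearMap Cq A ∘ₗ ε.toLinearMap
  antipode_right : LinearMap.mul' Cq A ∘ₗ TensorProduct.map LinearMap.id S ∘ₗ lin Δ =
    Algebra.linearMap Cq A ∘ₗ ε.toLinearMap

/-- `δ : V → A ⊗ V` is a (left) coaction of the super bialgebra `(A, Δ, ε)` on the
superalgebra `V`, by morphisms of superalgebras. -/
structure IsSuperCoaction (Δ : A →ₐ[Cq] STensor A A) (ε : A →ₐ[Cq] Cq)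
    (δ : V →ₐ[Cq] STensor A V) : Prop where
  even : lin δ ∘ₗ par V = TensorProduct.map (par A) (par V) ∘ₗ lin δ
  coassoc : (TensorProduct.assoc Cq A A V).toLinearMap ∘ₗ
      TensorProduct.map (lin Δ) LinearMap.id ∘ₗ lin δ =
    TensorProduct.map LinearMap.id (lin δ) ∘ₗ lin δ
  counit : (TensorProduct.lid Cq V).toLinearMap ∘ₗ
      TensorProduct.map ε.toLinearMap LinearMap.id ∘ₗ lin δ = LinearMap.id

/-- Commutativity in the super sense: `a b = (-1)^(|a| |b|) b a`. -/
def IsSuperCommutative (A : Type*) [Ring A] [Algebra Cq A] [SuperAlgebra A] : Prop :=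
  ∀ (i j : ZMod 2) (a b : A), a ∈ homog A i → b ∈ homog A j →
    a * b = (-1 : Cq) ^ (i.val * j.val) • (b * a)

/-- The quotient of a superalgebra by relations that are compatible with the parity. -/
abbrev SuperAlgebra.quot (r : A → A → Prop)
    (h : ∀ a b, r a b →
      RingQuot.mkAlgHom Cq r (parity a) = RingQuot.mkAlgHom Cq r (parity b)) :
    SuperAlgebra (RingQuot r) where
  parity := RingQuot.liftAlgHom Cq ⟨(RingQuot.mkAlgHom Cq r).comp parity, fun _ _ hab => h _ _ hab⟩
  parity_parity := by
    intro a
    obtain ⟨a, rfl⟩ := RingQuot.mkAlgHom_surjective Cq r a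
    have key : ∀ b, RingQuot.liftAlgHom Cq ⟨(RingQuot.mkAlgHom Cq r).comp parity,
        fun _ _ hab => h _ _ hab⟩ (RingQuot.mkAlgHom Cq r b) = RingQuot.mkAlgHom Cq r (parity b) :=
      fun b => RingQuot.liftAlgHom_mkAlgHom_apply Cq _ _ _
    exact (congrArg _ (key a)).trans ((key _).trans (congrArg _ (parity_parity a)))

theorem SuperAlgebra.quot_parity (r : A → A → Prop)
    (h : ∀ a b, r a b →
      RingQuot.mkAlgHom Cq r (parity a) = RingQuot.mkAlgHom Cq r (parity b)) (a : A) :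
    (SuperAlgebra.quot r h).parity (RingQuot.mkAlgHom Cq r a) =
      RingQuot.mkAlgHom Cq r (parity a) :=
  RingQuot.liftAlgHom_mkAlgHom_apply Cq _ _ _

/-- A subalgebra stable under the parity is a superalgebra. -/
abbrev SuperAlgebra.sub (B : Subalgebra Cq A) (h : ∀ b ∈ B, parity b ∈ B) : SuperAlgebra B where
  parity := ((parity : A →ₐ[Cq] A).comp B.val).codRestrict B fun b => h _ b.2
  parity_parity := by
    intro b
    exact Subtype.ext (parity_parity (b : A))

end Structures

/-! ### The quantum general linear supergroup `GL_q(4|1)` -/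

/-- Generators: the matrix entries `a_ij` (with `0 ≤ i, j ≤ 4`, the index `4` being the odd one)
and the inverses of the quantum determinants `D₁`, `D₂` of the two diagonal blocks. -/
inductive Gen : Type
  | a (i j : Fin 5)
  | D1inv
  | D2inv

/-- The parity of an index. -/
def p (i : Fin 5) : ℕ := if i = 4 then 1 else 0

/-- The parity of the matrix entry `a_ij`. -/
def π (i j : Fin 5) : ℕ := (p i + p j) % 2

/-- The parity of a generator. -/
def Gen.deg : Gen → ℕ
  | .a i j => π i j
  | .D1inv => 0
  | .D2inv => 0

/-- The free superalgebra on the generators. -/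
abbrev Free : Type := FreeAlgebra Cq Gen

instance : SuperAlgebra Free where
  parity := FreeAlgebra.lift Cq fun x => (-1 : Cq) ^ x.deg • FreeAlgebra.ι Cq x
  parity_parity := by
    intro a
    rw [← AlgHom.comp_apply]
    conv_rhs => rw [← AlgHom.id_apply (R := Cq) a]
    congr 1
    ext x
    simp [smul_smul, ← mul_pow]

/-- The entry `a_ij` in the free superalgebra. -/
def fa (i j : Fin 5) : Free := FreeAlgebra.ι Cq (Gen.a i j)

/-- The number of inversions of a permutation. -/
def inversions {n : ℕ} (σ : Equiv.Perm (Fin n)) : ℕ :=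
  (Finset.univ.filter fun ij : Fin n × Fin n => ij.1 < ij.2 ∧ σ ij.2 < σ ij.1).card

/-- The quantum determinant `∑_σ (-q)^(-l(σ)) M_{1σ(1)} ⋯ M_{nσ(n)}`, the factors being ordered
by rows. -/
def qdet {A : Type*} [Ring A] [Algebra Cq A] {n : ℕ} (M : Matrix (Fin n) (Fin n) A) : A :=
  ∑ σ : Equiv.Perm (Fin n),
    ((-1) ^ inversions σ * qpow (-(inversions σ : ℤ))) • (List.ofFn fun i => M i (σ i)).prod

/-- The quantum determinant of the upper left `4 × 4` block. -/
def fD1 : Free := qdet (Matrix.of fun i j : Fin 4 => fa i.castSucc j.castSucc)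

/-- The defining relations of `GL_q(4|1)`: the square of an odd generator is zero, the Manin
relations, and the invertibility of `D₁` and `D₂ = a_55`. -/
inductive GLRel : Free → Free → Prop
  | sq (i j : Fin 5) : π i j = 1 → GLRel (fa i j * fa i j) 0
  | row (i j l : Fin 5) : j < l → GLRel (fa i j * fa i l)
      (((-1) ^ (π i j * π i l) * qpow ((-1) ^ (p i + 1))) • (fa i l * fa i j))
  | col (i j k : Fin 5) : i < k → GLRel (fa i j * fa k j)
      (((-1) ^ (π i j * π k j) * qpow ((-1) ^ (p j + 1))) • (fa k j * fa i j))
  | anti (i j k l : Fin 5) : (i < k ∧ l < j) ∨ (k < i ∧ j < l) → GLRel (fa i j * fa k l)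
      ((-1 : Cq) ^ (π i j * π k l) • (fa k l * fa i j))
  | diag (i j k l : Fin 5) : i < k → j < l →
      GLRel (fa i j * fa k l - (-1 : Cq) ^ (π i j * π k l) • (fa k l * fa i j))
        (((-1) ^ (π i j * π k j) * (qpow (-1) - qpow 1)) • (fa k j * fa i l))
  | D1_mul : GLRel (fD1 * FreeAlgebra.ι Cq Gen.D1inv) 1
  | mul_D1 : GLRel (FreeAlgebra.ι Cq Gen.D1inv * fD1) 1
  | D2_mul : GLRel (fa 4 4 * FreeAlgebra.ι Cq Gen.D2inv) 1
  | mul_D2 : GLRel (FreeAlgebra.ι Cq Gen.D2inv * fa 4 4) 1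

theorem parity_ι (x : Gen) :
    parity (FreeAlgebra.ι Cq x) = (-1 : Cq) ^ x.deg • (FreeAlgebra.ι Cq x : Free) := by
  exact FreeAlgebra.lift_ι_apply _ _

theorem parity_fa (i j : Fin 5) : parity (fa i j) = (-1 : Cq) ^ π i j • fa i j := parity_ι _

theorem map_qdet {A B : Type*} [Ring A] [Algebra Cq A] [Ring B] [Algebra Cq B] (f : A →ₐ[Cq] B)
    {n : ℕ} (M : Matrix (Fin n) (Fin n) A) : f (qdet M) = qdet (M.map f) := by
  simp only [qdet, map_sum, map_smul, map_list_prod, List.map_ofFn]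
  rfl

theorem parity_fD1 : parity fD1 = fD1 := by
  rw [fD1, map_qdet]
  congr 1
  ext i j : 2
  have hp : ∀ i : Fin 4, p i.castSucc = 0 := by decide
  simp [parity_fa, π, hp]

/-- The quantum general linear supergroup `GL_q(4|1)`. -/
def GLq : Type := RingQuot GLRel

instance : Ring GLq := inferInstanceAs (Ring (RingQuot GLRel))

instance : Algebra Cq GLq := inferInstanceAs (Algebra Cq (RingQuot GLRel))

/-- The quotient map. -/
def GLq.mk : Free →ₐ[Cq] GLq := RingQuot.mkAlgHom Cq GLRel

theorem GLq.rel {a b : Free} (h : GLRel a b) : GLq.mk a = GLq.mk b := RingQuot.mkAlgHom_rel Cq h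

theorem GLq.rel_parity (a b : Free) (h : GLRel a b) : GLq.mk (parity a) = GLq.mk (parity b) := by
  have h' := GLq.rel h
  have e (i j k l : Fin 5) : GLq.mk (parity (fa i j * fa k l)) =
      ((-1 : Cq) ^ π i j * (-1) ^ π k l) • GLq.mk (fa i j * fa k l) := by
    rw [map_mul, parity_fa, parity_fa, smul_mul_smul_comm, map_smul]
  have e' (c : Cq) (i j k l : Fin 5) : GLq.mk (parity (c • (fa i j * fa k l))) =
      ((-1 : Cq) ^ π i j * (-1) ^ π k l) • GLq.mk (c • (fa i j * fa k l)) := by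
    rw [map_smul, map_smul, e, map_smul, smul_comm]
  have hinv : parity (FreeAlgebra.ι Cq Gen.D1inv) = (FreeAlgebra.ι Cq Gen.D1inv : Free) :=
    (parity_ι _).trans (one_smul _ _)
  have hinv' : parity (FreeAlgebra.ι Cq Gen.D2inv) = (FreeAlgebra.ι Cq Gen.D2inv : Free) :=
    (parity_ι _).trans (one_smul _ _)
  have h44 : parity (fa 4 4) = fa 4 4 := (parity_fa 4 4).trans (one_smul _ _)
  cases h with
  | sq i j hij => rw [e, h', map_zero, map_zero, map_zero, smul_zero]
  | row i j l hjl => rw [e, e', h', mul_comm]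
  | col i j k hik => rw [e, e', h', mul_comm]
  | anti i j k l _ => rw [e, e', h', mul_comm]
  | diag i j k l _ _ =>
    have e1 : (-1 : Cq) ^ π k j * (-1) ^ π i l = (-1) ^ π i j * (-1) ^ π k l := by
      simp only [π, ← neg_one_pow_eq_pow_mod_two, pow_add]
      ring
    have e2 : (-1 : Cq) ^ π k l * (-1) ^ π i j = (-1) ^ π i j * (-1) ^ π k l := mul_comm _ _
    rw [map_sub, map_sub, e, e', e', e1, e2, ← smul_sub, ← map_sub, h']
  | D1_mul => rw [map_mul, parity_fD1, hinv, h', map_one, map_one, map_one]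
  | mul_D1 => rw [map_mul, parity_fD1, hinv, h', map_one, map_one, map_one]
  | D2_mul => rw [map_mul, h44, hinv', h', map_one, map_one, map_one]
  | mul_D2 => rw [map_mul, h44, hinv', h', map_one, map_one, map_one]

instance : SuperAlgebra GLq := SuperAlgebra.quot GLRel GLq.rel_parity

theorem GLq.parity_mk (f : Free) : parity (GLq.mk f) = GLq.mk (parity f) :=
  SuperAlgebra.quot_parity GLRel GLq.rel_parity f

/-- The entries `a_ij` of the generating matrix of `GL_q(4|1)`. -/
def GLq.a (i j : Fin 5) : GLq := GLq.mk (fa i j)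

/-- The inverse of `D₂ = a_55` in `GL_q(4|1)`. -/
def GLq.D2inv : GLq := GLq.mk (FreeAlgebra.ι Cq Gen.D2inv)

/-! ### The quantum special linear supergroup `SL_q(4|1)` -/

/-- The quantum Berezinian `det_q(A - B D⁻¹ C) (det_q D)⁻¹` of the generating matrix
`(A, B; C, D)`, where `A` is the `4 × 4` block and `D = a_55`. -/
def quantumBer : GLq :=
  qdet (Matrix.of fun i j : Fin 4 =>
    GLq.a i.castSucc j.castSucc - GLq.a i.castSucc 4 * GLq.D2inv * GLq.a 4 j.castSucc) * GLq.D2inv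

/-- The relation `Ber_q = 1`. -/
inductive SLRel : GLq → GLq → Prop
  | ber : SLRel quantumBer 1

theorem GLq.parity_a (i j : Fin 5) : parity (GLq.a i j) = (-1 : Cq) ^ π i j • GLq.a i j := by
  rw [GLq.a, GLq.parity_mk, parity_fa, map_smul]

theorem GLq.parity_D2inv : parity GLq.D2inv = GLq.D2inv := by
  rw [GLq.D2inv, GLq.parity_mk, parity_ι]
  simp [Gen.deg]

theorem parity_quantumBer : parity quantumBer = quantumBer := by
  rw [quantumBer, map_mul, map_qdet, GLq.parity_D2inv]
  congr 2
  ext i j : 2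
  have hp : ∀ i : Fin 4, p i.castSucc = 0 := by decide
  have h4 : p 4 = 1 := by decide
  simp [GLq.parity_a, GLq.parity_D2inv, π, hp, h4]

/-- The quantum special linear supergroup `SL_q(4|1)`. -/
def SLq : Type := RingQuot SLRel

instance : Ring SLq := inferInstanceAs (Ring (RingQuot SLRel))

instance : Algebra Cq SLq := inferInstanceAs (Algebra Cq (RingQuot SLRel))

/-- The quotient map. -/
def SLq.mk : GLq →ₐ[Cq] SLq := RingQuot.mkAlgHom Cq SLRel

theorem SLq.rel {a b : GLq} (h : SLRel a b) : SLq.mk a = SLq.mk b := RingQuot.mkAlgHom_rel Cq h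

theorem SLq.rel_parity (a b : GLq) (h : SLRel a b) : SLq.mk (parity a) = SLq.mk (parity b) := by
  have h' := SLq.rel h
  cases h with
  | ber => rw [parity_quantumBer, h', map_one, map_one, map_one]

instance : SuperAlgebra SLq := SuperAlgebra.quot SLRel SLq.rel_parity

theorem SLq.parity_mk (f : GLq) : parity (SLq.mk f) = SLq.mk (parity f) :=
  SuperAlgebra.quot_parity SLRel SLq.rel_parity f

/-- The entries of the generating matrix of `SL_q(4|1)`. -/
def SLq.a (i j : Fin 5) : SLq := SLq.mk (GLq.a i j)

theorem SLq.parity_a (i j : Fin 5) : parity (SLq.a i j) = (-1 : Cq) ^ π i j • SLq.a i j := by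
  rw [SLq.a, SLq.parity_mk, GLq.parity_a, map_smul]

/-! ### The quantum lower parabolic supergroup -/

/-- The relations `a_ij = 0` for `i` among the first two indices and `j` among the last three. -/
inductive PRel : SLq → SLq → Prop
  | zero (i j : Fin 5) : i < 2 → 2 ≤ j → PRel (SLq.a i j) 0

/-- The superalgebra `O(P_{l,q})` of the quantum lower parabolic supergroup. -/
def Pq : Type := RingQuot PRel

instance : Ring Pq := inferInstanceAs (Ring (RingQuot PRel))

instance : Algebra Cq Pq := inferInstanceAs (Algebra Cq (RingQuot PRel))

/-- The quotient map. -/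
def Pq.mk : SLq →ₐ[Cq] Pq := RingQuot.mkAlgHom Cq PRel

theorem Pq.rel {a b : SLq} (h : PRel a b) : Pq.mk a = Pq.mk b := RingQuot.mkAlgHom_rel Cq h

theorem Pq.rel_parity (a b : SLq) (h : PRel a b) : Pq.mk (parity a) = Pq.mk (parity b) := by
  have h' := Pq.rel h
  cases h with
  | zero i j _ _ => rw [SLq.parity_a, map_smul, h', map_zero, map_zero, map_zero, smul_zero]

instance : SuperAlgebra Pq := SuperAlgebra.quot PRel Pq.rel_parity

theorem Pq.parity_mk (f : SLq) : parity (Pq.mk f) = Pq.mk (parity f) :=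
  SuperAlgebra.quot_parity PRel Pq.rel_parity f

/-- The generating matrix `g` of `O(P_{l,q})`. -/
def g : Matrix (Fin 5) (Fin 5) Pq := Matrix.of fun i j => Pq.mk (SLq.a i j)

/-! The change of variables
`g = (x, 0, 0; t x, y, y η; τ' x, d ξ, d)`, with `τ'` standing for `τ̃`, and `d τ = τ' x`.
Here `Ring.inverse` is the two-sided inverse; that `x`, `y`, `d` are invertible is part of the
theorem. -/

/-- The block `x`. -/
def x : Matrix (Fin 2) (Fin 2) Pq := g.submatrix ![0, 1] ![0, 1]

/-- The block `y`. -/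
def y : Matrix (Fin 2) (Fin 2) Pq := g.submatrix ![2, 3] ![2, 3]

/-- The entry `d`. -/
def d : Pq := g 4 4

/-- `t`, from `t x = (a_31, a_32; a_41, a_42)`. -/
def t : Matrix (Fin 2) (Fin 2) Pq := g.submatrix ![2, 3] ![0, 1] * Ring.inverse x

/-- `τ̃`, from `τ̃ x = (a_51, a_52)`. -/
def τtilde : Fin 2 → Pq := Matrix.vecMul (fun j => g 4 (![0, 1] j)) (Ring.inverse x)

/-- `τ`, from `d τ = τ̃ x = (a_51, a_52)`. -/
def τ : Fin 2 → Pq := fun j => Ring.inverse d * g 4 (![0, 1] j)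

/-- `ξ`, from `d ξ = (a_53, a_54)`. -/
def ξ : Fin 2 → Pq := fun j => Ring.inverse d * g 4 (![2, 3] j)

/-- `η`, from `y η = (a_35, a_45)ᵀ`. -/
def η : Fin 2 → Pq := Matrix.mulVec (Ring.inverse y) (fun i => g (![2, 3] i) 4)

/-! ### The quantum big cell -/

/-- The quantum big cell `O_q(U₁₂)`: the subalgebra of `O(P_{l,q})` generated by `t` and `τ̃`. -/
def U : Subalgebra Cq Pq :=
  Algebra.adjoin Cq ((Set.range fun ij : Fin 2 × Fin 2 => t ij.1 ij.2) ∪ Set.range τtilde)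

theorem parity_g (i j : Fin 5) : parity (g i j) = (-1 : Cq) ^ π i j • g i j := by
  rw [g, Matrix.of_apply, Pq.parity_mk, SLq.parity_a, map_smul]

theorem map_ring_inverse {M : Type*} [Ring M] (f : M →+* M) (hf : ∀ m, f (f m) = m) (m : M) :
    f (Ring.inverse m) = Ring.inverse (f m) := by
  by_cases h : IsUnit m
  · obtain ⟨u, rfl⟩ := h
    rw [Ring.inverse_unit]
    have : f (u : M) = (Units.map (f : M →* M) u : Mˣ) := rfl
    rw [this, Ring.inverse_unit]
    rfl
  · have h' : ¬ IsUnit (f m) := fun hu => h (by simpa [hf] using hu.map f)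
    rw [Ring.inverse_non_unit _ h, Ring.inverse_non_unit _ h', map_zero]

theorem parity_inverse_x (i j : Fin 2) : parity (Ring.inverse x i j) = Ring.inverse x i j := by
  have hx : (parity : Pq →ₐ[Cq] Pq).toRingHom.mapMatrix x = x := by
    ext i j
    change parity (g (![0, 1] i) (![0, 1] j)) = g (![0, 1] i) (![0, 1] j)
    fin_cases i <;> fin_cases j <;> simp [parity_g, π, p]
  have := map_ring_inverse ((parity : Pq →ₐ[Cq] Pq).toRingHom.mapMatrix)
    (fun m => by ext i j; simp [parity_parity]) x
  rw [hx] at this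
  exact congrFun (congrFun this i) j

theorem parity_t (i j : Fin 2) : parity (t i j) = t i j := by
  simp only [t, Matrix.mul_apply, map_sum, map_mul, parity_inverse_x]
  refine Finset.sum_congr rfl fun k _ => ?_
  fin_cases i <;> fin_cases k <;> simp [parity_g, π, p]

theorem parity_τtilde (j : Fin 2) : parity (τtilde j) = -τtilde j := by
  simp only [τtilde, Matrix.vecMul, dotProduct, map_sum, map_mul, parity_inverse_x,
    ← Finset.sum_neg_distrib]
  refine Finset.sum_congr rfl fun k _ => ?_
  fin_cases k <;> simp [parity_g, π, p]

theorem t_mem (i j : Fin 2) : t i j ∈ U := Algebra.subset_adjoin (Or.inl ⟨(i, j), rfl⟩)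

theorem τtilde_mem (j : Fin 2) : τtilde j ∈ U := Algebra.subset_adjoin (Or.inr ⟨j, rfl⟩)

theorem parity_mem_U (u : Pq) (hu : u ∈ U) : parity u ∈ U := by
  have : U ≤ U.comap (parity : Pq →ₐ[Cq] Pq) := by
    conv_lhs => rw [U]
    refine Algebra.adjoin_le ?_
    rintro _ (⟨ij, rfl⟩ | ⟨j, rfl⟩)
    · change parity (t ij.1 ij.2) ∈ U
      rw [parity_t]
      exact t_mem ij.1 ij.2
    · change parity (τtilde j) ∈ U
      rw [parity_τtilde]
      exact U.neg_mem (τtilde_mem j)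
  exact this hu

instance : SuperAlgebra U := SuperAlgebra.sub U parity_mem_U

/-- The generators `t_ij` as elements of the big cell. -/
def tU (i j : Fin 2) : U := ⟨t i j, t_mem i j⟩

/-- The generators `τ̃_j` as elements of the big cell. -/
def τU (j : Fin 2) : U := ⟨τtilde j, τtilde_mem j⟩

/-- `act f u δ v` is the value at `v` of the `C`-point `m ∘ (f ⊗ u) ∘ δ` of the big cell, which is
the result of letting the `C`-point `f` of the supergroup act on the `C`-point `u` of the big
cell through the coaction `δ`. -/
def act {C : Type*} [Ring C] [Algebra Cq C] (f : Pq →ₐ[Cq] C) (u : U →ₐ[Cq] C)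
    (δ : U →ₐ[Cq] STensor Pq U) (v : U) : C :=
  LinearMap.mul' Cq C (TensorProduct.map f.toLinearMap u.toLinearMap (lin δ v))

end QuantumBigCell

end

open QuantumBigCell

open scoped TensorProduct

set_option linter.unusedSimpArgs false

noncomputable section

namespace QuantumBigCell

open SuperAlgebra

/-! ### Manin matrices -/

/-! Algebra maps out of O(P_{l,q}) are given by matrices satisfying `IsPoint`: Manin matrices with
vanishing upper right block, invertible det_q x, det_q y and last entry, and Berezinian 1
(`IsPoint.exists_lift`, `Pq.algHom_ext`). The comultiplication, counit and antipode therefore come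
from three points: the product (g ⊗ 1)(1 ⊗ g), the identity matrix, and g⁻¹ over the opposite
algebra with its odd entries multiplied by √-1. The last twist turns a super anti-morphism into an
ordinary morphism to the opposite algebra.

Apart from the vanishing of squares of odd entries, the Manin relations say that the matrix of V ⊗ V
commutes with a braiding (`rtt_iff`), so they pass to products and inverses formally. The squares
need their own argument because q + q⁻¹ is not invertible in `Cq`. The Berezinian is handled by
Gauss decomposition of the lower right (2|1) × (2|1) block (Y, B; C, d). The Schur complement Z = Y
- B d⁻¹ C is again a quantum matrix, and `Manin21.qdet_eq` gives det_q Y = det_q Z · d⁻¹(d - C Y⁻¹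
B). This identity yields both the multiplicativity of the Berezinian (`Manin21.gauss_mul`) and its
value on the inverse (`IsPoint.antipode`).

Coassociativity and counitality compare algebra maps, so they are checked on the entries of g. The
antipode axioms are first strengthened to a statement that is multiplicative in its argument, and
then checked on the same entries.

From Δ(x⁻¹) = (1 ⊗ x⁻¹)(x⁻¹ ⊗ 1) the explicit formulas follow, and they show that Δ maps U into the
image of P ⊗ U. Lifting Δ to P ⊗ U requires P ⊗ U → P ⊗ P to be injective, which is obtained by
exhibiting U as a linear retract of P. With π the projection killing the lower left block and H the
block diagonal part, a ↦ ∑ a₁ S(π a₂) sends uh to ε(h)u, and a straightening argument gives P = U·H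
(`mem_UH`, `retr_mul`). The coaction axioms are then restrictions of Hopf axioms, and the formula on
points follows because x⁻¹ has even entries. -/

theorem qpow_mul_qpow_neg : qpow 1 * qpow (-1) = 1 := by
  rw [qpow, qpow, ← LaurentPolynomial.T_add]; simp

theorem qpow_neg_mul_qpow : qpow (-1) * qpow 1 = 1 := by
  rw [mul_comm, qpow_mul_qpow_neg]

/-- The Manin relations of `M_q`, for a matrix over an arbitrary algebra, with the parities of the
indices given by `p`. -/
structure IsManin {ι X : Type*} [LinearOrder ι] [Ring X] [Algebra Cq X] (p : ι → ℕ)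
    (T : Matrix ι ι X) : Prop where
  sq (i j : ι) : (p i + p j) % 2 = 1 → T i j * T i j = 0
  row (i j l : ι) : j < l → T i j * T i l =
    ((-1) ^ ((p i + p j) % 2 * ((p i + p l) % 2)) * qpow ((-1) ^ (p i + 1))) • (T i l * T i j)
  col (i j k : ι) : i < k → T i j * T k j =
    ((-1) ^ ((p i + p j) % 2 * ((p k + p j) % 2)) * qpow ((-1) ^ (p j + 1))) • (T k j * T i j)
  anti (i j k l : ι) : i < k → l < j → T i j * T k l =
    (-1 : Cq) ^ ((p i + p j) % 2 * ((p k + p l) % 2)) • (T k l * T i j)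
  diag (i j k l : ι) : i < k → j < l →
    T i j * T k l - (-1 : Cq) ^ ((p i + p j) % 2 * ((p k + p l) % 2)) • (T k l * T i j) =
      ((-1) ^ ((p i + p j) % 2 * ((p k + p j) % 2)) * (qpow (-1) - qpow 1)) • (T k j * T i l)

/-- The indices of odd parity are at the top of the order. -/
def TopOdd {ι : Type*} [LinearOrder ι] (p : ι → ℕ) : Prop :=
  ∀ i, p i = 0 ∨ (p i = 1 ∧ ∀ k, k ≤ i)

/-- An odd index is a greatest element, so in any comparison only the larger index can still be odd.
This keeps the sign analysis below finite and short. -/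
theorem TopOdd.of_lt {ι : Type*} [LinearOrder ι] {p : ι → ℕ} (hp : TopOdd p) {i k : ι}
    (h : i < k) : p i = 0 :=
  (hp i).resolve_right fun h' => absurd (h'.2 k) (not_le.2 h)

/-- Coefficient of `v_k v_i` in the braiding of `v_i v_k`. -/
def braidSwap {ι : Type*} [LinearOrder ι] (p : ι → ℕ) (i k : ι) : Cq :=
  if i = k then (if p i = 0 then qpow (-1) else -qpow 1) else 1

/-- Coefficient of `v_i v_k` in the braiding of `v_i v_k`. -/
def braidId {ι : Type*} [LinearOrder ι] (i k : ι) : Cq :=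
  if i < k then qpow (-1) - qpow 1 else 0

/-- The entrywise form of the compatibility of the comodule structure given by `T` with the
braiding. -/
def RTT {ι X : Type*} [LinearOrder ι] [Ring X] [Algebra Cq X] (p : ι → ℕ)
    (T : Matrix ι ι X) : Prop :=
  ∀ i k j l : ι,
    (braidSwap p i k * (-1) ^ (p j * (p i + p l))) • (T k j * T i l) +
      (braidId i k * (-1) ^ (p j * (p k + p l))) • (T i j * T k l) =
    (braidSwap p l j * (-1) ^ (p l * (p k + p j))) • (T i l * T k j) +
      (braidId j l * (-1) ^ (p j * (p k + p l))) • (T i j * T k l)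

/-! ### Equivalence of the Manin relations with the braiding relations -/

section
variable {ι X : Type*} [LinearOrder ι] [Ring X] [Algebra Cq X] {p : ι → ℕ} {T : Matrix ι ι X}

/-- The nine relative positions of (i, k) and (j, l) each reduce to one or two Manin relations. When
i = k and j = l the two braiding coefficients differ for indices of opposite parity, and the
relation holds because the odd entry squares to zero. -/
theorem IsManin.rtt (hp : TopOdd p) (hT : IsManin p T) : RTT p T := by
  intro i k j l
  have hq := qpow_mul_qpow_neg
  rcases lt_trichotomy i k with hik | rfl | hik <;> rcases lt_trichotomy j l with hjl | rfl | hjl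
  · have h1 := hT.anti i l k j hik hjl
    simp only [braidSwap, braidId, hik, hjl, hik.ne, hjl.ne', if_true, if_false, hp.of_lt hik,
      hp.of_lt hjl] at h1 ⊢
    rcases hp k with hk | ⟨hk, -⟩ <;> rcases hp l with hl | ⟨hl, -⟩ <;> simp [hk, hl] at h1 ⊢ <;>
      simp [h1]
  · have h1 := hT.col i j k hik
    have h2 := hT.sq
    simp only [braidSwap, braidId, hik, lt_irrefl, hik.ne, if_true, if_false, hp.of_lt hik] at h1 ⊢
    rcases hp k with hk | ⟨hk, -⟩ <;> rcases hp j with hl | ⟨hl, -⟩ <;> simp [hk, hl] at h1 ⊢ <;>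
      rw [h1] <;> match_scalars <;> grind
  · have h1 := hT.diag i l k j hik hjl
    have h2 := hT.anti i j k l hik hjl
    simp only [braidSwap, braidId, hik, hjl.not_gt, hik.ne, hjl.ne, if_true, if_false,
      hp.of_lt hik, hp.of_lt hjl] at h1 h2 ⊢
    rcases hp k with hk | ⟨hk, -⟩ <;> rcases hp j with hl | ⟨hl, -⟩ <;>
      simp [hk, hl] at h1 h2 ⊢ <;>
      rw [h2] <;> rw [sub_eq_iff_eq_add] at h1 <;> rw [h1] <;> match_scalars <;> grind
  · have h1 := hT.row i j l hjl
    simp only [braidSwap, braidId, hjl, hjl.ne', lt_irrefl, if_true, if_false, hp.of_lt hjl] at h1 ⊢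
    rcases hp i with hk | ⟨hk, -⟩ <;> rcases hp l with hl | ⟨hl, -⟩ <;> simp [hk, hl] at h1 ⊢ <;>
      rw [h1] <;> match_scalars <;> grind
  · have h1 := hT.sq i j
    simp only [braidSwap, braidId, lt_irrefl, if_true, if_false] at h1 ⊢
    rcases hp i with hk | ⟨hk, -⟩ <;> rcases hp j with hl | ⟨hl, -⟩ <;> simp [hk, hl] at h1 ⊢ <;>
      simp [h1]
  · have h1 := hT.row i l j hjl
    simp only [braidSwap, braidId, hjl.ne, hjl.not_gt, lt_irrefl, if_true, if_false,
      hp.of_lt hjl] at h1 ⊢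
    rcases hp i with hk | ⟨hk, -⟩ <;> rcases hp j with hl | ⟨hl, -⟩ <;> simp [hk, hl] at h1 ⊢ <;>
      rw [h1]
  · have h1 := hT.diag k j i l hik hjl
    have h2 := hT.anti k l i j hik hjl
    simp only [braidSwap, braidId, hik.not_gt, hjl, hik.ne', hjl.ne', if_true, if_false,
      hp.of_lt hik, hp.of_lt hjl] at h1 h2 ⊢
    rcases hp i with hk | ⟨hk, -⟩ <;> rcases hp l with hl | ⟨hl, -⟩ <;>
      simp [hk, hl] at h1 h2 ⊢ <;>
      rw [sub_eq_iff_eq_add] at h1 <;> rw [h1] <;> match_scalars <;> grind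
  · have h1 := hT.col k j i hik
    simp only [braidSwap, braidId, hik.not_gt, lt_irrefl, hik.ne', if_true, if_false,
      hp.of_lt hik] at h1 ⊢
    rcases hp i with hk | ⟨hk, -⟩ <;> rcases hp j with hl | ⟨hl, -⟩ <;> simp [hk, hl] at h1 ⊢ <;>
      rw [h1]; match_scalars <;> grind
  · have h1 := hT.anti k j i l hik hjl
    simp only [braidSwap, braidId, hik.not_gt, hjl.not_gt, hik.ne', hjl.ne, if_true, if_false,
      hp.of_lt hik, hp.of_lt hjl] at h1 ⊢
    rcases hp i with hk | ⟨hk, -⟩ <;> rcases hp j with hl | ⟨hl, -⟩ <;> simp [hk, hl] at h1 ⊢ <;>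
      simp [h1]

theorem RTT.row (hp : TopOdd p) (hT : RTT p T) (i j l : ι) (hjl : j < l) : T i j * T i l =
    ((-1) ^ ((p i + p j) % 2 * ((p i + p l) % 2)) * qpow ((-1) ^ (p i + 1))) •
      (T i l * T i j) := by
  have hq := qpow_mul_qpow_neg
  have h1 := hT i i l j
  simp only [braidSwap, braidId, hjl.ne, hjl.not_gt, lt_irrefl, if_true, if_false,
    hp.of_lt hjl] at h1 ⊢
  rcases hp i with hk | ⟨hk, -⟩ <;> rcases hp l with hl | ⟨hl, -⟩ <;> simp [hk, hl] at h1 ⊢ <;>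
    simp [← h1]

theorem RTT.col (hp : TopOdd p) (hT : RTT p T) (i j k : ι) (hik : i < k) : T i j * T k j =
    ((-1) ^ ((p i + p j) % 2 * ((p k + p j) % 2)) * qpow ((-1) ^ (p j + 1))) •
      (T k j * T i j) := by
  have hq := qpow_mul_qpow_neg
  have h1 := hT k i j j
  simp only [braidSwap, braidId, hik.not_gt, lt_irrefl, hik.ne', if_true, if_false,
    hp.of_lt hik] at h1 ⊢
  rcases hp k with hk | ⟨hk, -⟩ <;> rcases hp j with hl | ⟨hl, -⟩ <;> simp [hk, hl] at h1 ⊢ <;>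
    first | exact h1 | exact h1.symm | simp [← h1]

/-- For an odd entry the braiding relation only gives (q + q⁻¹) T_ij² = 0, and q + q⁻¹ is not a unit
of `Cq`. The vanishing of the squares is therefore the separate hypothesis `hsq`. -/
theorem RTT.isManin (hp : TopOdd p) (hT : RTT p T)
    (hsq : ∀ i j, (p i + p j) % 2 = 1 → T i j * T i j = 0) : IsManin p T := by
  refine ⟨hsq, hT.row hp, hT.col hp, fun i j k l hik hlj => ?_, fun i j k l hik hjl => ?_⟩
  · have h1 := hT i k l j
    simp only [braidSwap, braidId, hik, hlj, hik.ne, hlj.ne', if_true, if_false, hp.of_lt hik,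
      hp.of_lt hlj] at h1 ⊢
    rcases hp k with hk | ⟨hk, -⟩ <;> rcases hp j with hl | ⟨hl, -⟩ <;> simp [hk, hl] at h1 ⊢ <;>
      first | exact h1.symm | rw [h1, neg_neg]
  · have h1 := hT i k l j
    have h2 := hT i k j l
    simp only [braidSwap, braidId, hik, hjl.not_gt, hjl, hik.ne, hjl.ne, hjl.ne', if_true, if_false,
      hp.of_lt hik, hp.of_lt hjl] at h1 h2 ⊢
    rcases hp k with hk | ⟨hk, -⟩ <;> rcases hp l with hl | ⟨hl, -⟩ <;>
      simp [hk, hl] at h1 h2 ⊢ <;> simp [h2, ← h1, ← neg_smul]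
end

/-- A double sum with skew-symmetric off-diagonal terms reduces to its diagonal terms. -/
theorem sum_sum_eq_diag {ι X : Type*} [Fintype ι] [Ring X] [Algebra Cq X] (f : ι → ι → X)
    (h : ∀ a b, a ≠ b → f a b + f b a = 0) : ∑ a, ∑ b, f a b = ∑ a, f a a := by
  classical
  -- Adding the sum to its transpose pairs f a b with f b a; the resulting factor 2 is removed with
  -- `half`.
  have h1 : ∑ a, ∑ b, f a b + ∑ a, ∑ b, f a b = ∑ a, f a a + ∑ a, f a a := by
    conv_lhs => enter [2]; rw [Finset.sum_comm]
    rw [← Finset.sum_add_distrib, ← Finset.sum_add_distrib]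
    refine Finset.sum_congr rfl fun a _ => ?_
    rw [← Finset.sum_add_distrib]
    exact Finset.sum_eq_single a (fun b _ hb => h a b hb.symm) (by simp)
  have key (u : X) : half • (u + u) = u := by
    rw [smul_add, ← add_smul, half_add_half, one_smul]
  rw [← key (∑ a, ∑ b, f a b), h1, key]

/-! ### Products and inverses of Manin matrices -/

section
variable {ι X : Type*} [LinearOrder ι] [Fintype ι] [Ring X] [Algebra Cq X] {p : ι → ℕ}
  {T : Matrix ι ι X}

variable (X) in
/-- The matrix of the braiding of `V ⊗ V`. -/
def braidMatrix (p : ι → ℕ) : Matrix (ι × ι) (ι × ι) X := Matrix.of fun I J =>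
  algebraMap Cq X (if J = I.swap then braidSwap p I.1 I.2 else 0) +
    algebraMap Cq X (if J = I then braidId I.1 I.2 else 0)

/-- The matrix of the comodule `V ⊗ V`, with the Koszul signs. -/
def tensorSq (p : ι → ℕ) (T : Matrix ι ι X) : Matrix (ι × ι) (ι × ι) X := Matrix.of fun I J =>
  (-1 : Cq) ^ (p J.1 * (p I.2 + p J.2)) • (T I.1 J.1 * T I.2 J.2)

theorem braidMatrix_mul_apply (M : Matrix (ι × ι) (ι × ι) X) (I J : ι × ι) :
    (braidMatrix X p * M) I J = braidSwap p I.1 I.2 • M I.swap J + braidId I.1 I.2 • M I J := by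
  simp only [braidMatrix, Matrix.mul_apply, Matrix.of_apply, add_mul, Finset.sum_add_distrib,
    ← Algebra.smul_def, ite_smul, zero_smul, Finset.sum_ite_eq', Finset.mem_univ, if_true]

theorem mul_braidMatrix_apply (M : Matrix (ι × ι) (ι × ι) X) (I J : ι × ι) :
    (M * braidMatrix X p) I J = braidSwap p J.2 J.1 • M I J.swap + braidId J.1 J.2 • M I J := by
  have h (K : ι × ι) : J = K.swap ↔ J.swap = K :=
    ⟨fun h => by rw [h, Prod.swap_swap], fun h => by rw [← h, Prod.swap_swap]⟩
  simp only [braidMatrix, Matrix.mul_apply, Matrix.of_apply, mul_add, Finset.sum_add_distrib,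
    ← Algebra.commutes, ← Algebra.smul_def, ite_smul, zero_smul, h, Finset.sum_ite_eq,
    Finset.mem_univ, if_true]
  rfl

theorem rtt_iff : RTT p T ↔ braidMatrix X p * tensorSq p T = tensorSq p T * braidMatrix X p := by
  constructor
  · intro h
    ext ⟨i, k⟩ ⟨j, l⟩
    rw [braidMatrix_mul_apply, mul_braidMatrix_apply]
    simpa only [tensorSq, Matrix.of_apply, smul_smul, Prod.swap] using h i k j l
  · intro h i k j l
    have := congrFun (congrFun h (i, k)) (j, l)
    rw [braidMatrix_mul_apply, mul_braidMatrix_apply] at this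
    simpa only [tensorSq, Matrix.of_apply, smul_smul, Prod.swap] using this

/-- Two matrices with homogeneous entries which commute in the super sense. -/
def SuperCommute (p : ι → ℕ) (S T : Matrix ι ι X) : Prop :=
  ∀ i j k l, T i j * S k l = (-1 : Cq) ^ ((p i + p j) * (p k + p l)) • (S k l * T i j)

/-- Moving S k b past T a j produces a sign which, together with the Koszul signs of the two
factors, gives the Koszul sign of the product. The exponents agree only modulo 2, the discrepancy
being 2 p j p k. -/
theorem tensorSq_mul {S : Matrix ι ι X} (h : SuperCommute p S T) :
    tensorSq p (S * T) = tensorSq p S * tensorSq p T := by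
  ext ⟨i, k⟩ ⟨j, l⟩
  simp only [tensorSq, Matrix.mul_apply, Matrix.of_apply, Finset.sum_mul_sum, Finset.smul_sum,
    Fintype.sum_prod_type]
  refine Finset.sum_congr rfl fun a _ => Finset.sum_congr rfl fun b _ => ?_
  rw [mul_assoc, ← mul_assoc (T a j), h a j k b, smul_mul_assoc, mul_smul_comm, smul_smul,
    smul_mul_smul_comm, mul_assoc, mul_assoc, ← pow_add, ← pow_add]
  congr 1
  rw [neg_one_pow_eq_pow_mod_two, neg_one_pow_eq_pow_mod_two (n := _ + _)]
  congr 1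
  rw [← Nat.ModEq, ← ZMod.natCast_eq_natCast_iff]
  push_cast
  have h2 : (2 : ZMod 2) = 0 := rfl
  linear_combination (p j * p k : ZMod 2) * h2

theorem RTT.mul {S : Matrix ι ι X} (hS : RTT p S) (hT : RTT p T) (h : SuperCommute p S T) :
    RTT p (S * T) := by
  rw [rtt_iff] at *
  rw [tensorSq_mul h, ← mul_assoc, hS, mul_assoc, hT, mul_assoc]

/-- Only the squares are not formal. In the expansion of (ST)_ij² the terms (a, b) and (b, a) cancel
by the row relation of S and the column relation of T. A diagonal term vanishes because one of S_ia,
T_aj is odd. -/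
theorem IsManin.mul (hp : TopOdd p) {S : Matrix ι ι X} (hS : IsManin p S) (hT : IsManin p T)
    (h : SuperCommute p S T) : IsManin p (S * T) := by
  refine ((hS.rtt hp).mul (hT.rtt hp) h).isManin hp fun i j hij => ?_
  have hq := qpow_mul_qpow_neg
  have hsum : (S * T) i j * (S * T) i j = ∑ a, ∑ b,
      (-1 : Cq) ^ ((p a + p j) * (p i + p b)) • (S i a * S i b * (T a j * T b j)) := by
    simp only [Matrix.mul_apply, Finset.sum_mul_sum]
    refine Finset.sum_congr rfl fun a _ => Finset.sum_congr rfl fun b _ => ?_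
    rw [mul_assoc, ← mul_assoc (T a j), h a j i b, smul_mul_assoc, mul_smul_comm, mul_assoc,
      mul_assoc]
  rw [hsum, sum_sum_eq_diag]
  · refine Finset.sum_eq_zero fun a _ => ?_
    rcases Nat.mod_two_eq_zero_or_one (p i + p a) with h0 | h1
    · rw [hT.sq a j (by omega), mul_zero, smul_zero]
    · rw [hS.sq i a h1, zero_mul, smul_zero]
  · have key (a b : ι) (hab : a < b) :
        (-1 : Cq) ^ ((p a + p j) * (p i + p b)) • (S i a * S i b * (T a j * T b j)) +
          (-1 : Cq) ^ ((p b + p j) * (p i + p a)) • (S i b * S i a * (T b j * T a j)) = 0 := by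
      rw [hS.row i a b hab, hT.col a j b hab]
      simp only [hp.of_lt hab, smul_mul_smul_comm, smul_smul, ← add_smul]
      rcases hp i with hi | ⟨hi, -⟩ <;> rcases hp j with hj | ⟨hj, -⟩ <;>
        rcases hp b with hb | ⟨hb, -⟩ <;> simp [hi, hj] at hij <;>
        simp [hi, hj, hb, hq, mul_comm (qpow (-1))]
    intro a b hab
    rcases lt_or_gt_of_ne hab with hab | hab
    · exact key a b hab
    · rw [add_comm]; exact key b a hab

/-- The scalar `i = √-1`. -/
def sqrtNegOne : Cq := LaurentPolynomial.C Complex.I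

theorem sqrtNegOne_mul_self : sqrtNegOne * sqrtNegOne = -1 := by
  rw [sqrtNegOne, ← map_mul, Complex.I_mul_I, map_neg, map_one]

open MulOpposite in
/-- The matrix over the opposite algebra with entries those of `G`, the odd ones being multiplied
by `√-1`. -/
def opMatrix (p : ι → ℕ) (G : Matrix ι ι X) : Matrix ι ι Xᵐᵒᵖ := Matrix.of fun i j =>
  sqrtNegOne ^ ((p i + p j) % 2) • op (G i j)

/-- The inverse of `tensorSq`. -/
def tensorSqInv (p : ι → ℕ) (G : Matrix ι ι X) : Matrix (ι × ι) (ι × ι) X := Matrix.of fun I J =>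
  (-1 : Cq) ^ (p I.1 * (p I.2 + p J.2)) • (G I.2 J.2 * G I.1 J.1)

theorem neg_one_pow_mul_self (n : ℕ) : (-1 : Cq) ^ n * (-1) ^ n = 1 := by
  rw [← mul_pow]; simp

theorem tensorSq_mul_tensorSqInv {G : Matrix ι ι X} (h : T * G = 1) :
    tensorSq p T * tensorSqInv p G = 1 := by
  ext ⟨i, k⟩ ⟨j, l⟩
  have h' (a b : ι) : ∑ c, T a c * G c b = if a = b then 1 else 0 := by
    rw [← Matrix.mul_apply, h, Matrix.one_apply]
  have e (a b : ι) : (-1 : Cq) ^ (p a * (p k + p b)) • (T i a * T k b) *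
      (-1 : Cq) ^ (p a * (p b + p l)) • (G b l * G a j) =
      (-1 : Cq) ^ (p a * (p k + p l)) • (T i a * (T k b * G b l) * G a j) := by
    rw [smul_mul_smul_comm, ← pow_add, ← mul_add, mul_assoc, mul_assoc, mul_assoc]
    congr 1
    rw [show p k + p b + (p b + p l) = p k + p l + 2 * p b by ring, mul_add, pow_add,
      mul_left_comm, pow_mul _ 2]
    simp
  simp only [Matrix.mul_apply, tensorSq, tensorSqInv, Matrix.of_apply, Fintype.sum_prod_type, e,
    ← Finset.smul_sum, ← Finset.sum_mul, ← Finset.mul_sum, h', Matrix.one_apply, Prod.mk.injEq]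
  by_cases hkl : k = l
  · subst hkl
    simp [← two_mul, mul_left_comm (_ : ℕ) 2, pow_mul, h']
  · simp [hkl]

theorem tensorSqInv_mul_tensorSq {G : Matrix ι ι X} (h : G * T = 1) :
    tensorSqInv p G * tensorSq p T = 1 := by
  ext ⟨i, k⟩ ⟨j, l⟩
  have h' (a b : ι) : ∑ c, G a c * T c b = if a = b then 1 else 0 := by
    rw [← Matrix.mul_apply, h, Matrix.one_apply]
  have e (b a : ι) : (-1 : Cq) ^ (p i * (p k + p b)) • (G k b * G i a) *
      (-1 : Cq) ^ (p j * (p b + p l)) • (T a j * T b l) =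
      (-1 : Cq) ^ (p i * (p k + p b) + p j * (p b + p l)) • (G k b * (G i a * T a j) * T b l) := by
    rw [smul_mul_smul_comm, ← pow_add, mul_assoc, mul_assoc, mul_assoc]
  simp only [Matrix.mul_apply, tensorSq, tensorSqInv, Matrix.of_apply, Fintype.sum_prod_type_right,
    e, ← Finset.smul_sum, ← Finset.sum_mul, ← Finset.mul_sum, h', Matrix.one_apply, Prod.mk.injEq]
  by_cases hij : i = j
  · subst hij
    have (b : ι) : (-1 : Cq) ^ (p i * (p k + p b) + p i * (p b + p l)) =
        (-1) ^ (p i * (p k + p l)) := by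
      rw [← mul_add, show p k + p b + (p b + p l) = p k + p l + 2 * p b by ring, mul_add, pow_add,
        mul_left_comm, pow_mul _ 2]
      simp
    simp only [this, if_true, mul_one, ← Finset.smul_sum, h', true_and]
    split_ifs with hkl
    · subst hkl; simp [← two_mul, mul_left_comm (_ : ℕ) 2, pow_mul]
    · simp
  · simp [hij]

open MulOpposite in
-- A matrix commuting with the invertible `tensorSq p T` commutes with its inverse `tensorSqInv p
-- G`. The factors √-1 on odd entries absorb the signs by which `tensorSqInv` differs from a
-- `tensorSq` over the opposite algebra.
theorem RTT.opMatrix (hp : TopOdd p) (hT : RTT p T) {G : Matrix ι ι X} (h1 : T * G = 1)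
    (h2 : G * T = 1) : RTT p (opMatrix p G) := by
  rw [rtt_iff] at hT
  have hN := tensorSq_mul_tensorSqInv (p := p) h1
  have hN' := tensorSqInv_mul_tensorSq (p := p) h2
  have key : braidMatrix X p * tensorSqInv p G = tensorSqInv p G * braidMatrix X p := by
    calc _ = tensorSqInv p G * (tensorSq p T * braidMatrix X p) * tensorSqInv p G := by
          rw [← mul_assoc, hN', one_mul]
      _ = _ := by rw [← hT, mul_assoc, mul_assoc, hN, mul_one]
  have hI := sqrtNegOne_mul_self
  intro i k j l
  have := congrFun (congrFun key (i, k)) (j, l)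
  rw [braidMatrix_mul_apply, mul_braidMatrix_apply] at this
  simp only [tensorSqInv, Matrix.of_apply, smul_smul, Prod.swap] at this
  apply unop_injective
  simp only [QuantumBigCell.opMatrix, Matrix.of_apply, smul_mul_smul_comm, smul_smul, unop_add,
    unop_smul, unop_mul, unop_op]
  have h01 (i : ι) : p i = 0 ∨ p i = 1 := (hp i).imp id And.left
  rcases h01 i with hi | hi <;> rcases h01 j with hj | hj <;> rcases h01 k with hk | hk <;>
    rcases h01 l with hl | hl <;>
    simp [hi, hj, hk, hl, hI] at this ⊢ <;>
    -- According to the parities, the wanted relation is the one for `tensorSqInv` up to a common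
    -- factor 1, -1 or √-1.
    first
    | linear_combination (norm := module) this
    | linear_combination (norm := module) (-1 : Cq) • this
    | linear_combination (norm := module) sqrtNegOne • this

open MulOpposite in
-- The squares of odd entries are again the non-formal point. For j odd, ∑ (-1)^{p a} G_ia G_ib T_bj
-- T_aj is zero since GT = 1 and i ≠ j. Off-diagonal terms cancel in pairs and T_aj² = 0 for a ≠ j,
-- so G_ij² T_jj² = 0, and the invertibility of T_jj finishes. For i odd the roles of G and T are
-- exchanged.
theorem IsManin.opMatrix (hp : TopOdd p) (hT : IsManin p T) {G : Matrix ι ι X} (h1 : T * G = 1)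
    (h2 : G * T = 1) (ho : ∀ i, p i = 1 → IsUnit (T i i)) : IsManin p (opMatrix p G) := by
  have hR := (hT.rtt hp).opMatrix hp h1 h2
  refine hR.isManin hp fun i j hij => ?_
  have hq := qpow_mul_qpow_neg
  have hT1 (a b : ι) : ∑ c, T a c * G c b = if a = b then 1 else 0 := by
    rw [← Matrix.mul_apply, h1, Matrix.one_apply]
  have hT2 (a b : ι) : ∑ c, G a c * T c b = if a = b then 1 else 0 := by
    rw [← Matrix.mul_apply, h2, Matrix.one_apply]
  suffices G i j * G i j = 0 by
    simp only [QuantumBigCell.opMatrix, Matrix.of_apply, smul_mul_smul_comm, ← op_mul, this,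
      op_zero, smul_zero]
  have hu {i : ι} (hi : p i = 1) (hmax : ∀ k, k ≤ i) (a : ι) (ha : a ≠ i) : p a = 0 :=
    hp.of_lt (lt_of_le_of_ne (hmax a) ha)
  have hI := sqrtNegOne_mul_self
  have hq' := qpow_neg_mul_qpow
  have hcancel {c : Cq} {u v : X} (h : sqrtNegOne • u = (c * sqrtNegOne) • v) : u = c • v := by
    have := congrArg ((-sqrtNegOne) • ·) h
    simpa [smul_smul, mul_left_comm sqrtNegOne, hI] using this
  rcases hp i with hi | ⟨hi, hmax⟩ <;> rcases hp j with hj | ⟨hj, hmax⟩ <;> simp [hi, hj] at hij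
  · have hs : ∑ a, ∑ b, (-1 : Cq) ^ p a • (G i a * G i b * (T b j * T a j)) = 0 := by
      have hne : i ≠ j := by rintro rfl; omega
      have e (a b : ι) : G i a * G i b * (T b j * T a j) = G i a * (G i b * T b j) * T a j := by
        simp only [mul_assoc]
      simp only [e, ← Finset.smul_sum, ← Finset.mul_sum,
        ← Finset.sum_mul, hT2, hne, if_false, zero_mul, mul_zero, smul_zero, Finset.sum_const_zero]
    rw [sum_sum_eq_diag, Finset.sum_eq_single j] at hs
    · have hu := ho j hj
      rw [hj, pow_one, neg_smul, one_smul, neg_eq_zero] at hs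
      exact ((hu.mul hu).mul_left_eq_zero).1 hs
    · intro a _ ha
      rw [hT.sq a j (by rw [hu hj hmax a ha, hj]), mul_zero, smul_zero]
    · simp
    · have key (a b : ι) (hab : a < b) :
        (-1 : Cq) ^ p a • (G i a * G i b * (T b j * T a j)) +
          (-1 : Cq) ^ p b • (G i b * G i a * (T a j * T b j)) = 0 := by
        have h3 := congrArg unop (hR.row hp i a b hab)
        have h4 := hT.col a j b hab
        simp only [QuantumBigCell.opMatrix, Matrix.of_apply, smul_mul_smul_comm, smul_smul,
          unop_smul, unop_mul, unop_op, hi, hj, hp.of_lt hab] at h3 h4 ⊢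
        rcases hp b with hb | ⟨hb, -⟩ <;> simp [hb] at h3 h4 ⊢
        · rw [h3, h4, mul_neg, smul_mul_smul_comm, hq', one_smul, add_neg_cancel]
        · rw [hcancel h3, h4, smul_mul_smul_comm, hq', one_smul, add_neg_cancel]
      intro a b hab
      rcases lt_or_gt_of_ne hab with hab | hab
      · exact key a b hab
      · rw [add_comm]; exact key b a hab
  · have hs : ∑ a, ∑ b, (-1 : Cq) ^ p a • (T i a * T i b * (G b j * G a j)) = 0 := by
      have hne : i ≠ j := by rintro rfl; omega
      have e (a b : ι) : T i a * T i b * (G b j * G a j) = T i a * (T i b * G b j) * G a j := by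
        simp only [mul_assoc]
      simp only [e, ← Finset.smul_sum, ← Finset.mul_sum,
        ← Finset.sum_mul, hT1, hne, if_false, zero_mul, mul_zero, smul_zero, Finset.sum_const_zero]
    rw [sum_sum_eq_diag, Finset.sum_eq_single i] at hs
    · have hu := ho i hi
      rw [hi, pow_one, neg_smul, one_smul, neg_eq_zero] at hs
      exact ((hu.mul hu).mul_right_eq_zero).1 hs
    · intro a _ ha
      rw [hT.sq i a (by rw [hu hi hmax a ha, hi]), zero_mul, smul_zero]
    · simp
    · have key (a b : ι) (hab : a < b) :
        (-1 : Cq) ^ p a • (T i a * T i b * (G b j * G a j)) +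
          (-1 : Cq) ^ p b • (T i b * T i a * (G a j * G b j)) = 0 := by
        have h3 := congrArg unop (hR.col hp a j b hab)
        have h4 := hT.row i a b hab
        simp only [QuantumBigCell.opMatrix, Matrix.of_apply, smul_mul_smul_comm, smul_smul,
          unop_smul, unop_mul, unop_op, hi, hj, hp.of_lt hab] at h3 h4 ⊢
        rcases hp b with hb | ⟨hb, -⟩ <;> simp [hb] at h3 h4 ⊢
        · rw [h3, h4, neg_mul, smul_mul_smul_comm, hq, one_smul, neg_add_cancel]
        · rw [hcancel h3, h4, smul_mul_smul_comm, hq, one_smul, add_neg_cancel]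
      intro a b hab
      rcases lt_or_gt_of_ne hab with hab | hab
      · exact key a b hab
      · rw [add_comm]; exact key b a hab
end

/-! ### Quantum determinants -/

section
variable {X : Type*} [Ring X] [Algebra Cq X]

theorem qdet_fin_two (M : Matrix (Fin 2) (Fin 2) X) :
    qdet M = M 0 0 * M 1 1 - qpow (-1) • (M 0 1 * M 1 0) := by
  have h0 : inversions (1 : Equiv.Perm (Fin 2)) = 0 := by decide
  have h1 : inversions (Equiv.swap 0 1 : Equiv.Perm (Fin 2)) = 1 := by decide
  have hu : (Finset.univ : Finset (Equiv.Perm (Fin 2))) = {1, Equiv.swap 0 1} := by decide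
  have hne : (1 : Equiv.Perm (Fin 2)) ≠ Equiv.swap 0 1 := by decide
  have hq : qpow 0 = 1 := LaurentPolynomial.T_zero
  rw [qdet, hu, Finset.sum_pair hne, h0, h1]
  simp [List.ofFn_succ, hq, sub_eq_add_neg]

/-- The quantum determinant of a block lower triangular matrix. -/
theorem qdet_block (M : Matrix (Fin 4) (Fin 4) X) (h : ∀ i j : Fin 4, i < 2 → 2 ≤ j → M i j = 0) :
    qdet M = qdet (M.submatrix ![0, 1] ![0, 1]) * qdet (M.submatrix ![2, 3] ![2, 3]) := by
  let S : Finset (Equiv.Perm (Fin 4)) :=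
    {1, Equiv.swap 0 1, Equiv.swap 2 3, Equiv.swap 0 1 * Equiv.swap 2 3}
  -- A permutation outside S moves 0 or 1 into {2, 3}, and its term then contains an entry of the
  -- zero block.
  have hS : ∀ σ : Equiv.Perm (Fin 4), σ ∉ S → 2 ≤ σ 0 ∨ 2 ≤ σ 1 := by decide
  have h0 : inversions (1 : Equiv.Perm (Fin 4)) = 0 := by decide
  have h1 : inversions (Equiv.swap 0 1 : Equiv.Perm (Fin 4)) = 1 := by decide
  have h2 : inversions (Equiv.swap 2 3 : Equiv.Perm (Fin 4)) = 1 := by decide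
  have h3 : inversions (Equiv.swap 0 1 * Equiv.swap 2 3 : Equiv.Perm (Fin 4)) = 2 := by decide
  have hq : qpow 0 = 1 := LaurentPolynomial.T_zero
  have hq2 : qpow (-2) = qpow (-1) * qpow (-1) := by
    rw [qpow, qpow, ← LaurentPolynomial.T_add]; rfl
  have e : qdet M = ∑ σ ∈ S,
      ((-1) ^ inversions σ * qpow (-(inversions σ : ℤ))) • (List.ofFn fun i => M i (σ i)).prod := by
    refine (Finset.sum_subset (Finset.subset_univ S) fun σ _ hσ => ?_).symm
    rcases hS σ hσ with hσ | hσ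
    · simp [List.ofFn_succ, h 0 (σ 0) (by decide) hσ]
    · simp [List.ofFn_succ, h 1 (σ 1) (by decide) hσ]
  have n1 : (1 : Equiv.Perm (Fin 4)) ∉
    ({Equiv.swap 0 1, Equiv.swap 2 3, Equiv.swap 0 1 * Equiv.swap 2 3} :
      Finset (Equiv.Perm (Fin 4))) := by decide
  have n2 : (Equiv.swap 0 1 : Equiv.Perm (Fin 4)) ∉
    ({Equiv.swap 2 3, Equiv.swap 0 1 * Equiv.swap 2 3} : Finset (Equiv.Perm (Fin 4))) := by decide
  have n3 : (Equiv.swap 2 3 : Equiv.Perm (Fin 4)) ≠ Equiv.swap 0 1 * Equiv.swap 2 3 := by decide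
  have a0 : Equiv.swap (2 : Fin 4) 3 0 = 0 := by decide
  have a1 : Equiv.swap (2 : Fin 4) 3 1 = 1 := by decide
  have a2 : Equiv.swap (0 : Fin 4) 1 2 = 2 := by decide
  have a3 : Equiv.swap (0 : Fin 4) 1 3 = 3 := by decide
  rw [e, Finset.sum_insert n1, Finset.sum_insert n2, Finset.sum_pair n3, h0, h1, h2, h3,
    qdet_fin_two, qdet_fin_two]
  simp [List.ofFn_succ, hq, hq2, a0, a1, a2, a3, Fin.succ_one_eq_two,
    show (Fin.succ 2 : Fin 4) = 3 from rfl, sub_mul, mul_sub, smul_sub, smul_smul, mul_assoc]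
  abel

/-- The Schur complement of the last entry in the middle block of a `5 × 5` matrix, with `e` in the
role of the inverse of this entry. -/
def schur (T : Matrix (Fin 5) (Fin 5) X) (e : X) : Matrix (Fin 2) (Fin 2) X := Matrix.of fun i j =>
  T (![2, 3] i) (![2, 3] j) - T (![2, 3] i) 4 * e * T 4 (![2, 3] j)

/-- The conditions on a matrix `T` which make `g ↦ T` a morphism on `O(P_{l,q})`. -/
structure IsPoint (T : Matrix (Fin 5) (Fin 5) X) (e : X) : Prop where
  manin : IsManin p T
  zero (i j : Fin 5) : i < 2 → 2 ≤ j → T i j = 0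
  mul_inv : T 4 4 * e = 1
  inv_mul : e * T 4 4 = 1
  isUnit_x : IsUnit (qdet (T.submatrix ![0, 1] ![0, 1]))
  isUnit_y : IsUnit (qdet (T.submatrix ![2, 3] ![2, 3]))
  ber : qdet (T.submatrix ![0, 1] ![0, 1]) * qdet (schur T e) * e = 1

/-- The map is built through the three successive quotients. Both D₁ and the determinant in the
Berezinian belong to block lower triangular 4 × 4 matrices with upper left block x, so `qdet_block`
reduces their relations to the fields of `IsPoint`. -/
theorem IsPoint.exists_lift {T : Matrix (Fin 5) (Fin 5) X} {e : X} (hT : IsPoint T e) :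
    ∃ f : Pq →ₐ[Cq] X, ∀ i j, f (g i j) = T i j := by
  have k1 : ∀ i : Fin 4, i < 2 → i.castSucc < 2 := by decide
  have k2 : ∀ i : Fin 4, 2 ≤ i → 2 ≤ i.castSucc := by decide
  have hD : qdet (T.submatrix Fin.castSucc Fin.castSucc : Matrix (Fin 4) (Fin 4) X) =
      qdet (T.submatrix ![0, 1] ![0, 1]) * qdet (T.submatrix ![2, 3] ![2, 3]) := by
    rw [qdet_block]
    · congr 2 <;> ext i j <;> fin_cases i <;> fin_cases j <;> rfl
    · intro i j hi hj
      exact hT.zero _ _ (k1 i hi) (k2 j hj)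
  obtain ⟨D, hD'⟩ := hD ▸ hT.isUnit_x.mul hT.isUnit_y
  let F : Free →ₐ[Cq] X := FreeAlgebra.lift Cq fun
    | .a i j => T i j
    | .D1inv => (D⁻¹ : Xˣ)
    | .D2inv => e
  have Fa (i j : Fin 5) : F (fa i j) = T i j := FreeAlgebra.lift_ι_apply _ _
  have F1 : F (FreeAlgebra.ι Cq Gen.D1inv) = (D⁻¹ : Xˣ) := FreeAlgebra.lift_ι_apply _ _
  have F2 : F (FreeAlgebra.ι Cq Gen.D2inv) = e := FreeAlgebra.lift_ι_apply _ _
  have FD : F fD1 = D := by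
    rw [hD', fD1, map_qdet]
    congr 1
    ext i j
    exact Fa _ _
  have hF ⦃a b : Free⦄ (h : GLRel a b) : F a = F b := by
    have hm := hT.manin
    cases h with
    | sq i j h => rw [map_mul, Fa, map_zero, hm.sq i j h]
    | row i j l h => simpa only [map_mul, map_smul, Fa, π] using hm.row i j l h
    | col i j k h => simpa only [map_mul, map_smul, Fa, π] using hm.col i j k h
    | anti i j k l h =>
      simp only [map_mul, map_smul, Fa]
      rcases h with h | h
      · exact hm.anti i j k l h.1 h.2
      · have h1 := hm.anti k l i j h.1 h.2
        simp only [π]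
        rw [h1, smul_smul, mul_comm ((p i + p j) % 2), neg_one_pow_mul_self, one_smul]
    | diag i j k l h h' => simpa only [map_mul, map_smul, map_sub, Fa, π] using hm.diag i j k l h h'
    | D1_mul => rw [map_mul, FD, F1, map_one, Units.mul_inv]
    | mul_D1 => rw [map_mul, FD, F1, map_one, Units.inv_mul]
    | D2_mul => rw [map_mul, Fa, F2, map_one, hT.mul_inv]
    | mul_D2 => rw [map_mul, Fa, F2, map_one, hT.inv_mul]
  let F' : GLq →ₐ[Cq] X := RingQuot.liftAlgHom Cq (s := GLRel) ⟨F, hF⟩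
  have F'mk (u : Free) : F' (GLq.mk u) = F u := RingQuot.liftAlgHom_mkAlgHom_apply Cq F hF u
  have F'ber : F' quantumBer = 1 := by
    rw [quantumBer, map_mul, map_qdet, GLq.D2inv, F'mk, F2]
    rw [qdet_block]
    · rw [← hT.ber]
      congr 3
      · ext i j
        fin_cases i <;> fin_cases j <;>
          simp [GLq.a, F'mk, Fa, F2, hT.zero 0 4 (by decide) (by decide),
            hT.zero 1 4 (by decide) (by decide)]
      · ext i j
        fin_cases i <;> fin_cases j <;> simp [GLq.a, F'mk, Fa, F2, schur]
    · intro i j hi hj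
      have h1 : T i.castSucc j.castSucc = 0 :=
        hT.zero _ _ (k1 i hi) (k2 j hj)
      have h2 : T i.castSucc 4 = 0 := hT.zero _ _ (k1 i hi) (by decide)
      simp [GLq.a, F'mk, Fa, F2, h1, h2]
  have hF' ⦃a b : GLq⦄ (h : SLRel a b) : F' a = F' b := by
    cases h with
    | ber => rw [F'ber, map_one]
  let F'' : SLq →ₐ[Cq] X := RingQuot.liftAlgHom Cq (s := SLRel) ⟨F', hF'⟩
  have F''mk (u : GLq) : F'' (SLq.mk u) = F' u := RingQuot.liftAlgHom_mkAlgHom_apply Cq F' hF' u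
  have F''a (i j : Fin 5) : F'' (SLq.a i j) = T i j := by
    rw [SLq.a, F''mk, GLq.a, F'mk, Fa]
  have hF'' ⦃a b : SLq⦄ (h : PRel a b) : F'' a = F'' b := by
    cases h with
    | zero i j hi hj => rw [F''a, map_zero, hT.zero i j hi hj]
  refine ⟨RingQuot.liftAlgHom Cq (s := PRel) ⟨F'', hF''⟩, fun i j => ?_⟩
  exact (RingQuot.liftAlgHom_mkAlgHom_apply Cq F'' hF'' _).trans (F''a i j)

end

/-! ### The generating matrix of `O(P_{l,q})` -/

theorem topOdd_p : TopOdd p := by unfold TopOdd; decide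

/-- The inverse of `d`. -/
def dinv : Pq := Pq.mk (SLq.mk GLq.D2inv)

/-- The quotient map from the free algebra. -/
def Pq.ofFree : Free →ₐ[Cq] Pq := (Pq.mk.comp SLq.mk).comp GLq.mk

theorem Pq.ofFree_surjective : Function.Surjective Pq.ofFree :=
  ((RingQuot.mkAlgHom_surjective Cq PRel).comp (RingQuot.mkAlgHom_surjective Cq SLRel)).comp
    (RingQuot.mkAlgHom_surjective Cq GLRel)

theorem Pq.ofFree_rel {a b : Free} (h : GLRel a b) : Pq.ofFree a = Pq.ofFree b :=
  congrArg (fun u => Pq.mk (SLq.mk u)) (GLq.rel h)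

theorem Pq.ofFree_fa (i j : Fin 5) : Pq.ofFree (fa i j) = g i j := rfl

theorem isManin_g : IsManin p g where
  sq i j h := by simpa only [map_mul, map_zero, Pq.ofFree_fa, π] using Pq.ofFree_rel (GLRel.sq i j h)
  row i j l h := by
    simpa only [map_mul, map_smul, Pq.ofFree_fa, π] using Pq.ofFree_rel (GLRel.row i j l h)
  col i j k h := by
    simpa only [map_mul, map_smul, Pq.ofFree_fa, π] using Pq.ofFree_rel (GLRel.col i j k h)
  anti i j k l h h' := by
    simpa only [map_mul, map_smul, Pq.ofFree_fa, π] using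
      Pq.ofFree_rel (GLRel.anti i j k l (Or.inl ⟨h, h'⟩))
  diag i j k l h h' := by
    simpa only [map_mul, map_smul, map_sub, Pq.ofFree_fa, π] using
      Pq.ofFree_rel (GLRel.diag i j k l h h')

theorem g_zero (i j : Fin 5) (hi : i < 2) (hj : 2 ≤ j) : g i j = 0 := by
  have := Pq.rel (PRel.zero i j hi hj)
  rwa [map_zero] at this

/-- The entries of the block `x` commute with those of the lower right block. -/
theorem g_commute {i j k l : Fin 5} (hi : i < 2) (hj : j < 2) (hk : 2 ≤ k) (hl : 2 ≤ l) :
    Commute (g i j) (g k l) := by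
  have h := isManin_g.diag i j k l (hi.trans_le hk) (hj.trans_le hl)
  have e : ∀ i : Fin 5, i < 2 → p i = 0 := by decide
  rw [g_zero i l hi hl, mul_zero, smul_zero, e i hi, e j hj] at h
  exact sub_eq_zero.1 (by simpa using h)

theorem commute_qdet {X : Type*} [Ring X] [Algebra Cq X] {M : Matrix (Fin 2) (Fin 2) X} {u : X}
    (h : ∀ i j, Commute (M i j) u) : Commute (qdet M) u := by
  rw [qdet_fin_two]
  exact ((h 0 0).mul_left (h 1 1)).sub_left (((h 0 1).mul_left (h 1 0)).smul_left _)

theorem ofFree_fD1 : Pq.ofFree fD1 = qdet x * qdet y := by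
  have k1 : ∀ i : Fin 4, i < 2 → i.castSucc < 2 := by decide
  have k2 : ∀ i : Fin 4, 2 ≤ i → 2 ≤ i.castSucc := by decide
  rw [fD1, map_qdet, qdet_block]
  · congr 2 <;> ext i j <;> fin_cases i <;> fin_cases j <;> rfl
  · intro i j hi hj
    exact g_zero _ _ (k1 i hi) (k2 j hj)

/-- Only the product D₁ = det_q x · det_q y is inverted by construction. The two factors commute,
since the zero block makes the entries of x commute with those of y, hence each of them is a unit.
-/
theorem isPoint_g : IsPoint g dinv := by
  have hD : Pq.ofFree fD1 = qdet (g.submatrix ![0, 1] ![0, 1]) * qdet (g.submatrix ![2, 3] ![2, 3]) :=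
    ofFree_fD1
  have h1 := Pq.ofFree_rel GLRel.D1_mul
  have h2 := Pq.ofFree_rel GLRel.mul_D1
  rw [map_mul, map_one] at h1 h2
  have hu : IsUnit (Pq.ofFree fD1) := ⟨⟨_, _, h1, h2⟩, rfl⟩
  have hc : Commute (qdet (g.submatrix ![0, 1] ![0, 1])) (qdet (g.submatrix ![2, 3] ![2, 3])) := by
    refine commute_qdet fun i j => (commute_qdet fun k l => ?_).symm
    refine (g_commute ?_ ?_ ?_ ?_).symm
    · revert i; decide
    · revert j; decide
    · revert k; decide
    · revert l; decide
  rw [hD, hc.isUnit_mul_iff] at hu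
  refine ⟨isManin_g, g_zero, ?_, ?_, hu.1, hu.2, ?_⟩
  · exact (map_mul _ _ _).symm.trans ((Pq.ofFree_rel GLRel.D2_mul).trans (map_one _))
  · exact (map_mul Pq.ofFree (FreeAlgebra.ι Cq Gen.D2inv) (fa 4 4)).symm.trans
      ((Pq.ofFree_rel GLRel.mul_D2).trans (map_one _))
  · obtain ⟨F, hF⟩ : ∃ F : GLq →ₐ[Cq] Pq, F = Pq.mk.comp SLq.mk := ⟨_, rfl⟩
    have h : F quantumBer = 1 := by
      rw [hF, AlgHom.comp_apply, SLq.rel SLRel.ber, map_one, map_one]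
    have k1 : ∀ i : Fin 4, i < 2 → i.castSucc < 2 := by decide
    have k2 : ∀ i : Fin 4, 2 ≤ i → 2 ≤ i.castSucc := by decide
    have ea (i j : Fin 5) : F (GLq.a i j) = g i j := by rw [hF]; rfl
    have ed : F GLq.D2inv = dinv := by rw [hF]; rfl
    rw [quantumBer, map_mul, map_qdet, ed, qdet_block] at h
    · rw [← h]
      congr 3
      · ext i j
        fin_cases i <;> fin_cases j <;>
          simp [ea, ed, g_zero 0 4 (by decide) (by decide),
            g_zero 1 4 (by decide) (by decide)]
      · ext i j
        fin_cases i <;> fin_cases j <;> simp [ea, ed, schur]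
    · intro i j hi hj
      have h1 : g i.castSucc j.castSucc = 0 := g_zero _ _ (k1 i hi) (k2 j hj)
      have h2 : g i.castSucc 4 = 0 := g_zero _ _ (k1 i hi) (by decide)
      simp [ea, ed, h1, h2]

/-- The inverse of the quantum determinant of the even block. -/
def D1inv : Pq := Pq.ofFree (FreeAlgebra.ι Cq Gen.D1inv)

theorem ofFree_fD1_mul_D1inv : Pq.ofFree fD1 * D1inv = 1 := by
  rw [D1inv, ← map_mul, Pq.ofFree_rel GLRel.D1_mul, map_one]

theorem D1inv_mul_ofFree_fD1 : D1inv * Pq.ofFree fD1 = 1 := by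
  rw [D1inv, ← map_mul, Pq.ofFree_rel GLRel.mul_D1, map_one]

theorem Pq.eq_top_of_gen_mem {S : Subalgebra Cq Pq} (hg : ∀ i j, g i j ∈ S)
    (h1 : D1inv ∈ S) (h2 : dinv ∈ S) : S = ⊤ := by
  refine eq_top_iff.2 fun u _ => ?_
  obtain ⟨u, rfl⟩ := Pq.ofFree_surjective u
  induction u using FreeAlgebra.induction with
  | grade0 r => rw [AlgHom.commutes]; exact S.algebraMap_mem r
  | grade1 x =>
    cases x with
    | a i j => exact hg i j
    | D1inv => exact h1
    | D2inv => exact h2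
  | mul a b ha hb => rw [map_mul]; exact S.mul_mem (ha trivial) (hb trivial)
  | add a b ha hb => rw [map_add]; exact S.add_mem (ha trivial) (hb trivial)

/-- The two adjoined elements are inverses of polynomials in the g i j, so closure under two-sided
inverses spares a separate check for them. -/
theorem Pq.eq_top_of_mem {S : Subalgebra Cq Pq} (hg : ∀ i j, g i j ∈ S)
    (hinv : ∀ a b, a * b = 1 → b * a = 1 → a ∈ S → b ∈ S) : S = ⊤ := by
  have hD : Pq.ofFree fD1 ∈ S := by
    rw [fD1, map_qdet]
    refine sum_mem fun σ _ => S.smul_mem (list_prod_mem ?_) _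
    intro u hu
    obtain ⟨i, rfl⟩ := (List.mem_ofFn' _ _).1 hu
    exact hg _ _
  exact Pq.eq_top_of_gen_mem hg (hinv _ _ ofFree_fD1_mul_D1inv D1inv_mul_ofFree_fD1 hD)
    (hinv _ _ isPoint_g.mul_inv isPoint_g.inv_mul (hg 4 4))

theorem Pq.algHom_ext {X : Type*} [Ring X] [Algebra Cq X] {f f' : Pq →ₐ[Cq] X}
    (h : ∀ i j, f (g i j) = f' (g i j)) : f = f' := by
  have : AlgHom.equalizer f f' = ⊤ := by
    refine Pq.eq_top_of_mem h fun a b hab hba ha => ?_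
    change f a = f' a at ha
    change f b = f' b
    calc f b = f b * f' (a * b) := by rw [hab, map_one, mul_one]
      _ = f (b * a) * f' b := by rw [map_mul, ← ha, map_mul, mul_assoc]
      _ = f' b := by rw [hba, map_one, one_mul]
  ext u
  exact (this ▸ Algebra.mem_top : u ∈ AlgHom.equalizer f f')

/-! ### Gauss decomposition of `(2|1) × (2|1)` Manin matrices -/

theorem reassoc {X : Type*} [Semigroup X] {a b c : X} (h : a * b = c) (x : X) :
    a * (b * x) = c * x := by rw [← mul_assoc, h]

section
variable {X : Type*} [Ring X] [Algebra Cq X]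

/-- The relations of a `2 × 2` quantum matrix. -/
structure QMat (Y : Matrix (Fin 2) (Fin 2) X) : Prop where
  row (i) : Y i 0 * Y i 1 = qpow (-1) • (Y i 1 * Y i 0)
  col (j) : Y 0 j * Y 1 j = qpow (-1) • (Y 1 j * Y 0 j)
  anti : Y 0 1 * Y 1 0 = Y 1 0 * Y 0 1
  diag : Y 0 0 * Y 1 1 = Y 1 1 * Y 0 0 + (qpow (-1) - qpow 1) • (Y 1 0 * Y 0 1)

/-- The relations between a quantum matrix `Y` and an odd column `B`. -/
structure QCol (Y : Matrix (Fin 2) (Fin 2) X) (B : Fin 2 → X) : Prop where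
  row (i j) : Y i j * B i = qpow (-1) • (B i * Y i j)
  anti (j) : Y 1 j * B 0 = B 0 * Y 1 j
  diag (j) : Y 0 j * B 1 = B 1 * Y 0 j + (qpow (-1) - qpow 1) • (Y 1 j * B 0)

/-- The relations between a quantum matrix `Y` and an odd row `C`. -/
structure QRow (Y : Matrix (Fin 2) (Fin 2) X) (C : Fin 2 → X) : Prop where
  col (i j) : Y i j * C j = qpow (-1) • (C j * Y i j)
  anti (i) : Y i 1 * C 0 = C 0 * Y i 1
  diag (i) : Y i 0 * C 1 = C 1 * Y i 0 + (qpow (-1) - qpow 1) • (C 0 * Y i 1)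

/-- The relations between the components of an odd row or column. -/
structure QOdd (B : Fin 2 → X) : Prop where
  sq (i) : B i * B i = 0
  swap : B 0 * B 1 = -(qpow 1 • (B 1 * B 0))

/-- The relations between the blocks of a `(2|1) × (2|1)` Manin matrix. -/
structure Manin21 (Y : Matrix (Fin 2) (Fin 2) X) (B C : Fin 2 → X) (d : X) : Prop where
  y : QMat Y
  yB : QCol Y B
  yC : QRow Y C
  oB : QOdd B
  oC : QOdd C
  CB (i j) : C j * B i = -(B i * C j)
  Bd (i) : B i * d = qpow 1 • (d * B i)
  Cd (i) : C i * d = qpow 1 • (d * C i)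
  yd (i j) : Y i j * d = d * Y i j + (qpow (-1) - qpow 1) • (C j * B i)

variable {Y Z : Matrix (Fin 2) (Fin 2) X} {B C : Fin 2 → X} {d e : X}

theorem QOdd.swap' (h : QOdd B) : B 1 * B 0 = -(qpow (-1) • (B 0 * B 1)) := by
  rw [h.swap, smul_neg, smul_smul, qpow_neg_mul_qpow, one_smul, neg_neg]

theorem inv_swap (hde : d * e = 1) (hed : e * d = 1) {u : X} (h : u * d = qpow 1 • (d * u)) :
    e * u = qpow 1 • (u * e) := by
  calc e * u = e * (u * d) * e := by rw [mul_assoc, mul_assoc, hde, mul_one]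
    _ = _ := by rw [h, mul_smul_comm, ← mul_assoc, hed, one_mul, smul_mul_assoc]

theorem mul_d_swap {u : X} (h : u * d = qpow 1 • (d * u)) : d * u = qpow (-1) • (u * d) := by
  rw [h, smul_smul, qpow_neg_mul_qpow, one_smul]

/-- The relations between the Schur complement `Z` and the other blocks. -/
theorem Manin21.schur_row (h : Manin21 Y B C d) (hde : d * e = 1) (hed : e * d = 1)
    (hZ : ∀ i j, Y i j = Z i j + B i * (e * C j)) : QRow Z C := by
  have hq := qpow_mul_qpow_neg
  have eC (j) := inv_swap hde hed (h.Cd j)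
  constructor
  · intro i j
    have h1 := h.yC.col i j
    simp only [hZ, add_mul, mul_add, mul_assoc, h.oC.sq, reassoc (h.oC.sq _), reassoc (h.CB _ _),
      neg_mul, mul_neg, smul_mul_assoc, mul_smul_comm, eC, zero_mul, mul_zero, add_zero, smul_zero,
      neg_zero] at h1
    exact h1
  · intro i
    have h1 := h.yC.anti i
    simp only [hZ, add_mul, mul_add, mul_assoc, h.oC.sq, reassoc (h.oC.sq _), reassoc (h.CB _ _),
      neg_mul, mul_neg, smul_mul_assoc, mul_smul_comm, eC, zero_mul, mul_zero, add_zero, smul_zero,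
      neg_zero, h.oC.swap', reassoc h.oC.swap', reassoc (eC _), smul_neg, smul_smul] at h1
    -- Once the monomials are in normal order, only an identity between scalars remains, decided by
    -- q q⁻¹ = 1. The same scheme is used in the computations below.
    linear_combination (norm := (match_scalars <;> grind)) h1
  · intro i
    have h1 := h.yC.diag i
    simp only [hZ, add_mul, mul_add, mul_assoc, h.oC.sq, reassoc (h.oC.sq _), reassoc (h.CB _ _),
      neg_mul, mul_neg, smul_mul_assoc, mul_smul_comm, eC, zero_mul, mul_zero, add_zero, smul_zero,
      neg_zero, h.oC.swap', reassoc h.oC.swap', reassoc (eC _), smul_neg, smul_smul] at h1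
    linear_combination (norm := (match_scalars <;> grind)) h1

theorem Manin21.schur_col (h : Manin21 Y B C d) (hde : d * e = 1) (hed : e * d = 1)
    (hZ : ∀ i j, Y i j = Z i j + B i * (e * C j)) : QCol Z B := by
  have hq := qpow_mul_qpow_neg
  have eB (j) := inv_swap hde hed (h.Bd j)
  have eC (j) := inv_swap hde hed (h.Cd j)
  constructor
  · intro i j
    have h1 := h.yB.row i j
    simp only [hZ, add_mul, mul_add, mul_assoc, h.oB.sq, reassoc (h.oB.sq _), h.CB,
      neg_mul, mul_neg, smul_mul_assoc, mul_smul_comm, reassoc (eB _), zero_mul, mul_zero, add_zero,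
      smul_zero, neg_zero] at h1
    exact h1
  · intro i
    have h1 := h.yB.anti i
    simp only [hZ, add_mul, mul_add, mul_assoc, reassoc (eB _), eB, reassoc (eC _), h.CB,
      reassoc (h.CB _ _), h.oB.swap', reassoc h.oB.swap',
      neg_mul, mul_neg, smul_mul_assoc, mul_smul_comm, eC, smul_neg, smul_smul] at h1
    linear_combination (norm := (match_scalars <;> grind)) h1
  · intro i
    have h1 := h.yB.diag i
    simp only [hZ, add_mul, mul_add, mul_assoc, reassoc (eB _), eB, reassoc (eC _), h.CB,
      reassoc (h.CB _ _), h.oB.swap', reassoc h.oB.swap',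
      neg_mul, mul_neg, smul_mul_assoc, mul_smul_comm, eC, smul_neg, smul_smul] at h1
    linear_combination (norm := (match_scalars <;> grind)) h1

/-- The commutator of B e C with d is (q - q⁻¹) B C, which is exactly the correction term of the
relation `yd`. Removing B e C from Y therefore leaves entries that commute with d. -/
theorem Manin21.schur_d (h : Manin21 Y B C d) (hde : d * e = 1) (hed : e * d = 1)
    (hZ : ∀ i j, Y i j = Z i j + B i * (e * C j)) (i j) : Z i j * d = d * Z i j := by
  have hq := qpow_mul_qpow_neg
  have eC (j) := inv_swap hde hed (h.Cd j)
  have dB (j) := mul_d_swap (h.Bd j)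
  have h1 := h.yd i j
  simp only [hZ, add_mul, mul_add, mul_assoc, h.CB, h.Cd, reassoc (dB _), reassoc hed,
    reassoc hde, one_mul, mul_one,
    neg_mul, mul_neg, smul_mul_assoc, mul_smul_comm, smul_neg, smul_smul] at h1
  linear_combination (norm := (match_scalars <;> grind)) h1

/-- Substituting Y = Z + B e C in a relation for Y and bringing the factors into a fixed order makes
all terms containing B and C cancel. What is left is the same relation for Z. -/
theorem Manin21.schur_qmat (h : Manin21 Y B C d) (hde : d * e = 1) (hed : e * d = 1)
    (hZ : ∀ i j, Y i j = Z i j + B i * (e * C j)) : QMat Z := by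
  have hq := qpow_mul_qpow_neg
  have eB (j) := inv_swap hde hed (h.Bd j)
  have eC (j) := inv_swap hde hed (h.Cd j)
  have zB := h.schur_col hde hed hZ
  have zC := h.schur_row hde hed hZ
  have zd := h.schur_d hde hed hZ
  have ze (i j) : Z i j * e = e * Z i j :=
    ((show Commute (Z i j) d from zd i j).units_inv_right (u := ⟨d, e, hde, hed⟩)).eq
  constructor
  · intro i
    have h1 := h.y.row i
    have a1 := zC.diag i
    have a2 := zC.anti i
    have a3 := zC.col i
    simp only [hZ, add_mul, mul_add, mul_assoc, reassoc (zB.row _ _), reassoc (ze _ _), a1, a2, a3,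
      reassoc (eB _), h.CB, reassoc (h.CB _ _), h.oB.sq, reassoc (h.oB.sq _), zero_mul, mul_zero,
      neg_mul, mul_neg, smul_mul_assoc, mul_smul_comm, smul_neg, smul_smul, add_zero, smul_zero,
      neg_zero] at h1
    linear_combination (norm := (match_scalars <;> grind)) h1
  · intro j
    have h1 := h.y.col j
    simp only [hZ, add_mul, mul_add, mul_assoc, reassoc (zB.diag _), reassoc (zB.anti _),
      reassoc (zB.row _ _), reassoc (ze _ _), ze, reassoc (zC.col _ _), reassoc (zC.diag _),
      reassoc (zC.anti _), zC.col,
      reassoc (eB _), eC, reassoc (eC _), h.oB.swap', reassoc h.oB.swap',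
      h.CB, reassoc (h.CB _ _), h.oC.sq, reassoc (h.oC.sq _), zero_mul, mul_zero,
      neg_mul, mul_neg, smul_mul_assoc, mul_smul_comm, smul_neg, smul_smul, add_zero, smul_zero,
      neg_zero, smul_add] at h1
    linear_combination (norm := (match_scalars <;> grind)) h1
  · have h1 := h.y.anti
    simp only [hZ, add_mul, mul_add, mul_assoc, reassoc (zB.diag _), reassoc (zB.anti _),
      reassoc (zB.row _ _), reassoc (ze _ _), ze, reassoc (zC.col _ _), reassoc (zC.diag _),
      reassoc (zC.anti _), zC.col, zC.diag, zC.anti,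
      reassoc (eB _), eC, reassoc (eC _), h.oB.swap', reassoc h.oB.swap',
      h.oC.swap', reassoc h.oC.swap',
      h.CB, reassoc (h.CB _ _), h.oC.sq, reassoc (h.oC.sq _), zero_mul, mul_zero,
      neg_mul, mul_neg, smul_mul_assoc, mul_smul_comm, smul_neg, smul_smul, add_zero, smul_zero,
      neg_zero, smul_add] at h1
    linear_combination (norm := (match_scalars <;> grind)) h1
  · have h1 := h.y.diag
    simp only [hZ, add_mul, mul_add, mul_assoc, reassoc (zB.diag _), reassoc (zB.anti _),
      reassoc (zB.row _ _), reassoc (ze _ _), ze, reassoc (zC.col _ _), reassoc (zC.diag _),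
      reassoc (zC.anti _), zC.col, zC.diag, zC.anti,
      reassoc (eB _), eC, reassoc (eC _), h.oB.swap', reassoc h.oB.swap',
      h.oC.swap', reassoc h.oC.swap',
      h.CB, reassoc (h.CB _ _), h.oC.sq, reassoc (h.oC.sq _), zero_mul, mul_zero,
      neg_mul, mul_neg, smul_mul_assoc, mul_smul_comm, smul_neg, smul_smul, add_zero, smul_zero,
      neg_zero, smul_add] at h1
    linear_combination (norm := (match_scalars <;> grind)) h1
end

/-! ### The quantum adjugate and the invertibility of quantum determinants -/

section
variable {X : Type*} [Ring X] [Algebra Cq X]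
variable {Y Z : Matrix (Fin 2) (Fin 2) X} {B C : Fin 2 → X} {d e : X}

/-- The quantum adjugate of a `2 × 2` matrix. -/
def qadj (Z : Matrix (Fin 2) (Fin 2) X) : Matrix (Fin 2) (Fin 2) X :=
  !![Z 1 1, -(qpow 1 • Z 0 1); -(qpow (-1) • Z 1 0), Z 0 0]

theorem QMat.mul_qadj (h : QMat Z) : Z * qadj Z = Matrix.diagonal fun _ => qdet Z := by
  have hq := qpow_mul_qpow_neg
  ext i j
  fin_cases i <;> fin_cases j <;>
    simp [Matrix.mul_apply, Fin.sum_univ_two, qadj, qdet_fin_two, h.row, h.diag, h.anti, smul_smul,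
      hq] <;> match_scalars <;> grind

theorem QMat.qadj_mul (h : QMat Z) : qadj Z * Z = Matrix.diagonal fun _ => qdet Z := by
  have hq := qpow_mul_qpow_neg
  ext i j
  fin_cases i <;> fin_cases j <;>
    simp [Matrix.mul_apply, Fin.sum_univ_two, qadj, qdet_fin_two, h.col, h.diag, h.anti, smul_smul,
      hq] <;> match_scalars <;> grind

/-- Both bracketings of Z · qadj Z · Z are compared: the determinant appears on the left in one and
on the right in the other. -/
theorem QMat.qdet_commute (h : QMat Z) (i j) : qdet Z * Z i j = Z i j * qdet Z := by
  have h1 := congrFun (congrFun (mul_assoc Z (qadj Z) Z) i) j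
  rw [h.mul_qadj, h.qadj_mul, Matrix.diagonal_mul, Matrix.mul_diagonal] at h1
  exact h1

theorem QCol.mul_qdet (hZ : QMat Z) (h : QCol Z B) (i) : B i * qdet Z = qpow 1 • (qdet Z * B i) := by
  have hq := qpow_mul_qpow_neg
  fin_cases i <;>
    simp [qdet_fin_two, mul_assoc, h.row, h.anti, h.diag, reassoc (h.row _ _), reassoc (h.anti _),
      reassoc (h.diag _), mul_sub, sub_mul, add_mul, mul_add, smul_smul, hZ.diag, hZ.anti, hZ.row] <;>
    match_scalars <;> grind

theorem QRow.mul_qdet (hZ : QMat Z) (h : QRow Z C) (i) : C i * qdet Z = qpow 1 • (qdet Z * C i) := by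
  have hq := qpow_mul_qpow_neg
  fin_cases i <;>
    simp [qdet_fin_two, mul_assoc, h.col, h.anti, h.diag, reassoc (h.col _ _), reassoc (h.anti _),
      reassoc (h.diag _), mul_sub, sub_mul, add_mul, mul_add, smul_smul, hZ.diag, hZ.anti, hZ.col] <;>
    match_scalars <;> grind

/-- Let K = Z⁻¹ and D = det_q Z. Then qadj Z = K D = D K, so the entries of K commute with D and the
entries of Z are, up to sign and powers of q, entries of K times D. Hence D = κ D² with κ quadratic
in K. Moreover D u = 0 forces qadj Z · u = 0, then Z u = 0 and u = 0, so cancelling D gives κ D = 1.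
-/
theorem QMat.isUnit_qdet (h : QMat Z) (hu : IsUnit Z) : IsUnit (qdet Z) := by
  obtain ⟨⟨Z, K, hZK, hKZ⟩, rfl⟩ := hu
  dsimp only at *
  have a1 : qadj Z = K * Matrix.diagonal fun _ => qdet Z := by
    rw [← h.mul_qadj, ← mul_assoc, hKZ, one_mul]
  have a2 : qadj Z = (Matrix.diagonal fun _ => qdet Z) * K := by
    rw [← h.qadj_mul, mul_assoc, hZK, mul_one]
  have hc (i j) : K i j * qdet Z = qdet Z * K i j := by
    have := congrFun (congrFun (a1.symm.trans a2) i) j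
    rwa [Matrix.diagonal_mul, Matrix.mul_diagonal] at this
  have e (i j) : qadj Z i j = K i j * qdet Z := by rw [a1, Matrix.mul_diagonal]
  have e00 := e 0 0
  have e01 := e 0 1
  have e10 := e 1 0
  have e11 := e 1 1
  simp only [qadj, Matrix.of_apply, Matrix.cons_val', Matrix.cons_val_zero, Matrix.cons_val_one,
    Matrix.cons_val_fin_one] at e00 e01 e10 e11
  set κ := K 1 1 * K 0 0 - qpow (-1) • (K 0 1 * K 1 0) with hκ
  have hreg (u : X) (hu : qdet Z * u = 0) : u = 0 := by
    have h1 : qadj Z * Matrix.diagonal (fun _ => u) = 0 := by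
      rw [a1, mul_assoc, Matrix.diagonal_mul_diagonal]
      simp [hu]
    have h2 (i j) : Z i j * u = 0 := by
      have h3 (i j) : qadj Z i j * u = 0 := by
        have := congrFun (congrFun h1 i) j
        rwa [Matrix.mul_diagonal] at this
      have h00 := h3 0 0
      have h01 := h3 0 1
      have h10 := h3 1 0
      have h11 := h3 1 1
      simp only [qadj, Matrix.of_apply, Matrix.cons_val', Matrix.cons_val_zero, Matrix.cons_val_one,
        Matrix.cons_val_fin_one, neg_mul, neg_eq_zero, smul_mul_assoc] at h00 h01 h10 h11
      have k01 := congrArg (qpow (-1) • ·) h01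
      have k10 := congrArg (qpow 1 • ·) h10
      simp only [smul_smul, qpow_neg_mul_qpow, qpow_mul_qpow_neg, one_smul, smul_zero] at k01 k10
      fin_cases i <;> fin_cases j <;> assumption
    have h4 : K * (Z * Matrix.diagonal fun _ => u) = 0 := by
      have : (Z * Matrix.diagonal fun _ => u) = 0 := by
        ext i j; rw [Matrix.mul_diagonal, h2, Matrix.zero_apply]
      rw [this, mul_zero]
    rw [← mul_assoc, hKZ, one_mul] at h4
    simpa using congrFun (congrFun h4 0) 0
  have hD : qdet Z = κ * (qdet Z * qdet Z) := by
    have k01 := congrArg (qpow (-1) • ·) e01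
    have k10 := congrArg (qpow 1 • ·) e10
    simp only [smul_neg, smul_smul, qpow_neg_mul_qpow, qpow_mul_qpow_neg, one_smul] at k01 k10
    conv_lhs => rw [qdet_fin_two]
    rw [e00, e11, ← neg_neg (Z 0 1), ← neg_neg (Z 1 0), k01, k10, hκ]
    simp only [neg_mul_neg, smul_mul_assoc, mul_smul_comm, smul_smul, qpow_mul_qpow_neg, mul_one,
      mul_assoc, hc, reassoc (hc _ _), mul_sub, sub_mul]
  have hκc : κ * qdet Z = qdet Z * κ := by
    simp only [hκ, sub_mul, mul_sub, smul_mul_assoc, mul_smul_comm, mul_assoc, hc]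
    simp only [← mul_assoc, hc]
  have h1 : κ * qdet Z = 1 := by
    refine (sub_eq_zero.1 (hreg (1 - κ * qdet Z) ?_)).symm
    rw [mul_sub, mul_one, ← mul_assoc, ← hκc, mul_assoc, ← hD, sub_self]
  exact ⟨⟨qdet Z, κ, hκc ▸ h1, h1⟩, rfl⟩

end

/-! ### Expansion of det_q Y around the Schur complement -/

section
variable {X : Type*} [Ring X] [Algebra Cq X]
variable {Y Z Zi : Matrix (Fin 2) (Fin 2) X} {B C : Fin 2 → X} {d e : X}

theorem Manin21.schur_e (h : Manin21 Y B C d) (hde : d * e = 1) (hed : e * d = 1)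
    (hZ : ∀ i j, Y i j = Z i j + B i * (e * C j)) (i j) : Z i j * e = e * Z i j :=
  ((show Commute (Z i j) d from h.schur_d hde hed hZ i j).units_inv_right
    (u := ⟨d, e, hde, hed⟩)).eq

/-- The expansion of the quantum determinant of the even block in terms of the Schur complement,
first step. -/
theorem Manin21.qdet_expand (h : Manin21 Y B C d) (hde : d * e = 1) (hed : e * d = 1)
    (hZ : ∀ i j, Y i j = Z i j + B i * (e * C j)) :
    qdet Y = qdet Z - qpow (-1) • (e * C 0 * (qadj Z).mulVec B 0 + e * C 1 * (qadj Z).mulVec B 1) -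
      (qpow 1 + qpow (-1)) • (B 0 * (B 1 * (e * C 0 * (e * C 1)))) := by
  have hq := qpow_mul_qpow_neg
  have eB (j) := inv_swap hde hed (h.Bd j)
  have eC (j) := inv_swap hde hed (h.Cd j)
  have zB := h.schur_col hde hed hZ
  have zC := h.schur_row hde hed hZ
  have ze := h.schur_e hde hed hZ
  simp only [qdet_fin_two, qadj, Matrix.mulVec, dotProduct, Fin.sum_univ_two, Matrix.of_apply,
    Matrix.cons_val', Matrix.cons_val_zero, Matrix.cons_val_one, Matrix.cons_val_fin_one,
    hZ, add_mul, mul_add, mul_assoc, reassoc (zB.diag _), reassoc (zB.anti _),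
    reassoc (zB.row _ _), reassoc (ze _ _), ze, reassoc (zC.col _ _), reassoc (zC.diag _),
    reassoc (zC.anti _), zC.col, zC.diag, zC.anti, zB.diag, zB.anti, zB.row,
    reassoc (eB _), eB, eC, reassoc (eC _), h.oB.swap', reassoc h.oB.swap',
    h.oC.swap', reassoc h.oC.swap', h.CB, reassoc (h.CB _ _), h.oC.sq, reassoc (h.oC.sq _),
    h.oB.sq, reassoc (h.oB.sq _), zero_mul, mul_zero,
    neg_mul, mul_neg, smul_mul_assoc, mul_smul_comm, smul_neg, smul_smul, add_zero, smul_zero,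
    neg_zero, smul_add]
  match_scalars <;> grind

/-- The square of the linear correction in `qdet_expand` is det_q Z times a multiple of the
quadratic correction. This allows the three terms of the expansion to be read as a truncated
geometric series. -/
theorem Manin21.qdet_sq (h : Manin21 Y B C d) (hde : d * e = 1) (hed : e * d = 1)
    (hZ : ∀ i j, Y i j = Z i j + B i * (e * C j)) :
    (e * C 0 * (qadj Z).mulVec B 0 + e * C 1 * (qadj Z).mulVec B 1) *
      (e * C 0 * (qadj Z).mulVec B 0 + e * C 1 * (qadj Z).mulVec B 1) =
    -((qpow 1 * qpow 1 * qpow 1 * qpow 1 * (qpow 1 + qpow (-1))) •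
      (qdet Z * (B 0 * (B 1 * (e * C 0 * (e * C 1)))))) := by
  have hq := qpow_mul_qpow_neg
  have eB (j) := inv_swap hde hed (h.Bd j)
  have eC (j) := inv_swap hde hed (h.Cd j)
  have zB := h.schur_col hde hed hZ
  have zC := h.schur_row hde hed hZ
  have zz := h.schur_qmat hde hed hZ
  have ze := h.schur_e hde hed hZ
  simp only [qdet_fin_two, qadj, Matrix.mulVec, dotProduct, Fin.sum_univ_two, Matrix.of_apply,
    Matrix.cons_val', Matrix.cons_val_zero, Matrix.cons_val_one, Matrix.cons_val_fin_one,
    add_mul, sub_mul, mul_add, mul_assoc, reassoc (zB.diag _), reassoc (zB.anti _),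
    reassoc (zB.row _ _), reassoc (ze _ _), ze, reassoc (zC.col _ _), reassoc (zC.diag _),
    reassoc (zC.anti _), zC.col, zC.diag, zC.anti, zB.diag, zB.anti, zB.row,
    reassoc (eB _), eB, eC, reassoc (eC _), h.oB.swap', reassoc h.oB.swap',
    h.oC.swap', reassoc h.oC.swap', h.CB, reassoc (h.CB _ _), h.oC.sq, reassoc (h.oC.sq _),
    h.oB.sq, reassoc (h.oB.sq _), zero_mul, mul_zero, zz.row, zz.col, zz.anti, zz.diag,
    neg_mul, mul_neg, smul_mul_assoc, mul_smul_comm, smul_neg, smul_smul, add_zero, smul_zero,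
    neg_zero, smul_add, zero_add, neg_neg]
  match_scalars <;> grind

end

section
variable {X : Type*} [Ring X] [Algebra Cq X]
variable {Y Z Zi : Matrix (Fin 2) (Fin 2) X} {B C : Fin 2 → X} {d e : X}

/-- The quantum determinant of the even block in terms of the Schur complement: the correction
`E` is nilpotent of order three. -/
theorem Manin21.qdet_eq_mul (h : Manin21 Y B C d) (hde : d * e = 1) (hed : e * d = 1)
    (hZ : ∀ i j, Y i j = Z i j + B i * (e * C j)) (h1 : Z * Zi = 1) (h2 : Zi * Z = 1) {E : X}
    (hE : E = ∑ a, e * C a * Zi.mulVec B a) :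
    qdet Y = qdet Z * (1 - E + E * E) ∧ E * E * E = 0 := by
  have hq := qpow_mul_qpow_neg
  have eB (j) := inv_swap hde hed (h.Bd j)
  have eC (j) := inv_swap hde hed (h.Cd j)
  have zB := h.schur_col hde hed hZ
  have zC := h.schur_row hde hed hZ
  have zz := h.schur_qmat hde hed hZ
  have ze := h.schur_e hde hed hZ
  obtain ⟨D, hD⟩ := zz.isUnit_qdet ⟨⟨Z, Zi, h1, h2⟩, rfl⟩
  have hv (a) : (D : X) * Zi.mulVec B a = (qadj Z).mulVec B a := by
    have : qadj Z = Matrix.diagonal (fun _ => qdet Z) * Zi := by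
      rw [← zz.qadj_mul, mul_assoc, h1, mul_one]
    rw [this, ← Matrix.mulVec_mulVec, Matrix.mulVec_diagonal, hD]
  have bD (i) : B i * D = qpow 1 • ((D : X) * B i) := by rw [hD]; exact zB.mul_qdet zz i
  have cD (i) : C i * D = qpow 1 • ((D : X) * C i) := by rw [hD]; exact zC.mul_qdet zz i
  have zD (i j) : Z i j * D = (D : X) * Z i j := by rw [hD]; exact (zz.qdet_commute i j).symm
  have eD : e * D = (D : X) * e := by
    have c (i j) : Commute e (Z i j) := (ze i j).symm
    rw [hD, qdet_fin_two]
    exact (((c 0 0).mul_right (c 1 1)).sub_right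
      (((c 0 1).mul_right (c 1 0)).smul_right _)).eq
  set W := e * C 0 * (qadj Z).mulVec B 0 + e * C 1 * (qadj Z).mulVec B 1 with hW
  -- With D = det_q Z, the element D E is q⁻¹ times the linear correction W, while D E² will be
  -- minus (q + q⁻¹) times the quadratic correction N. The expansion of det_q Y thus becomes D(1 - E
  -- + E²).
  have DE : (D : X) * E = qpow (-1) • W := by
    have key (a) : (D : X) * (e * C a) = qpow (-1) • (e * C a * D) := by
      rw [mul_assoc, cD, mul_smul_comm, smul_smul, qpow_neg_mul_qpow, one_smul, ← mul_assoc e, eD,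
        mul_assoc]
    have key' (a) : (D : X) * (e * C a * Zi.mulVec B a) =
        qpow (-1) • (e * C a * (qadj Z).mulVec B a) := by
      rw [← mul_assoc, key, smul_mul_assoc, mul_assoc _ (D : X), hv]
    rw [hE, Fin.sum_univ_two, mul_add, key', key', hW, smul_add]
  have WD : W * D = (qpow 1 * qpow 1) • ((D : X) * W) := by
    rw [hW]
    simp only [qadj, Matrix.mulVec, dotProduct, Fin.sum_univ_two, Matrix.of_apply,
      Matrix.cons_val', Matrix.cons_val_zero, Matrix.cons_val_one, Matrix.cons_val_fin_one,
      add_mul, mul_add, mul_assoc, bD, cD, zD, eD, reassoc (bD _), reassoc (cD _),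
      reassoc (zD _ _), reassoc eD, mul_smul_comm, smul_mul_assoc, neg_mul, mul_neg, smul_neg,
      smul_smul, smul_add, mul_left_comm, mul_comm]
  have ED : E * D = (qpow 1 * qpow 1) • ((D : X) * E) := by
    rw [← D.mul_right_inj, ← mul_assoc, DE, smul_mul_assoc, WD, mul_smul_comm, mul_smul_comm,
      smul_comm]
  set N := B 0 * (B 1 * (e * C 0 * (e * C 1))) with hN
  have DEE : (D : X) * (E * E) = -((qpow 1 + qpow (-1)) • N) := by
    have h3 : (D : X) * (D * (E * E)) = (D : X) * (-((qpow 1 + qpow (-1)) • N)) := by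
      have h4 : (qpow 1 * qpow 1) • ((D : X) * (D * (E * E))) =
          (qpow (-1) * qpow (-1)) • (W * W) := by
        calc (qpow 1 * qpow 1) • ((D : X) * (D * (E * E))) =
            D * ((qpow 1 * qpow 1) • (D * E)) * E := by
              simp only [mul_smul_comm, smul_mul_assoc, mul_assoc]
          _ = (D * E) * (D * E) := by rw [← ED]; simp only [mul_assoc]
          _ = _ := by rw [DE, smul_mul_smul_comm]
      rw [h.qdet_sq hde hed hZ, ← hD] at h4
      have h5 := congrArg (fun u => (qpow (-1) * qpow (-1)) • u) h4
      simp only [smul_smul] at h5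
      have h6 : qpow (-1) * qpow (-1) * (qpow 1 * qpow 1) = 1 := by grind
      rw [h6, one_smul] at h5
      rw [h5, mul_neg, smul_neg, smul_smul, mul_smul_comm]
      congr 2
      grind
    exact (D.mul_right_inj).1 h3
  -- N already contains both C 0 and C 1, so a third factor C a kills it; this gives E³ = 0.
  have NE : N * E = 0 := by
    have key (a) : N * (e * C a) = 0 := by
      fin_cases a <;>
      simp only [hN, mul_assoc, eC, reassoc (eC _), mul_smul_comm, h.oC.sq, h.oC.swap', mul_neg,
        reassoc (h.oC.sq _), mul_zero, zero_mul, smul_zero, neg_zero, reassoc h.oC.swap',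
        neg_mul, smul_mul_assoc, Fin.zero_eta, Fin.mk_one]
    rw [hE, Finset.mul_sum]
    refine Finset.sum_eq_zero fun a _ => ?_
    rw [← mul_assoc, key, zero_mul]
  constructor
  · rw [h.qdet_expand hde hed hZ, ← hD, mul_add, mul_sub, mul_one, DE, DEE, sub_eq_add_neg _ (_ • N)]
  · rw [← D.mul_right_inj, ← mul_assoc, DEE, neg_mul, smul_mul_assoc, NE]
    simp

/-- Since E³ = 0, the factor 1 - E + E² has the inverse 1 + E. -/
theorem Manin21.isUnit_qdet (h : Manin21 Y B C d) (hde : d * e = 1) (hed : e * d = 1)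
    (hZ : ∀ i j, Y i j = Z i j + B i * (e * C j)) (hu : IsUnit Z) : IsUnit (qdet Y) := by
  obtain ⟨⟨Z, Zi, h1, h2⟩, rfl⟩ := hu
  obtain ⟨h3, h4⟩ := h.qdet_eq_mul hde hed hZ h1 h2 rfl
  rw [h3]
  set E := ∑ a, e * C a * Zi.mulVec B a
  refine ((h.schur_qmat hde hed hZ).isUnit_qdet ⟨⟨Z, Zi, h1, h2⟩, rfl⟩).mul
    ⟨⟨_, 1 + E, ?_, ?_⟩, rfl⟩
  · calc (1 - E + E * E) * (1 + E) = 1 + E * E * E := by noncomm_ring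
      _ = 1 := by rw [h4, add_zero]
  · calc (1 + E) * (1 - E + E * E) = 1 + E * E * E := by noncomm_ring
      _ = 1 := by rw [h4, add_zero]

/-- The multiplicativity of the quantum Berezinian for the two Gauss decompositions. -/
theorem Manin21.qdet_eq (h : Manin21 Y B C d) (hde : d * e = 1) (hed : e * d = 1)
    (hZ : ∀ i j, Y i j = Z i j + B i * (e * C j)) (hu : IsUnit Z)
    {K : Matrix (Fin 2) (Fin 2) X} (hK : Y * K = 1) :
    qdet Y = qdet Z * (e * (d - ∑ a, C a * K.mulVec B a)) := by
  obtain ⟨⟨Z, Zi, h1, h2⟩, rfl⟩ := hu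
  obtain ⟨h3, h4⟩ := h.qdet_eq_mul hde hed hZ h1 h2 rfl
  rw [h3]
  congr 1
  set E := ∑ a, e * C a * Zi.mulVec B a with hE
  set F := ∑ a, e * C a * K.mulVec B a with hF
  have hr : e * (d - ∑ a, C a * K.mulVec B a) = 1 - F := by
    rw [mul_sub, hed, hF, Finset.mul_sum]; simp only [mul_assoc]
  -- Resolvent identity: K = (Z + B e C)⁻¹ satisfies K = Z⁻¹ - Z⁻¹ B e C K. It yields (1 + E)(1 - F)
  -- = 1, and since 1 - E + E² is a left inverse of 1 + E it must equal 1 - F.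
  have hEF : F = E - E * F := by
    have hK' : K = Zi - Zi * (Matrix.replicateCol (Fin 1) B *
        Matrix.replicateRow (Fin 1) (fun a => e * C a)) * K := by
      have : Y = Z + Matrix.replicateCol (Fin 1) B *
          Matrix.replicateRow (Fin 1) (fun a => e * C a) := by
        ext i j; simp [Matrix.mul_apply, hZ]
      rw [this, add_mul] at hK
      calc K = Zi * (Z * K) := by rw [← mul_assoc, h2, one_mul]
        _ = _ := by rw [eq_sub_of_add_eq hK, mul_sub, mul_one, mul_assoc]
    have key (a) : K.mulVec B a = Zi.mulVec B a - Zi.mulVec B a * F := by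
      conv_lhs => rw [hK']
      simp only [Matrix.sub_mulVec, Pi.sub_apply, ← Matrix.mulVec_mulVec]
      congr 1
      simp only [Matrix.mulVec, dotProduct, Fin.sum_univ_two, Matrix.mul_apply, Fin.sum_univ_one,
        hF, Matrix.replicateCol_apply, Matrix.replicateRow_apply]
      noncomm_ring
    conv_lhs => rw [hF]
    simp only [key, mul_sub, Finset.sum_sub_distrib]
    rw [← hE]
    simp only [hE, Finset.sum_mul, mul_assoc]
  rw [hr]
  have h5 : (1 + E) * (1 - F) = 1 := by
    have : (1 + E) * (1 - F) = 1 + (E - E * F) - F := by noncomm_ring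
    rw [this, ← hEF]; noncomm_ring
  have h6 : (1 - E + E * E) * (1 + E) = 1 := by
    calc (1 - E + E * E) * (1 + E) = 1 + E * E * E := by noncomm_ring
      _ = 1 := by rw [h4, add_zero]
  exact left_inv_eq_right_inv h6 h5

end

/-! ### Passage between Manin matrices and their blocks -/

section
variable {X : Type*} [Ring X] [Algebra Cq X]
variable {Y Z : Matrix (Fin 2) (Fin 2) X} {B C : Fin 2 → X} {d e : X}

theorem IsManin.qMat {ι : Type*} [LinearOrder ι] {P : ι → ℕ} {T : Matrix ι ι X}
    (hT : IsManin P T) {u v : ι} (huv : u < v) (hu : P u = 0) (hv : P v = 0) :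
    QMat (T.submatrix ![u, v] ![u, v]) where
  row i := by
    fin_cases i
    · simpa [hu, hv] using hT.row u u v huv
    · simpa [hu, hv] using hT.row v u v huv
  col j := by
    fin_cases j
    · simpa [hu, hv] using hT.col u u v huv
    · simpa [hu, hv] using hT.col u v v huv
  anti := by simpa [hu, hv] using hT.anti u v v u huv huv
  diag := by
    have := hT.diag u u v v huv huv
    simp only [hu, hv] at this
    simpa [sub_eq_iff_eq_add'] using this

theorem IsManin.manin21 {ι : Type*} [LinearOrder ι] {P : ι → ℕ} {T : Matrix ι ι X}
    (hT : IsManin P T) {u v w : ι} (huv : u < v) (hvw : v < w) (hu : P u = 0) (hv : P v = 0)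
    (hw : P w = 1) :
    Manin21 (T.submatrix ![u, v] ![u, v]) (fun i => T (![u, v] i) w) (fun j => T w (![u, v] j))
      (T w w) := by
  have huw := huv.trans hvw
  have hq := qpow_mul_qpow_neg
  constructor
  · exact hT.qMat huv hu hv
  · constructor
    · intro i j
      fin_cases i <;> fin_cases j
      · simpa [hu, hv, hw] using hT.row u u w huw
      · simpa [hu, hv, hw] using hT.row u v w hvw
      · simpa [hu, hv, hw] using hT.row v u w huw
      · simpa [hu, hv, hw] using hT.row v v w hvw
    · intro j
      fin_cases j
      · simpa [hu, hv, hw, eq_comm] using hT.anti u w v u huv huw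
      · simpa [hu, hv, hw, eq_comm] using hT.anti u w v v huv hvw
    · intro j
      fin_cases j
      · simpa [hu, hv, hw, sub_eq_iff_eq_add'] using hT.diag u u v w huv huw
      · simpa [hu, hv, hw, sub_eq_iff_eq_add'] using hT.diag u v v w huv hvw
  · constructor
    · intro i j
      fin_cases i <;> fin_cases j
      · simpa [hu, hv, hw] using hT.col u u w huw
      · simpa [hu, hv, hw] using hT.col u v w huw
      · simpa [hu, hv, hw] using hT.col v u w hvw
      · simpa [hu, hv, hw] using hT.col v v w hvw
    · intro i
      fin_cases i
      · simpa [hu, hv, hw] using hT.anti u v w u huw huv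
      · simpa [hu, hv, hw] using hT.anti v v w u hvw huv
    · intro i
      fin_cases i
      · simpa [hu, hv, hw, sub_eq_iff_eq_add'] using hT.diag u u w v huw huv
      · simpa [hu, hv, hw, sub_eq_iff_eq_add'] using hT.diag v u w v hvw huv
  · constructor
    · intro i
      fin_cases i
      · exact hT.sq u w (by simp [hu, hw])
      · exact hT.sq v w (by simp [hv, hw])
    · simpa [hu, hv, hw] using hT.col u w v huv
  · constructor
    · intro i
      fin_cases i
      · exact hT.sq w u (by simp [hu, hw])
      · exact hT.sq w v (by simp [hv, hw])
    · simpa [hu, hv, hw] using hT.row w u v huv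
  · have key {a b : X} (h : a * b = -(b * a)) : b * a = -(a * b) := by rw [h, neg_neg]
    intro i j
    fin_cases i <;> fin_cases j
    · exact key (by simpa [hu, hv, hw] using hT.anti u w w u huw huw)
    · exact key (by simpa [hu, hv, hw] using hT.anti u w w v huw hvw)
    · exact key (by simpa [hu, hv, hw] using hT.anti v w w u hvw huw)
    · exact key (by simpa [hu, hv, hw] using hT.anti v w w v hvw hvw)
  · intro i
    fin_cases i
    · simpa [hu, hv, hw] using hT.col u w w huw
    · simpa [hu, hv, hw] using hT.col v w w hvw
  · intro i
    fin_cases i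
    · simpa [hu, hv, hw] using hT.row w u w huw
    · simpa [hu, hv, hw] using hT.row w v w hvw
  · intro i j
    fin_cases i <;> fin_cases j
    · simpa [hu, hv, hw, sub_eq_iff_eq_add'] using hT.diag u u w w huw huw
    · simpa [hu, hv, hw, sub_eq_iff_eq_add'] using hT.diag u v w w huw hvw
    · simpa [hu, hv, hw, sub_eq_iff_eq_add'] using hT.diag v u w w hvw huw
    · simpa [hu, hv, hw, sub_eq_iff_eq_add'] using hT.diag v v w w hvw hvw

/-- The matrix with blocks `Y, B, C, d`. -/
def blk (Y : Matrix (Fin 2) (Fin 2) X) (B C : Fin 2 → X) (d : X) : Matrix (Fin 3) (Fin 3) X :=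
  !![Y 0 0, Y 0 1, B 0; Y 1 0, Y 1 1, B 1; C 0, C 1, d]

/-- The parities of the indices of a `(2|1) × (2|1)` matrix. -/
def par21 : Fin 3 → ℕ := ![0, 0, 1]

theorem topOdd_par21 : TopOdd par21 := by unfold TopOdd; decide

/-- With its converse `Manin21.of_isManin`, this makes the product theorem `IsManin.mul` available
for block data. -/
theorem Manin21.isManin (h : Manin21 Y B C d) : IsManin par21 (blk Y B C d) := by
  constructor
  · intro i j
    fin_cases i <;> fin_cases j <;> simp [par21, blk, h.oB.sq, h.oC.sq]
  · intro i j l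
    fin_cases i <;> fin_cases j <;> fin_cases l <;>
      simp [par21, blk, h.y.row, h.yB.row, h.oC.swap, h.Cd]
  · intro i j l
    fin_cases i <;> fin_cases j <;> fin_cases l <;>
      simp [par21, blk, h.y.col, h.yC.col, h.oB.swap, h.Bd]
  · intro i j k l
    fin_cases i <;> fin_cases k <;> (try simp) <;> fin_cases j <;> fin_cases l <;>
      simp [par21, blk, h.y.anti, h.yC.anti, h.yB.anti, h.CB]
  · intro i j k l
    fin_cases i <;> fin_cases k <;> (try simp) <;> fin_cases j <;> fin_cases l <;>
      simp [par21, blk, h.y.diag, h.yC.diag, h.yB.diag, h.CB, h.yd]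

theorem Manin21.of_isManin (h : IsManin par21 (blk Y B C d)) : Manin21 Y B C d := by
  have := h.manin21 (u := 0) (v := 1) (w := 2) (by decide) (by decide) rfl rfl rfl
  convert this using 1
  · ext i j; fin_cases i <;> fin_cases j <;> rfl
  · ext i; fin_cases i <;> rfl
  · ext i; fin_cases i <;> rfl
  · rfl

end

theorem commute_of_anti {X : Type*} [Ring X] {a b c v : X} (ha : v * a = -(a * v)) (hc : v * c = -(c * v))
    (hb : Commute b v) : Commute (a * (b * c)) v := by
  have hb' : v * b = b * v := hb.eq.symm
  have : v * (a * (b * c)) = a * (b * c) * v := by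
    rw [← mul_assoc, ha, neg_mul, mul_assoc, ← mul_assoc v, hb', mul_assoc, hc]
    simp only [mul_neg, neg_neg, mul_assoc]
  exact this.symm

theorem anti_symm {X : Type*} [Ring X] {a v : X} (ha : v * a = -(a * v)) : a * v = -(v * a) := by rw [ha, neg_neg]

/-! ### Triangular Gauss factors -/

section
variable {X : Type*} [Ring X] [Algebra Cq X]
variable {Y Z : Matrix (Fin 2) (Fin 2) X} {B C : Fin 2 → X} {d e : X}

/-- This is the right factor in (Y, B; C, d) = (1, B e; 0, 1)(Z, 0; C, d); the factor of the
opposite decomposition is `Manin21.upper`. -/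
theorem Manin21.lower (h : Manin21 Y B C d) (hde : d * e = 1) (hed : e * d = 1)
    (hZ : ∀ i j, Y i j = Z i j + B i * (e * C j)) : Manin21 Z 0 C d where
  y := h.schur_qmat hde hed hZ
  yB := by constructor <;> simp
  yC := h.schur_row hde hed hZ
  oB := by constructor <;> simp
  oC := h.oC
  CB := by simp
  Bd := by simp
  Cd := h.Cd
  yd := by simp [h.schur_d hde hed hZ]

theorem Manin21.upper (h : Manin21 Y B C d) (hde : d * e = 1) (hed : e * d = 1)
    (hZ : ∀ i j, Y i j = Z i j + B i * (e * C j)) : Manin21 Z B 0 d where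
  y := h.schur_qmat hde hed hZ
  yB := h.schur_col hde hed hZ
  yC := by constructor <;> simp
  oB := h.oB
  oC := by constructor <;> simp
  CB := by simp
  Bd := h.Bd
  Cd := by simp
  yd := by simp [h.schur_d hde hed hZ]

theorem QMat.qdet_mul (hY : QMat Y) (hZ : QMat Z) (h : ∀ i j k l, Commute (Y i j) (Z k l)) :
    qdet (Y * Z) = qdet Y * qdet Z := by
  have hq := qpow_mul_qpow_neg
  have h' (i j k l) : Z k l * Y i j = Y i j * Z k l := (h i j k l).eq.symm
  simp only [qdet_fin_two, Matrix.mul_apply, Fin.sum_univ_two, add_mul, mul_add, sub_mul, mul_sub,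
    mul_assoc, reassoc (h' _ _ _ _), h', hZ.row, hZ.col, hZ.anti, hZ.diag, hY.row, hY.col,
    hY.anti, hY.diag, reassoc (hY.row _), reassoc (hY.col _), reassoc hY.anti, reassoc hY.diag,
    smul_mul_assoc, mul_smul_comm, smul_add, smul_sub, smul_smul]
  match_scalars <;> grind

theorem isUnit_of_qdet (hZ : QMat Z) (h : IsUnit (qdet Z)) : IsUnit Z := by
  obtain ⟨D, hD⟩ := h
  have h1 : Matrix.diagonal (fun _ : Fin 2 => (D : X)) * Matrix.diagonal (fun _ => ((D⁻¹ : Xˣ) : X)) =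
      1 := by simp
  have h2 : Matrix.diagonal (fun _ : Fin 2 => ((D⁻¹ : Xˣ) : X)) * Matrix.diagonal (fun _ => (D : X)) =
      1 := by simp
  have e1 := hZ.mul_qadj
  have e2 := hZ.qadj_mul
  rw [← hD] at e1 e2
  refine isUnit_iff_exists_and_exists.2 ⟨⟨qadj Z * Matrix.diagonal (fun _ => ((D⁻¹ : Xˣ) : X)), ?_⟩,
    ⟨Matrix.diagonal (fun _ => ((D⁻¹ : Xˣ) : X)) * qadj Z, ?_⟩⟩
  · rw [← mul_assoc, e1, h1]
  · rw [mul_assoc, e2, h2]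

end

/-! ### Gauss decomposition of a product -/

section
variable {X : Type*} [Ring X] [Algebra Cq X]
variable {Y Z Y' Z' : Matrix (Fin 2) (Fin 2) X} {B C B' C' : Fin 2 → X} {d e d' e' : X}

/-- Commutation in the super sense between the entries of two block matrices. -/
structure SuperCommute21 (Y : Matrix (Fin 2) (Fin 2) X) (B C : Fin 2 → X) (d : X)
    (Y' : Matrix (Fin 2) (Fin 2) X) (B' C' : Fin 2 → X) (d' : X) : Prop where
  dd : Commute d d'
  dY (i j) : Commute d (Y' i j)
  dB (i) : Commute d (B' i)
  dC (i) : Commute d (C' i)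
  Yd (i j) : Commute (Y i j) d'
  YY (i j k l) : Commute (Y i j) (Y' k l)
  YB (i j k) : Commute (Y i j) (B' k)
  YC (i j k) : Commute (Y i j) (C' k)
  Bd (i) : Commute (B i) d'
  BY (i k l) : Commute (B i) (Y' k l)
  BB (i j) : B' j * B i = -(B i * B' j)
  BC (i j) : C' j * B i = -(B i * C' j)
  Cd (i) : Commute (C i) d'
  CY (i k l) : Commute (C i) (Y' k l)
  CB (i j) : B' j * C i = -(C i * B' j)
  CC (i j) : C' j * C i = -(C i * C' j)

theorem SuperCommute21.superCommute (h : SuperCommute21 Y B C d Y' B' C' d') :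
    SuperCommute par21 (blk Y B C d) (blk Y' B' C' d') := by
  have e0 := h.dd.eq
  have e1 (i j) := (h.dY i j).eq
  have e2 (i) := (h.dB i).eq
  have e3 (i) := (h.dC i).eq
  have f1 (i j) := (h.Yd i j).eq
  have f2 (i j k l) := (h.YY i j k l).eq
  have f3 (i j k) := (h.YB i j k).eq
  have f4 (i j k) := (h.YC i j k).eq
  have g1 (i) := (h.Bd i).eq
  have g2 (i) := (h.Cd i).eq
  have g3 (i j k) := (h.BY i j k).eq
  have g4 (i j k) := (h.CY i j k).eq
  have h4 : (-1 : Cq) ^ 4 = 1 := by norm_num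
  intro i j k l
  fin_cases i <;> fin_cases j <;> fin_cases k <;> fin_cases l <;>
    simp [par21, blk, h.BB, h.BC, h.CB, h.CC, e0, e1, e2, e3, f1, f2, f3, f4, g1, g2, g3, g4, h4]

/-- The lower factor of the first matrix and the upper factor of the second still commute in the
super sense, so that their product is a Manin matrix. The correction B e C is even and, e being even
too, moves past the entries of the other matrix without sign. -/
theorem SuperCommute21.gauss (h : SuperCommute21 Y B C d Y' B' C' d')
    (hde : d * e = 1) (hed : e * d = 1) (hde' : d' * e' = 1) (hed' : e' * d' = 1)
    (hZ : ∀ i j, Y i j = Z i j + B i * (e * C j))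
    (hZ' : ∀ i j, Y' i j = Z' i j + B' i * (e' * C' j)) :
    SuperCommute21 Z 0 C d Z' B' 0 d' := by
  have ce {u : X} (hu : Commute d u) : Commute e u :=
    Commute.units_inv_left (u := ⟨d, e, hde, hed⟩) hu
  have ce' {u : X} (hu : Commute u d') : Commute u e' :=
    Commute.units_inv_right (u := ⟨d', e', hde', hed'⟩) hu
  have hZ (i j) : Z i j = Y i j - B i * (e * C j) := eq_sub_of_add_eq (hZ i j).symm
  have hZ' (i j) : Z' i j = Y' i j - B' i * (e' * C' j) := eq_sub_of_add_eq (hZ' i j).symm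
  have ZB (i j k) : Commute (Z i j) (B' k) := by
    rw [hZ]
    exact (h.YB i j k).sub_left (commute_of_anti (h.BB _ _) (h.CB _ _) (ce (h.dB _)))
  have ZC (i j k) : Commute (Z i j) (C' k) := by
    rw [hZ]
    exact (h.YC i j k).sub_left (commute_of_anti (h.BC _ _) (h.CC _ _) (ce (h.dC _)))
  have Zd (i j) : Commute (Z i j) d' := by
    rw [hZ]
    exact (h.Yd i j).sub_left ((h.Bd i).mul_left ((ce h.dd).mul_left (h.Cd j)))
  have ZY (i j k l) : Commute (Z i j) (Y' k l) := by
    rw [hZ]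
    exact (h.YY i j k l).sub_left ((h.BY i k l).mul_left ((ce (h.dY k l)).mul_left (h.CY j k l)))
  constructor
  · exact h.dd
  · intro i j
    rw [hZ']
    exact (h.dY i j).sub_right ((h.dB i).mul_right ((ce' h.dd).mul_right (h.dC j)))
  · exact h.dB
  · simp
  · exact Zd
  · intro i j k l
    rw [hZ' k l]
    exact (ZY i j k l).sub_right ((ZB i j k).mul_right ((ce' (Zd i j)).mul_right (ZC i j l)))
  · exact ZB
  · simp
  · simp
  · simp
  · simp
  · simp
  · exact h.Cd
  · intro i k l
    rw [hZ']
    exact (h.CY i k l).sub_right (commute_of_anti (anti_symm (h.CB _ _)) (anti_symm (h.CC _ _))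
      (ce' (h.Cd i)).symm).symm
  · exact h.CB
  · simp

/-- The Gauss decomposition of a product, and the multiplicativity of the Berezinian. -/
theorem Manin21.gauss_mul (h : Manin21 Y B C d) (h' : Manin21 Y' B' C' d')
    (hs : SuperCommute21 Y B C d Y' B' C' d')
    (hde : d * e = 1) (hed : e * d = 1) (hde' : d' * e' = 1) (hed' : e' * d' = 1)
    (hZ : ∀ i j, Y i j = Z i j + B i * (e * C j))
    (hZ' : ∀ i j, Y' i j = Z' i j + B' i * (e' * C' j)) (hu : IsUnit Z) (hu' : IsUnit Z') :
    ∃ (e₁ : X) (Z₁ : Matrix (Fin 2) (Fin 2) X), (C ⬝ᵥ B' + d * d') * e₁ = 1 ∧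
      e₁ * (C ⬝ᵥ B' + d * d') = 1 ∧
      (∀ i j, (Y * Y') i j + B i * C' j = Z₁ i j + (Y.mulVec B' i + B i * d') *
        (e₁ * (Matrix.vecMul C Y' j + d * C' j))) ∧ IsUnit Z₁ ∧
      qdet Z₁ * e₁ = qdet Z * e * (qdet Z' * e') := by
  have hs₁ := hs.gauss hde hed hde' hed' hZ hZ'
  -- The full product is (1, B e; 0, 1) · M · (1, 0; e' C', 1), where M is the product of the lower
  -- factor of the first matrix and the upper factor of the second. The outer factors change neither
  -- the last entry nor its Schur complement, so it suffices to study M.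
  have hm := (h.lower hde hed hZ).isManin.mul topOdd_par21 (h'.upper hde' hed' hZ').isManin
    hs₁.superCommute
  have ce {u : X} (hu : Commute d u) : Commute e u :=
    Commute.units_inv_left (u := ⟨d, e, hde, hed⟩) hu
  set N := C ⬝ᵥ B' with hN
  obtain ⟨e₁, h1, h2⟩ : ∃ e₁, (N + d * d') * e₁ = 1 ∧ e₁ * (N + d * d') = 1 := by
    -- Each factor N contributes one C and one B', so in the cube some C j occurs twice. The last
    -- entry d d' + N of M is then d d' times a unipotent element.
    have hnil : IsNilpotent (e' * e * N) := by
      refine ⟨3, ?_⟩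
      have Ce (j) := inv_swap hde hed (h.Cd j)
      have Be' (j) := inv_swap hde' hed' (h'.Bd j)
      have Ce' (j) : e' * C j = C j * e' := by
        exact (Commute.units_inv_left (u := ⟨d', e', hde', hed'⟩) (hs.Cd j).symm).eq
      have Be (j) : e * B' j = B' j * e := (ce (hs.dB j)).eq
      simp only [hN, dotProduct, Fin.sum_univ_two, pow_succ, pow_zero, one_mul, mul_add, add_mul,
        mul_assoc, Ce, Be', Ce', Be, reassoc (Ce _), reassoc (Be' _), reassoc (Ce' _),
        reassoc (Be _), hs.CB, reassoc (hs.CB _ _), h.oC.swap', reassoc h.oC.swap',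
        h'.oB.swap', reassoc h'.oB.swap', h.oC.sq, reassoc (h.oC.sq _), h'.oB.sq,
        reassoc (h'.oB.sq _), smul_mul_assoc, mul_smul_comm, neg_mul, mul_neg, zero_mul, mul_zero,
        smul_zero, neg_zero, add_zero]
    obtain ⟨w, hw⟩ := hnil.isUnit_add_one
    have h3 : N + d * d' = d * d' * w := by
      rw [hw, mul_add, mul_one]
      simp only [mul_assoc, reassoc hde', one_mul, reassoc hde]
    refine ⟨(w⁻¹ : Xˣ) * (e' * e), ?_, ?_⟩
    · rw [h3]
      simp only [mul_assoc, Units.mul_inv_cancel_left, reassoc hde', one_mul, hde]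
    · rw [h3]
      simp only [mul_assoc, reassoc hed, one_mul, reassoc hed', Units.inv_mul]
  obtain ⟨⟨Z, Zi, hZ1, hZ2⟩, rfl⟩ := hu
  obtain ⟨⟨Z', Zi', hZ1', hZ2'⟩, rfl⟩ := hu'
  simp only at *
  let Z₁ : Matrix (Fin 2) (Fin 2) X := Matrix.of fun i j =>
    (Z * Z') i j - Z.mulVec B' i * (e₁ * Matrix.vecMul C Z' j)
  have hu₁ : IsUnit Z₁ := by
    let c : Matrix (Fin 2) (Fin 1) X := Matrix.replicateCol (Fin 1) B'
    let r : Matrix (Fin 1) (Fin 2) X := Matrix.replicateRow (Fin 1) C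
    let s (u : X) : Matrix (Fin 1) (Fin 1) X := Matrix.of fun _ _ => u
    have hrc : r * c = s (N + d * d') - s (d * d') := by
      ext i j; simp [r, c, s, Matrix.mul_apply, hN, dotProduct]
    have ss (u v : X) : s u * s v = s (u * v) := by
      ext i j; simp [s, Matrix.mul_apply]
    have s1 : s 1 = 1 := by ext i j; fin_cases i; fin_cases j; rfl
    have k1 : d * d' * (e' * e) = 1 := by
      simp only [mul_assoc, reassoc hde', one_mul, hde]
    have k2 : e' * e * (d * d') = 1 := by
      simp only [mul_assoc, reassoc hed, one_mul, hed']
    have hZ₁ : Z₁ = Z * (1 - c * (s e₁ * r)) * Z' := by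
      ext i j
      simp only [Z₁, c, s, r, Matrix.of_apply, Matrix.mul_apply, Matrix.mulVec, Matrix.vecMul, dotProduct,
        Fin.sum_univ_two, Matrix.sub_apply, Matrix.one_apply, Fin.sum_univ_one,
        Matrix.replicateCol_apply, Matrix.replicateRow_apply]
      fin_cases i <;> fin_cases j <;> simp <;> noncomm_ring
    -- Sherman–Morrison formula: 1 - c(rc + dd')⁻¹ r has inverse 1 + c(dd')⁻¹ r.
    have hmid : IsUnit (1 - c * (s e₁ * r)) := by
      refine ⟨⟨1 - c * (s e₁ * r), 1 + c * (s (e' * e) * r), ?_, ?_⟩, rfl⟩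
      · calc _ = 1 + c * (s (e' * e) * r) - c * (s e₁ * r) - c * (s e₁ * (r * c) * s (e' * e) * r) := by
              simp only [Matrix.mul_assoc, mul_add, sub_mul, mul_one, one_mul]; abel
          _ = 1 := by
              rw [hrc, mul_sub, ss, h2, s1, sub_mul, ss, ss, one_mul, mul_assoc, k1]
              simp only [mul_one, Matrix.sub_mul, Matrix.mul_sub]; abel
      · calc _ = 1 + c * (s (e' * e) * r) - c * (s e₁ * r) - c * (s (e' * e) * (r * c) * s e₁ * r) := by
              simp only [Matrix.mul_assoc, mul_sub, add_mul, mul_one, one_mul]; abel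
          _ = 1 := by
              rw [hrc, mul_sub, ss, ss, k2, s1, sub_mul, ss, one_mul, mul_assoc, h1]
              simp only [mul_one, Matrix.sub_mul, Matrix.mul_sub]; abel
    rw [hZ₁]
    exact (IsUnit.mul ⟨⟨Z, Zi, hZ1, hZ2⟩, rfl⟩ hmid).mul ⟨⟨Z', Zi', hZ1', hZ2'⟩, rfl⟩
  refine ⟨e₁, Z₁, h1, h2, ?_, hu₁, ?_⟩
  · have hB (i) : Y.mulVec B' i + B i * d' = Z.mulVec B' i + B i * (e * (N + d * d')) := by
      rw [mul_add, reassoc hed, one_mul, hN]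
      simp only [Matrix.mulVec, dotProduct, Fin.sum_univ_two, hZ]
      noncomm_ring
    have hC (j) : Matrix.vecMul C Y' j + d * C' j =
        Matrix.vecMul C Z' j + (N + d * d') * (e' * C' j) := by
      have : d * C' j = d * (d' * (e' * C' j)) := by rw [reassoc hde', one_mul]
      rw [add_mul, mul_assoc d, ← this, hN]
      simp only [Matrix.vecMul, dotProduct, Fin.sum_univ_two, hZ']
      noncomm_ring
    intro i j
    have hBC : B i * C' j = B i * (e * (d * (d' * (e' * C' j)))) := by
      rw [reassoc hde', one_mul, reassoc hed, one_mul]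
    have hn (u : X) : B i * (e * (N * u)) = B i * (e * (C 0 * (B' 0 * u))) +
        B i * (e * (C 1 * (B' 1 * u))) := by
      rw [hN]; simp only [dotProduct, Fin.sum_univ_two]; noncomm_ring
    rw [hB, hC, hBC]
    calc _ = (Z * Z') i j + Z.mulVec B' i * (e' * C' j) + B i * (e * Matrix.vecMul C Z' j) +
          B i * (e * ((N + d * d') * (e' * C' j))) := by
          rw [add_mul N, mul_add e, mul_add (B i) (e * _), hn, mul_assoc d]
          simp only [Matrix.mul_apply, Matrix.mulVec, Matrix.vecMul, dotProduct, Fin.sum_univ_two,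
            hZ, hZ']
          noncomm_ring
      _ = _ := by
          have k (u : X) : e₁ * ((N + d * d') * u) = u := by rw [reassoc h2, one_mul]
          have k' (u : X) : (N + d * d') * (e₁ * u) = u := by rw [reassoc h1, one_mul]
          generalize N + d * d' = m at k k'
          simp only [Z₁, Matrix.of_apply, mul_add, add_mul, mul_assoc, k, k']
          abel
  · have hb : blk Z 0 C d * blk Z' B' 0 d' =
        blk (Z * Z') (Z.mulVec B') (Matrix.vecMul C Z') (N + d * d') := by
      ext i j
      fin_cases i <;> fin_cases j <;>
        simp [blk, Matrix.mul_apply, Fin.sum_univ_succ, Matrix.mulVec, Matrix.vecMul, dotProduct, hN, add_assoc]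
    rw [hb] at hm
    -- `qdet_eq` is applied to M, whose even block ZZ' has inverse Z'⁻¹ Z⁻¹. The other Schur
    -- complement, N + dd' - C Z'(ZZ')⁻¹ Z B', collapses to dd'.
    have h4 := (Manin21.of_isManin hm).qdet_eq h1 h2 (Z := Z₁) (fun i j => by simp [Z₁]) hu₁
      (K := Zi' * Zi) (by rw [mul_assoc, ← mul_assoc Z', hZ1', one_mul, hZ1])
    have h5 : ∑ a, Matrix.vecMul C Z' a * (Zi' * Zi).mulVec (Z.mulVec B') a = N := by
      change Matrix.vecMul C Z' ⬝ᵥ (Zi' * Zi).mulVec (Z.mulVec B') = N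
      rw [Matrix.mulVec_mulVec, mul_assoc, hZ2, mul_one, Matrix.dotProduct_mulVec,
        Matrix.vecMul_vecMul, hZ1', Matrix.vecMul_one]
    rw [h5, add_sub_cancel_left, QMat.qdet_mul (h.schur_qmat hde hed hZ)
      (h'.schur_qmat hde' hed' hZ') hs₁.YY] at h4
    have h6 : Commute e (qdet Z') := by
      exact (commute_qdet fun i j => (ce (hs₁.dY i j)).symm).symm
    have h7 : Commute e e' := Commute.units_inv_right (u := ⟨d', e', hde', hed'⟩) (ce hs.dd)
    calc qdet Z₁ * e₁ = qdet Z₁ * (e₁ * (d * d')) * (e' * e) := by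
          simp only [mul_assoc, reassoc hde', one_mul, hde, mul_one]
      _ = _ := by
          rw [← h4, ← h7.eq, mul_assoc, mul_assoc, ← mul_assoc (qdet Z'), ← h6.eq, mul_assoc]

end

/-! ### Products of points -/

section
variable {X : Type*} [Ring X] [Algebra Cq X] {S T : Matrix (Fin 5) (Fin 5) X} {e f : X}

theorem IsManin.manin21_fin (hT : IsManin p T) :
    Manin21 (T.submatrix ![2, 3] ![2, 3]) (fun i => T (![2, 3] i) 4) (fun j => T 4 (![2, 3] j))
      (T 4 4) :=
  hT.manin21 (by decide) (by decide) rfl rfl rfl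

theorem schur_add {X : Type*} [Ring X] {T : Matrix (Fin 5) (Fin 5) X} {e : X} (i j : Fin 2) : T.submatrix ![2, 3] ![2, 3] i j =
    schur T e i j + T (![2, 3] i) 4 * (e * T 4 (![2, 3] j)) := by
  simp [schur, mul_assoc]

theorem IsPoint.qMat_schur (hT : IsPoint T e) : QMat (schur T e) :=
  hT.manin.manin21_fin.schur_qmat hT.mul_inv hT.inv_mul schur_add

/-- The Berezinian condition exhibits det_q of the Schur complement as (det_q x)⁻¹ d, a unit. -/
theorem IsPoint.isUnit_schur (hT : IsPoint T e) : IsUnit (schur T e) := by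
  refine isUnit_of_qdet hT.qMat_schur ?_
  obtain ⟨u, hu⟩ := hT.isUnit_x
  have h := hT.ber
  rw [← hu] at h
  have : qdet (schur T e) = ((u⁻¹ : Xˣ) : X) * T 4 4 := by
    calc _ = ((u⁻¹ : Xˣ) : X) * (u * qdet (schur T e) * e) * T 4 4 := by
          simp only [mul_assoc, Units.inv_mul_cancel_left, hT.inv_mul, mul_one]
      _ = _ := by rw [h, mul_one]
  rw [this]
  exact (u⁻¹).isUnit.mul ⟨⟨T 4 4, e, hT.mul_inv, hT.inv_mul⟩, rfl⟩

theorem SuperCommute.superCommute21 (h : SuperCommute p S T) :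
    SuperCommute21 (S.submatrix ![2, 3] ![2, 3]) (fun i => S (![2, 3] i) 4)
      (fun j => S 4 (![2, 3] j)) (S 4 4) (T.submatrix ![2, 3] ![2, 3])
      (fun i => T (![2, 3] i) 4) (fun j => T 4 (![2, 3] j)) (T 4 4) := by
  have h4 : (-1 : Cq) ^ 4 = 1 := by norm_num
  have he (i j k l) (hh : (-1 : Cq) ^ ((p i + p j) * (p k + p l)) = 1) :
      Commute (S k l) (T i j) := by
    have := h i j k l
    rw [hh, one_smul] at this
    exact this.symm
  have ho (i j k l) (hh : (-1 : Cq) ^ ((p i + p j) * (p k + p l)) = -1) :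
      T i j * S k l = -(S k l * T i j) := by
    have := h i j k l
    rwa [hh, neg_one_smul] at this
  have p4 : p 4 = 1 := rfl
  have pi (i : Fin 2) : p (![2, 3] i) = 0 := by fin_cases i <;> rfl
  constructor <;> intros <;> first
    | exact he _ _ _ _ (by simp [p4, pi, h4])
    | exact ho _ _ _ _ (by simp [p4, pi, h4])

/-- The vanishing upper right block makes both x and the lower right 3 × 3 block multiplicative. The
determinant of x is then multiplicative, `gauss_mul` treats the 3 × 3 block, and the factors of the
Berezinian regroup because entries of the two matrices commute whenever one of them is even. -/
theorem IsPoint.mul (hS : IsPoint S e) (hT : IsPoint T f) (h : SuperCommute p S T) :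
    ∃ k, IsPoint (S * T) k := by
  have hm := hS.manin.mul topOdd_p hT.manin h
  obtain ⟨k, Z, h1, h2, h3, h4, h5⟩ := hS.manin.manin21_fin.gauss_mul hT.manin.manin21_fin
    h.superCommute21 hS.mul_inv hS.inv_mul hT.mul_inv hT.inv_mul schur_add schur_add
    hS.isUnit_schur hT.isUnit_schur
  have t0 (j : Fin 2) : T 0 (![2, 3] j) = 0 := hT.zero _ _ (by decide) (by revert j; decide)
  have t1 (j : Fin 2) : T 1 (![2, 3] j) = 0 := hT.zero _ _ (by decide) (by revert j; decide)
  have t04 : T 0 4 = 0 := hT.zero _ _ (by decide) (by decide)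
  have t14 : T 1 4 = 0 := hT.zero _ _ (by decide) (by decide)
  have s0 (j : Fin 5) (hj : 2 ≤ j) : S 0 j = 0 := hS.zero _ _ (by decide) hj
  have s1 (j : Fin 5) (hj : 2 ≤ j) : S 1 j = 0 := hS.zero _ _ (by decide) hj
  have e44 : (fun j => S 4 (![2, 3] j)) ⬝ᵥ (fun i => T (![2, 3] i) 4) + S 4 4 * T 4 4 =
      (S * T) 4 4 := by
    simp [Matrix.mul_apply, Fin.sum_univ_five, dotProduct, t04, t14]
  have eY (i j : Fin 2) : (S * T) (![2, 3] i) (![2, 3] j) =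
      (S.submatrix ![2, 3] ![2, 3] * T.submatrix ![2, 3] ![2, 3]) i j +
        S (![2, 3] i) 4 * T 4 (![2, 3] j) := by
    rw [Matrix.mul_apply, Matrix.mul_apply]
    simp [Fin.sum_univ_five, t0, t1]
  have eB (i : Fin 2) : (S * T) (![2, 3] i) 4 =
      (S.submatrix ![2, 3] ![2, 3]).mulVec (fun i => T (![2, 3] i) 4) i +
        S (![2, 3] i) 4 * T 4 4 := by
    simp [Matrix.mul_apply, Fin.sum_univ_five, Matrix.mulVec, dotProduct, t04, t14]
  have eC (j : Fin 2) : (S * T) 4 (![2, 3] j) =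
      Matrix.vecMul (fun j => S 4 (![2, 3] j)) (T.submatrix ![2, 3] ![2, 3]) j +
        S 4 4 * T 4 (![2, 3] j) := by
    simp [Matrix.mul_apply, Fin.sum_univ_five, Matrix.vecMul, dotProduct, t0, t1]
  rw [e44] at h1 h2
  simp only [← eB, ← eC, ← eY] at h3
  have hZ : Z = schur (S * T) k := by
    ext i j
    simp only [schur, Matrix.of_apply]
    rw [h3, mul_assoc, add_sub_cancel_right]
  rw [hZ] at h4 h5
  have hx : (S * T).submatrix ![0, 1] ![0, 1] =
      S.submatrix ![0, 1] ![0, 1] * T.submatrix ![0, 1] ![0, 1] := by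
    ext i j
    rw [Matrix.submatrix_apply, Matrix.mul_apply, Matrix.mul_apply]
    fin_cases i <;> simp [Fin.sum_univ_five, s0, s1]
  have pi (i : Fin 2) : p (![0, 1] i) = 0 := by fin_cases i <;> rfl
  have pj (i : Fin 2) : p (![2, 3] i) = 0 := by fin_cases i <;> rfl
  have hc {i j k l : Fin 5} (hk : p k = 0) (hl : p l = 0) : Commute (S k l) (T i j) := by
    have := h i j k l
    rw [hk, hl, add_zero, mul_zero, pow_zero, one_smul] at this
    exact this.symm
  have hc' {i j k l : Fin 5} (hk : p k = 0) (hl : p l = 0) : Commute (S i j) (T k l) := by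
    have := h k l i j
    rw [hk, hl, add_zero, zero_mul, pow_zero, one_smul] at this
    exact this.symm
  have hqx : qdet ((S * T).submatrix ![0, 1] ![0, 1]) =
      qdet (S.submatrix ![0, 1] ![0, 1]) * qdet (T.submatrix ![0, 1] ![0, 1]) := by
    rw [hx]
    exact QMat.qdet_mul (hS.manin.qMat (by decide) rfl rfl) (hT.manin.qMat (by decide) rfl rfl)
      fun i j k l => hc (pi _) (pi _)
  refine ⟨k, hm, ?_, h1, h2, ?_, ?_, ?_⟩
  · intro i j hi hj
    have hi' : i = 0 ∨ i = 1 := by revert i; decide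
    have t0 : T 0 j = 0 := hT.zero _ _ (by decide) hj
    have t1 : T 1 j = 0 := hT.zero _ _ (by decide) hj
    rcases hi' with rfl | rfl <;> simp [Matrix.mul_apply, Fin.sum_univ_five, s0, s1, t0, t1]
  · rw [hqx]
    exact hS.isUnit_x.mul hT.isUnit_x
  · exact hm.manin21_fin.isUnit_qdet h1 h2 schur_add h4
  · have hcx (u : X) (hu : ∀ i j : Fin 2, Commute u (T (![0, 1] i) (![0, 1] j))) :
        Commute u (qdet (T.submatrix ![0, 1] ![0, 1])) :=
      (commute_qdet fun i j => (hu i j).symm).symm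
    have c1 : Commute e (qdet (T.submatrix ![0, 1] ![0, 1])) :=
      Commute.units_inv_left (u := ⟨S 4 4, e, hS.mul_inv, hS.inv_mul⟩)
        (hcx _ fun i j => hc' (pi _) (pi _))
    have c2 : Commute (qdet (schur S e)) (qdet (T.submatrix ![0, 1] ![0, 1])) := by
      refine commute_qdet fun i j => hcx _ fun k l => ?_
      have ce : Commute e (T (![0, 1] k) (![0, 1] l)) :=
        Commute.units_inv_left (u := ⟨S 4 4, e, hS.mul_inv, hS.inv_mul⟩) (hc' (pi _) (pi _))
      exact (hc (pj _) (pj _)).sub_left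
        (((hc' (pi _) (pi _)).mul_left ce).mul_left (hc' (pi _) (pi _)))
    rw [hqx, mul_assoc, h5]
    calc _ = qdet (S.submatrix ![0, 1] ![0, 1]) * ((qdet (T.submatrix ![0, 1] ![0, 1]) *
          (qdet (schur S e) * e)) * (qdet (schur T f) * f)) := by simp only [mul_assoc]
      _ = (qdet (S.submatrix ![0, 1] ![0, 1]) * qdet (schur S e) * e) *
          (qdet (T.submatrix ![0, 1] ![0, 1]) * qdet (schur T f) * f) := by
        rw [← (c2.mul_left c1).eq]; simp only [mul_assoc]
      _ = 1 := by rw [hS.ber, hT.ber, one_mul]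

end

/-! ### The inverse of the generating matrix -/

section
variable {X : Type*} [Ring X] {m n : Type*} [Fintype m] [Fintype n] [DecidableEq m] [DecidableEq n]

theorem isUnit_fromBlocks_lower {A : Matrix m m X} {C : Matrix n m X} {D : Matrix n n X}
    (hA : IsUnit A) (hD : IsUnit D) : IsUnit (Matrix.fromBlocks A 0 C D) := by
  obtain ⟨A, rfl⟩ := hA
  obtain ⟨D, rfl⟩ := hD
  refine ⟨⟨Matrix.fromBlocks A 0 C D, Matrix.fromBlocks ↑A⁻¹ 0 (-((↑D⁻¹ : Matrix n n X) * C * (↑A⁻¹ : Matrix m m X))) ↑D⁻¹, ?_, ?_⟩, rfl⟩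
  · simp [Matrix.fromBlocks_multiply, Matrix.mul_assoc, ← Matrix.mul_assoc (D : Matrix n n X)]
  · simp [Matrix.fromBlocks_multiply, Matrix.mul_assoc]

theorem isUnit_fromBlocks_upper {A : Matrix m m X} {B : Matrix m n X} {D : Matrix n n X}
    (hA : IsUnit A) (hD : IsUnit D) : IsUnit (Matrix.fromBlocks A B 0 D) := by
  obtain ⟨A, rfl⟩ := hA
  obtain ⟨D, rfl⟩ := hD
  refine ⟨⟨Matrix.fromBlocks A B 0 D, Matrix.fromBlocks ↑A⁻¹ (-((↑A⁻¹ : Matrix m m X) * B * (↑D⁻¹ : Matrix n n X))) 0 ↑D⁻¹, ?_, ?_⟩, rfl⟩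
  · simp [Matrix.fromBlocks_multiply, Matrix.mul_assoc, ← Matrix.mul_assoc (A : Matrix m m X)]
  · simp [Matrix.fromBlocks_multiply, Matrix.mul_assoc]

end

section
variable {X : Type*} [Ring X] [Algebra Cq X] {T G : Matrix (Fin 5) (Fin 5) X} {e : X}

theorem IsPoint.isUnit_x' (hT : IsPoint T e) : IsUnit (T.submatrix ![0, 1] ![0, 1]) :=
  isUnit_of_qdet (hT.manin.qMat (by decide) rfl rfl) hT.isUnit_x

theorem IsPoint.isUnit_y' (hT : IsPoint T e) : IsUnit (T.submatrix ![2, 3] ![2, 3]) :=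
  isUnit_of_qdet (hT.manin.qMat (by decide) rfl rfl) hT.isUnit_y

theorem IsPoint.isUnit_d (hT : IsPoint T e) : IsUnit (T 4 4) :=
  ⟨⟨T 4 4, e, hT.mul_inv, hT.inv_mul⟩, rfl⟩

/-- In block sizes 2, 2, 1 the matrix is a unipotent upper triangular matrix times a lower
triangular one with diagonal blocks x, the Schur complement, and d, all invertible. -/
theorem IsPoint.isUnit (hT : IsPoint T e) : IsUnit T := by
  let φ : (Fin 2 ⊕ Fin 2) ⊕ Fin 1 → Fin 5 := Sum.elim (Sum.elim ![0, 1] ![2, 3]) ![4]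
  have hφ : Function.Bijective φ := by decide
  let ψ := Equiv.ofBijective φ hφ
  have key : IsUnit (T.submatrix ψ ψ) := by
    have h1 : T.submatrix ψ ψ = Matrix.fromBlocks 1
        (Matrix.of fun i _ => Sum.elim 0 (fun i => T (![2, 3] i) 4 * e) i) 0 1 *
        Matrix.fromBlocks (Matrix.fromBlocks (Matrix.of fun i j => T (![0, 1] i) (![0, 1] j)) 0
          (Matrix.of fun i j => T (![2, 3] i) (![0, 1] j) - T (![2, 3] i) 4 * e * T 4 (![0, 1] j))
          (schur T e)) 0
        (Matrix.of fun _ j => Sum.elim (fun j => T 4 (![0, 1] j)) (fun j => T 4 (![2, 3] j)) j)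
        (Matrix.of fun _ _ => T 4 4) := by
      have z (i j : Fin 2) : T (![0, 1] i) (![2, 3] j) = 0 :=
        hT.zero _ _ (by revert i; decide) (by revert j; decide)
      have z' (i : Fin 2) : T (![0, 1] i) 4 = 0 := hT.zero _ _ (by revert i; decide) (by decide)
      rw [Matrix.fromBlocks_multiply]
      ext i j
      rcases i with (i | i) | i <;> rcases j with (j | j) | j <;>
        simp [ψ, φ, Matrix.mul_apply, schur, z, z', mul_assoc, hT.inv_mul, Matrix.one_apply]
    rw [h1]
    refine (isUnit_fromBlocks_upper isUnit_one isUnit_one).mul (isUnit_fromBlocks_lower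
      (isUnit_fromBlocks_lower hT.isUnit_x' hT.isUnit_schur) ?_)
    refine ⟨⟨_, Matrix.of fun _ _ => e, ?_, ?_⟩, rfl⟩ <;>
    · ext i j
      fin_cases i; fin_cases j
      simp [Matrix.mul_apply, hT.mul_inv, hT.inv_mul]
  obtain ⟨⟨M, N, h1, h2⟩, hM⟩ := key
  simp only at hM
  subst hM
  refine ⟨⟨T, N.submatrix ψ.symm ψ.symm, ?_, ?_⟩, rfl⟩
  · have := congrArg (fun M => Matrix.submatrix M ψ.symm ψ.symm) h1
    simpa [← Matrix.submatrix_mul_equiv _ _ ψ.symm ψ.symm] using this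
  · have := congrArg (fun M => Matrix.submatrix M ψ.symm ψ.symm) h2
    simpa [← Matrix.submatrix_mul_equiv _ _ ψ.symm ψ.symm] using this

open MulOpposite in
/-- The quantum determinant of the inverse matrix, over the opposite algebra. -/
theorem QMat.qdet_op {Y K : Matrix (Fin 2) (Fin 2) X} (hY : QMat Y) (h1 : Y * K = 1)
    (h2 : K * Y = 1) : qdet (K.map op) * op (qdet Y) = 1 ∧ op (qdet Y) * qdet (K.map op) = 1 := by
  obtain ⟨D, hD⟩ := hY.isUnit_qdet ⟨⟨Y, K, h1, h2⟩, rfl⟩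
  have hK : K = qadj Y * Matrix.diagonal (fun _ => ((D⁻¹ : Xˣ) : X)) := by
    calc K = K * (Y * qadj Y) * Matrix.diagonal (fun _ => ((D⁻¹ : Xˣ) : X)) := by
          rw [hY.mul_qadj, ← hD, mul_assoc, Matrix.diagonal_mul_diagonal]; simp
      _ = _ := by rw [← mul_assoc, h2, one_mul]
  have c (i j) : ((D⁻¹ : Xˣ) : X) * Y i j = Y i j * ((D⁻¹ : Xˣ) : X) := by
    have : Commute (D : X) (Y i j) := by rw [hD]; exact hY.qdet_commute i j
    exact this.units_inv_left.eq
  -- As K = qadj Y · D⁻¹ with D = det_q Y, reversing the order of products makes the determinant of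
  -- K equal to det_q Y · D⁻² = D⁻¹.
  have h3 : qdet (K.map op) = op ((D⁻¹ : Xˣ) : X) := by
    rw [qdet_fin_two, hK]
    simp only [qadj, Matrix.map_apply, Matrix.mul_diagonal, Matrix.of_apply, Matrix.cons_val',
      Matrix.cons_val_zero, Matrix.cons_val_one, Matrix.cons_val_fin_one, ← op_mul, ← op_smul,
      ← op_sub]
    congr 1
    have hq := qpow_mul_qpow_neg
    have : (D : X) * (((D⁻¹ : Xˣ) : X) * ((D⁻¹ : Xˣ) : X)) = ((D⁻¹ : Xˣ) : X) := by simp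
    conv_rhs => rw [← this, hD, qdet_fin_two]
    simp only [neg_mul, mul_neg, smul_mul_assoc, mul_smul_comm, mul_assoc, reassoc (c _ _), c,
      neg_neg, smul_neg, smul_smul, sub_mul, reassoc hY.anti]
    match_scalars <;> grind
  rw [h3, ← hD, ← op_mul, ← op_mul]
  simp

/-- The blocks of the inverse matrix. -/
structure InvBlocks (T : Matrix (Fin 5) (Fin 5) X) (e : X) (G : Matrix (Fin 5) (Fin 5) X)
    (K : Matrix (Fin 2) (Fin 2) X) (k : X) : Prop where
  zero (i j : Fin 5) : i < 2 → 2 ≤ j → G i j = 0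
  x_mul : T.submatrix ![0, 1] ![0, 1] * G.submatrix ![0, 1] ![0, 1] = 1
  mul_x : G.submatrix ![0, 1] ![0, 1] * T.submatrix ![0, 1] ![0, 1] = 1
  schur_mul : schur T e * G.submatrix ![2, 3] ![2, 3] = 1
  mul_schur : G.submatrix ![2, 3] ![2, 3] * schur T e = 1
  mul_k : G 4 4 * k = 1
  k_mul : k * G 4 4 = 1
  schur_eq (i j : Fin 2) :
    G (![2, 3] i) (![2, 3] j) - G (![2, 3] i) 4 * k * G 4 (![2, 3] j) = K i j

/-- Usual duality for block inverses: a block of the inverse is the inverse of a Schur complement,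
and a Schur complement of the inverse is the inverse of a block. Here G₄₄⁻¹ = d - C Y⁻¹ B, and the
Schur complement of G at its last entry is K = Y⁻¹. -/
theorem IsPoint.invBlocks (hT : IsPoint T e) (h1 : T * G = 1) (h2 : G * T = 1)
    {K : Matrix (Fin 2) (Fin 2) X} (hK1 : T.submatrix ![2, 3] ![2, 3] * K = 1)
    (hK2 : K * T.submatrix ![2, 3] ![2, 3] = 1) :
    InvBlocks T e G K
      (T 4 4 - ∑ a, T 4 (![2, 3] a) * K.mulVec (fun i => T (![2, 3] i) 4) a) := by
  obtain ⟨⟨x, xi, hx1, hx2⟩, hx⟩ := hT.isUnit_x'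
  simp only at hx
  subst hx
  obtain ⟨⟨Z, Zi, hZ1, hZ2⟩, hZ⟩ := hT.isUnit_schur
  simp only at hZ
  subst hZ
  have H1 (i j) := congrFun (congrFun h1 i) j
  have H2 (i j) := congrFun (congrFun h2 i) j
  simp only [Matrix.mul_apply, Fin.sum_univ_five] at H1 H2
  have z (i j : Fin 5) (hi : i < 2) (hj : 2 ≤ j) : T i j = 0 := hT.zero _ _ hi hj
  have hzero (i j : Fin 5) (hi : i < 2) (hj : 2 ≤ j) : G i j = 0 := by
    have hv : (T.submatrix ![0, 1] ![0, 1]).mulVec (fun a => G (![0, 1] a) j) = 0 := by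
      have ne : ∀ i j : Fin 5, i < 2 → 2 ≤ j → i ≠ j := by decide
      ext a
      fin_cases a
      · simpa [Matrix.mulVec, dotProduct, Fin.sum_univ_two, z 0 2, z 0 3, z 0 4,
          Matrix.one_apply_ne (ne 0 j (by decide) hj)] using H1 0 j
      · simpa [Matrix.mulVec, dotProduct, Fin.sum_univ_two, z 1 2, z 1 3, z 1 4,
          Matrix.one_apply_ne (ne 1 j (by decide) hj)] using H1 1 j
    have hv' := congrArg xi.mulVec hv
    rw [Matrix.mulVec_mulVec, hx2, Matrix.one_mulVec, Matrix.mulVec_zero] at hv'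
    have hi' : i = 0 ∨ i = 1 := by revert i; decide
    rcases hi' with rfl | rfl
    · exact congrFun hv' 0
    · exact congrFun hv' 1
  have o1 (i j : Fin 2) : (1 : Matrix (Fin 5) (Fin 5) X) (![2, 3] i) (![2, 3] j) =
      (1 : Matrix (Fin 2) (Fin 2) X) i j := by
    have : ∀ i j : Fin 2, (![2, 3] i : Fin 5) = ![2, 3] j ↔ i = j := by decide
    simp only [Matrix.one_apply, this]
  have o1' (i j : Fin 2) : (1 : Matrix (Fin 5) (Fin 5) X) (![0, 1] i) (![0, 1] j) =
      (1 : Matrix (Fin 2) (Fin 2) X) i j := by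
    have : ∀ i j : Fin 2, (![0, 1] i : Fin 5) = ![0, 1] j ↔ i = j := by decide
    simp only [Matrix.one_apply, this]
  have o2 (i : Fin 2) : (1 : Matrix (Fin 5) (Fin 5) X) (![2, 3] i) 4 = 0 :=
    Matrix.one_apply_ne (by revert i; decide)
  have o3 (i : Fin 2) : (1 : Matrix (Fin 5) (Fin 5) X) 4 (![2, 3] i) = 0 :=
    Matrix.one_apply_ne (by revert i; decide)
  have hxr : T.submatrix ![0, 1] ![0, 1] * G.submatrix ![0, 1] ![0, 1] = 1 := by
    ext i j
    rw [Matrix.mul_apply, ← o1', ← H1]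
    fin_cases i <;> fin_cases j <;> simp [z 0 2, z 0 3, z 0 4, z 1 2, z 1 3, z 1 4]
  have hxl : G.submatrix ![0, 1] ![0, 1] * T.submatrix ![0, 1] ![0, 1] = 1 := by
    rw [← left_inv_eq_right_inv hx2 hxr, hx2]
  have hz0 (j : Fin 2) : G 0 (![2, 3] j) = 0 := hzero _ _ (by decide) (by revert j; decide)
  have hz1 (j : Fin 2) : G 1 (![2, 3] j) = 0 := hzero _ _ (by decide) (by revert j; decide)
  have hz04 : G 0 4 = 0 := hzero _ _ (by decide) (by decide)
  have hz14 : G 1 4 = 0 := hzero _ _ (by decide) (by decide)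
  have tz0 (j : Fin 2) : T 0 (![2, 3] j) = 0 := z _ _ (by decide) (by revert j; decide)
  have tz1 (j : Fin 2) : T 1 (![2, 3] j) = 0 := z _ _ (by decide) (by revert j; decide)
  have tz04 : T 0 4 = 0 := z _ _ (by decide) (by decide)
  have tz14 : T 1 4 = 0 := z _ _ (by decide) (by decide)
  let Y : Matrix (Fin 2) (Fin 2) X := T.submatrix ![2, 3] ![2, 3]
  let B : Matrix (Fin 2) (Fin 1) X := Matrix.of fun i _ => T (![2, 3] i) 4
  let C : Matrix (Fin 1) (Fin 2) X := Matrix.of fun _ j => T 4 (![2, 3] j)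
  let s (u : X) : Matrix (Fin 1) (Fin 1) X := Matrix.of fun _ _ => u
  let Y' : Matrix (Fin 2) (Fin 2) X := G.submatrix ![2, 3] ![2, 3]
  let B' : Matrix (Fin 2) (Fin 1) X := Matrix.of fun i _ => G (![2, 3] i) 4
  let C' : Matrix (Fin 1) (Fin 2) X := Matrix.of fun _ j => G 4 (![2, 3] j)
  have ss (u v : X) : s u * s v = s (u * v) := by
    ext i j; simp [s, Matrix.mul_apply]
  have s1 : s 1 = 1 := by ext i j; fin_cases i; fin_cases j; rfl
  have o4 (i j : Fin 1) : (1 : Matrix (Fin 1) (Fin 1) X) i j =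
      (1 : Matrix (Fin 5) (Fin 5) X) 4 4 := by
    fin_cases i; fin_cases j; rw [Matrix.one_apply_eq, Matrix.one_apply_eq]
  have a1 : Y * Y' + B * C' = 1 := by
    ext i j
    rw [← o1, ← H1]
    simp only [Y, B, C, s, Y', B', C', Matrix.add_apply, Matrix.mul_apply, Matrix.of_apply,
      Matrix.submatrix_apply, Fin.sum_univ_two, Fin.sum_univ_one, Matrix.cons_val_zero,
      Matrix.cons_val_one, Matrix.cons_val_fin_one, hz0, hz1, hz04, hz14, tz0, tz1, tz04, tz14,
      mul_zero, zero_add]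
  have a2 : Y * B' + B * s (G 4 4) = 0 := by
    ext i j
    rw [Matrix.zero_apply, ← o2 i, ← H1]
    simp only [Y, B, C, s, Y', B', C', Matrix.add_apply, Matrix.mul_apply, Matrix.of_apply,
      Matrix.submatrix_apply, Fin.sum_univ_two, Fin.sum_univ_one, Matrix.cons_val_zero,
      Matrix.cons_val_one, Matrix.cons_val_fin_one, hz0, hz1, hz04, hz14, tz0, tz1, tz04, tz14,
      mul_zero, zero_add]
  have a3 : C * Y' + s (T 4 4) * C' = 0 := by
    ext i j
    rw [Matrix.zero_apply, ← o3 j, ← H1]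
    simp only [Y, B, C, s, Y', B', C', Matrix.add_apply, Matrix.mul_apply, Matrix.of_apply,
      Matrix.submatrix_apply, Fin.sum_univ_two, Fin.sum_univ_one, Matrix.cons_val_zero,
      Matrix.cons_val_one, Matrix.cons_val_fin_one, hz0, hz1, hz04, hz14, tz0, tz1, tz04, tz14,
      mul_zero, zero_add]
  have a4 : C * B' + s (T 4 4) * s (G 4 4) = 1 := by
    ext i j
    rw [o4, ← H1]
    simp only [Y, B, C, s, Y', B', C', Matrix.add_apply, Matrix.mul_apply, Matrix.of_apply,
      Matrix.submatrix_apply, Fin.sum_univ_two, Fin.sum_univ_one, Matrix.cons_val_zero,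
      Matrix.cons_val_one, Matrix.cons_val_fin_one, hz0, hz1, hz04, hz14, tz0, tz1, tz04, tz14,
      mul_zero, zero_add]
  have b1 : Y' * Y + B' * C = 1 := by
    ext i j
    rw [← o1, ← H2]
    simp only [Y, B, C, s, Y', B', C', Matrix.add_apply, Matrix.mul_apply, Matrix.of_apply,
      Matrix.submatrix_apply, Fin.sum_univ_two, Fin.sum_univ_one, Matrix.cons_val_zero,
      Matrix.cons_val_one, Matrix.cons_val_fin_one, hz0, hz1, hz04, hz14, tz0, tz1, tz04, tz14,
      mul_zero, zero_add]
  have b3 : C' * Y + s (G 4 4) * C = 0 := by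
    ext i j
    rw [Matrix.zero_apply, ← o3 j, ← H2]
    simp only [Y, B, C, s, Y', B', C', Matrix.add_apply, Matrix.mul_apply, Matrix.of_apply,
      Matrix.submatrix_apply, Fin.sum_univ_two, Fin.sum_univ_one, Matrix.cons_val_zero,
      Matrix.cons_val_one, Matrix.cons_val_fin_one, hz0, hz1, hz04, hz14, tz0, tz1, tz04, tz14,
      mul_zero, zero_add]
  have b4 : C' * B + s (G 4 4) * s (T 4 4) = 1 := by
    ext i j
    rw [o4, ← H2]
    simp only [Y, B, C, s, Y', B', C', Matrix.add_apply, Matrix.mul_apply, Matrix.of_apply,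
      Matrix.submatrix_apply, Fin.sum_univ_two, Fin.sum_univ_one, Matrix.cons_val_zero,
      Matrix.cons_val_one, Matrix.cons_val_fin_one, hz0, hz1, hz04, hz14, tz0, tz1, tz04, tz14,
      mul_zero, zero_add]
  have hk : s (T 4 4 - ∑ a, T 4 (![2, 3] a) * K.mulVec (fun i => T (![2, 3] i) 4) a) =
      s (T 4 4) - C * (K * B) := by
    ext i j
    rw [Matrix.sub_apply, Matrix.mul_apply]
    rfl
  have eB' : B' = -(K * B * s (G 4 4)) := by
    have := congrArg (K * ·) a2
    simp only [mul_add, ← Matrix.mul_assoc, Matrix.mul_add] at this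
    rw [hK2, Matrix.one_mul, Matrix.mul_zero] at this
    exact eq_neg_of_add_eq_zero_left this
  have eC' : C' = -(s (G 4 4) * C * K) := by
    have := congrArg (· * K) b3
    simp only [Matrix.add_mul, Matrix.mul_assoc] at this
    rw [hK1, Matrix.mul_one, Matrix.zero_mul, ← Matrix.mul_assoc] at this
    exact eq_neg_of_add_eq_zero_left this
  set k := T 4 4 - ∑ a, T 4 (![2, 3] a) * K.mulVec (fun i => T (![2, 3] i) 4) a with hk'
  have km : s k * s (G 4 4) = 1 := by
    rw [hk, ← a4, eB', Matrix.sub_mul, Matrix.mul_neg]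
    simp only [Matrix.mul_assoc]; abel
  have mk : s (G 4 4) * s k = 1 := by
    rw [hk, ← b4, eC', Matrix.mul_sub, Matrix.neg_mul]
    simp only [Matrix.mul_assoc]; abel
  have km' : k * G 4 4 = 1 := by
    rw [ss] at km
    exact congrFun (congrFun km 0) 0
  have mk' : G 4 4 * k = 1 := by
    rw [ss] at mk
    exact congrFun (congrFun mk 0) 0
  have hZY : schur T e = Y - B * (s e * C) := by
    ext i j
    simp only [schur, Y, B, C, s, Matrix.sub_apply, Matrix.mul_apply, Matrix.of_apply,
      Matrix.submatrix_apply, Fin.sum_univ_one, mul_assoc]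
  have hZr : schur T e * Y' = 1 := by
    have hC : s e * (C * Y') = -C' := by
      rw [eq_neg_of_add_eq_zero_left a3, Matrix.mul_neg, ← Matrix.mul_assoc, ss, hT.inv_mul, s1,
        Matrix.one_mul]
    rw [hZY, Matrix.sub_mul, Matrix.mul_assoc, Matrix.mul_assoc, hC, ← a1, Matrix.mul_neg]
    abel
  have hZl : Y' * schur T e = 1 := by
    rw [← left_inv_eq_right_inv hZ2 hZr, hZ2]
  refine ⟨hzero, hxr, hxl, hZr, hZl, mk', km', ?_⟩
  have hfin : Y' - B' * (s k * C') = K := by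
    have h3 : s k * C' = -(C * K) := by
      rw [eC', Matrix.mul_neg, ← Matrix.mul_assoc, ← Matrix.mul_assoc, km, Matrix.one_mul]
    calc Y' - B' * (s k * C') = (Y' * Y + B' * C) * K := by
          rw [h3, Matrix.mul_neg, sub_neg_eq_add, Matrix.add_mul, Matrix.mul_assoc Y', hK1,
            Matrix.mul_one, Matrix.mul_assoc B']
      _ = K := by rw [b1, Matrix.one_mul]
  intro i j
  rw [← hfin]
  simp only [Y', B', C', s, Matrix.sub_apply, Matrix.mul_apply, Matrix.of_apply,
    Matrix.submatrix_apply, Fin.sum_univ_one, mul_assoc]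

end

/-! ### The inverse matrix and the identity matrix as points -/

section
variable {X : Type*} [Ring X] [Algebra Cq X] {T G : Matrix (Fin 5) (Fin 5) X} {e : X}

open MulOpposite

theorem opMatrix_even {G : Matrix (Fin 5) (Fin 5) X} {i j : Fin 5} (h : (p i + p j) % 2 = 0) :
    opMatrix p G i j = op (G i j) := by
  simp [opMatrix, h]

/-- Commutation through the Schur complement. -/
theorem Manin21.schur_comm {Y : Matrix (Fin 2) (Fin 2) X} {B C : Fin 2 → X} {d e : X}
    (h : Manin21 Y B C d) (hde : d * e = 1) (hed : e * d = 1) (i j) :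
    B i * e * C j = -(C j * e * B i) := by
  have hq := qpow_mul_qpow_neg
  have eC := inv_swap hde hed (h.Cd j)
  have eB := inv_swap hde hed (h.Bd i)
  rw [mul_assoc, eC, mul_assoc, eB]
  simp only [mul_smul_comm, ← mul_assoc, h.CB, neg_mul, smul_neg, neg_neg]

/-- The matrix of the antipode. -/
theorem IsPoint.antipode (hT : IsPoint T e) (h1 : T * G = 1) (h2 : G * T = 1) :
    ∃ k, IsPoint (opMatrix p G) k := by
  have hm : IsManin p (opMatrix p G) := by
    refine hT.manin.opMatrix topOdd_p h1 h2 fun i hi => ?_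
    have : i = 4 := by revert i; decide
    rw [this]
    exact hT.isUnit_d
  obtain ⟨⟨Y, K, hK1, hK2⟩, hY⟩ := hT.isUnit_y'
  simp only at hY
  subst hY
  have hb := hT.invBlocks h1 h2 hK1 hK2
  set k := T 4 4 - ∑ a, T 4 (![2, 3] a) * K.mulVec (fun i => T (![2, 3] i) 4) a with hk
  have pi (i : Fin 2) : p (![0, 1] i) = 0 := by fin_cases i <;> rfl
  have pj (i : Fin 2) : p (![2, 3] i) = 0 := by fin_cases i <;> rfl
  have p4 : p 4 = 1 := rfl
  have hx : (opMatrix p G).submatrix ![0, 1] ![0, 1] =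
      (G.submatrix ![0, 1] ![0, 1]).map op := by
    ext i j
    simp only [Matrix.submatrix_apply, Matrix.map_apply]
    exact opMatrix_even (by rw [pi, pi])
  have hy : (opMatrix p G).submatrix ![2, 3] ![2, 3] =
      (G.submatrix ![2, 3] ![2, 3]).map op := by
    ext i j
    simp only [Matrix.submatrix_apply, Matrix.map_apply]
    exact opMatrix_even (by rw [pj, pj])
  have h44 : opMatrix p G 4 4 = op (G 4 4) := opMatrix_even rfl
  have e1 : opMatrix p G 4 4 * op k = 1 := by
    rw [h44, ← op_mul, hb.k_mul, op_one]
  have e2 : op k * opMatrix p G 4 4 = 1 := by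
    rw [h44, ← op_mul, hb.mul_k, op_one]
  have hx' := (hT.manin.qMat (u := 0) (v := 1) (by decide) rfl rfl).qdet_op hb.x_mul hb.mul_x
  have hZ := hT.qMat_schur.qdet_op hb.schur_mul hb.mul_schur
  have hY' := (hT.manin.qMat (u := 2) (v := 3) (by decide) rfl rfl).qdet_op hK1 hK2
  -- Over the opposite algebra the odd factors B and C appear in reversed order. Exchanging them by
  -- `schur_comm` costs -1, which the two factors √-1 compensate.
  have hs : schur (opMatrix p G) (op k) = K.map op := by
    ext i j
    have hc := hm.manin21_fin.schur_comm e1 e2 i j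
    have hii : sqrtNegOne * sqrtNegOne = -1 := sqrtNegOne_mul_self
    have o1 (i : Fin 2) : opMatrix p G (![2, 3] i) 4 =
        sqrtNegOne • op (G (![2, 3] i) 4) := by
      simp [opMatrix, pj, p4]
    have o2 (i : Fin 2) : opMatrix p G 4 (![2, 3] i) =
        sqrtNegOne • op (G 4 (![2, 3] i)) := by
      simp [opMatrix, pj, p4]
    simp only [schur, Matrix.of_apply]
    rw [hc, o1, o2, opMatrix_even (by rw [pj, pj]), Matrix.map_apply, ← hb.schur_eq i j]
    simp only [smul_mul_assoc, mul_smul_comm, smul_smul, hii, op_sub, op_mul, neg_smul, one_smul,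
      neg_neg, mul_assoc]
  refine ⟨op k, hm, ?_, e1, e2, ?_, ?_, ?_⟩
  · intro i j hi hj
    simp [opMatrix, hb.zero i j hi hj]
  · rw [hx]
    exact ⟨⟨_, _, hx'.1, hx'.2⟩, rfl⟩
  · rw [hy]
    exact ⟨⟨_, _, hZ.1, hZ.2⟩, rfl⟩
  · rw [hx, hs]
    have hq := hT.manin.manin21_fin.qdet_eq hT.mul_inv hT.inv_mul schur_add hT.isUnit_schur hK1
    rw [← hk] at hq
    -- Here `qdet_eq` expresses det_q Y by the Schur complement and k; together with the Berezinian
    -- relation of T it gives det_q x · det_q Y = k, which is the Berezinian relation for the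
    -- inverse.
    have hab : op (qdet (T.submatrix ![2, 3] ![2, 3])) * op (qdet (T.submatrix ![0, 1] ![0, 1])) =
        op k := by
      rw [← op_mul, hq, ← mul_assoc, ← mul_assoc, hT.ber, one_mul]
    rw [← hab]
    calc _ = qdet ((G.submatrix ![0, 1] ![0, 1]).map op) * (qdet (K.map op) *
          op (qdet (T.submatrix ![2, 3] ![2, 3]))) * op (qdet (T.submatrix ![0, 1] ![0, 1])) := by
          simp only [mul_assoc]
      _ = 1 := by rw [hY'.1, mul_one, hx'.1]

theorem isPoint_one : IsPoint (1 : Matrix (Fin 5) (Fin 5) X) 1 := by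
  have h1 (i j : Fin 5) : (1 : Matrix (Fin 5) (Fin 5) X) i j = if i = j then 1 else 0 :=
    Matrix.one_apply
  have hx : qdet ((1 : Matrix (Fin 5) (Fin 5) X).submatrix ![0, 1] ![0, 1]) = 1 := by
    rw [qdet_fin_two]
    change (1 : Matrix (Fin 5) (Fin 5) X) 0 0 * (1 : Matrix (Fin 5) (Fin 5) X) 1 1 -
      qpow (-1) • ((1 : Matrix (Fin 5) (Fin 5) X) 0 1 * (1 : Matrix (Fin 5) (Fin 5) X) 1 0) = 1
    simp
  have hy : qdet ((1 : Matrix (Fin 5) (Fin 5) X).submatrix ![2, 3] ![2, 3]) = 1 := by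
    rw [qdet_fin_two]
    change (1 : Matrix (Fin 5) (Fin 5) X) 2 2 * (1 : Matrix (Fin 5) (Fin 5) X) 3 3 -
      qpow (-1) • ((1 : Matrix (Fin 5) (Fin 5) X) 2 3 * (1 : Matrix (Fin 5) (Fin 5) X) 3 2) = 1
    simp
  refine ⟨⟨?_, ?_, ?_, ?_, ?_⟩, ?_, by simp, by simp, ?_, ?_, ?_⟩
  · intro i j h
    have : i ≠ j := by rintro rfl; omega
    simp [this]
  · intro i j l h
    by_cases hij : i = j <;> by_cases hil : i = l
    · exact absurd (hij.symm.trans hil) h.ne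
    all_goals simp [h1, hij, hil, h.ne, h.ne']
  · intro i j k h
    by_cases hij : i = j <;> by_cases hil : k = j
    · exact absurd (hij.trans hil.symm) h.ne
    all_goals simp [h1, hij, hil, h.ne, h.ne']
  · intro i j k l h h'
    by_cases hij : i = j <;> by_cases hil : k = l
    · subst hij hil
      exact absurd h h'.not_gt
    all_goals simp [h1, hij, hil]
  · intro i j k l h h'
    have : ¬ (k = j ∧ i = l) := by rintro ⟨rfl, rfl⟩; exact absurd h h'.not_gt
    have hr : (1 : Matrix (Fin 5) (Fin 5) X) k j * (1 : Matrix (Fin 5) (Fin 5) X) i l = 0 := by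
      by_cases hkj : k = j
      · rw [h1 i l, if_neg fun h => this ⟨hkj, h⟩, mul_zero]
      · simp [h1, hkj]
    rw [hr, smul_zero]
    by_cases hij : i = j <;> by_cases hil : k = l
    · subst hij hil
      have : (p i + p i) % 2 = 0 := by omega
      simp [this]
    all_goals simp [h1, hij, hil]
  · intro i j hi hj
    have : ∀ i j : Fin 5, i < 2 → 2 ≤ j → i ≠ j := by decide
    exact Matrix.one_apply_ne (this i j hi hj)
  · rw [hx]; exact isUnit_one
  · rw [hy]; exact isUnit_one
  · have hs : schur (1 : Matrix (Fin 5) (Fin 5) X) 1 =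
        (1 : Matrix (Fin 5) (Fin 5) X).submatrix ![2, 3] ![2, 3] := by
      ext i j
      have : (1 : Matrix (Fin 5) (Fin 5) X) (![2, 3] i) 4 = 0 :=
        Matrix.one_apply_ne (by revert i; decide)
      rw [schur, Matrix.of_apply, this, zero_mul, zero_mul, sub_zero, Matrix.submatrix_apply]
    rw [hs, hx, hy]
    simp

end

/-! ### Super tensor products -/

section
variable {A B C D : Type*} [Ring A] [Algebra Cq A] [SuperAlgebra A] [Ring B] [Algebra Cq B]
  [SuperAlgebra B] [Ring C] [Algebra Cq C] [SuperAlgebra C] [Ring D] [Algebra Cq D]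
  [SuperAlgebra D]

/-- `a` is homogeneous of degree `n` modulo two. -/
def HasDeg (n : ℕ) (a : A) : Prop := parity a = (-1 : Cq) ^ n • a

theorem neg_one_pow_val (n : ℕ) : (-1 : Cq) ^ (n : ZMod 2).val = (-1) ^ n := by
  rw [ZMod.val_natCast, ← neg_one_pow_eq_pow_mod_two]

theorem hasDeg_iff {n : ℕ} {a : A} : HasDeg n a ↔ a ∈ homog A (n : ZMod 2) := by
  rw [mem_homog, neg_one_pow_val, HasDeg]

theorem mem_homog_hasDeg {i : ZMod 2} {a : A} (h : a ∈ homog A i) : HasDeg i.val a := h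

theorem HasDeg.mul {m n : ℕ} {a b : A} (ha : HasDeg m a) (hb : HasDeg n b) :
    HasDeg (m + n) (a * b) := by
  rw [HasDeg, map_mul, ha, hb, smul_mul_smul_comm, pow_add]

theorem hasDeg_one : HasDeg 0 (1 : A) := by simp [HasDeg]

theorem hasDeg_zero_iff {a : A} : HasDeg 0 a ↔ parity a = a := by simp [HasDeg]

theorem hasDeg_one_iff {a : A} : HasDeg 1 a ↔ parity a = -a := by simp [HasDeg]

theorem exists_hasDeg (a : A) : ∃ a₀ a₁ : A, a = a₀ + a₁ ∧ HasDeg 0 a₀ ∧ HasDeg 1 a₁ :=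
  ⟨_, _, (even_add_odd a).symm, mem_homog_hasDeg (evenPart a).2, mem_homog_hasDeg (oddPart a).2⟩

/-- Converts the sign convention of the graded tensor product into scalars of `Cq`, in which all
later signs are computed. -/
theorem zmod_sign {M : Type*} [AddCommGroup M] [Module Cq M] (i j : ZMod 2) (x : M) :
    (-1 : ℤˣ) ^ (i * j) • x = (-1 : Cq) ^ (i.val * j.val) • x := by
  have key : ∀ i : ZMod 2, i = 0 ∨ i = 1 := by decide
  rcases key i with rfl | rfl <;> rcases key j with rfl | rfl <;>
    simp [ZMod.val_one, Units.smul_def]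

theorem st_mul {m n : ℕ} (a : A) {b : B} {a' : A} (b' : B) (hb : HasDeg m b) (ha : HasDeg n a') :
    st a b * st a' b' = (-1 : Cq) ^ (m * n) • st (a * a') (b * b') := by
  have := GradedTensorProduct.tmul_coe_mul_coe_tmul (R := Cq) (homog A) (homog B) a
    ⟨b, hasDeg_iff.1 hb⟩ ⟨a', hasDeg_iff.1 ha⟩ b'
  refine this.trans ?_
  rw [zmod_sign, pow_mul, neg_one_pow_val, ← pow_mul, mul_comm, pow_mul, neg_one_pow_val,
    ← pow_mul, mul_comm]
  rfl

theorem st_add_left (x y : A) (z : B) : st (x + y) z = st x z + st y z :=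
  TensorProduct.add_tmul x y z

theorem st_add_right (x : A) (y z : B) : st x (y + z) = st x y + st x z :=
  TensorProduct.tmul_add x y z

theorem st_smul_left (c : Cq) (x : A) (z : B) : st (c • x) z = c • st x z :=
  (TensorProduct.smul_tmul' c x z).symm

theorem st_smul_right (c : Cq) (x : A) (z : B) : st x (c • z) = c • st x z :=
  TensorProduct.tmul_smul c x z

theorem st_mul_even {b : B} (a a' : A) (b' : B) (hb : HasDeg 0 b) :
    st a b * st a' b' = st (a * a') (b * b') := by
  obtain ⟨u, v, rfl, hu, hv⟩ := exists_hasDeg a'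
  rw [mul_add, st_add_left, st_add_left, mul_add, st_mul _ _ hb hu, st_mul _ _ hb hv]
  simp

theorem st_mul_st_even {a' : A} (a : A) (b b' : B) (ha : HasDeg 0 a') :
    st a b * st a' b' = st (a * a') (b * b') := by
  obtain ⟨u, v, rfl, hu, hv⟩ := exists_hasDeg b
  rw [add_mul, st_add_right, st_add_right, add_mul, st_mul _ _ hu ha, st_mul _ _ hv ha]
  simp

theorem st_induction {P : STensor A B → Prop} (h0 : P 0) (hadd : ∀ x y, P x → P y → P (x + y))
    (h : ∀ (m n : ℕ) (a : A) (b : B), HasDeg m a → HasDeg n b → P (st a b)) (x : STensor A B) :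
    P x := by
  refine TensorProduct.induction_on (motive := P) x h0 (fun a b => ?_) hadd
  obtain ⟨a₀, a₁, rfl, ha₀, ha₁⟩ := exists_hasDeg a
  obtain ⟨b₀, b₁, rfl, hb₀, hb₁⟩ := exists_hasDeg b
  change P (st _ _)
  rw [st_add_left, st_add_right, st_add_right]
  exact hadd _ _ (hadd _ _ (h _ _ _ _ ha₀ hb₀) (h _ _ _ _ ha₀ hb₁))
    (hadd _ _ (h _ _ _ _ ha₁ hb₀) (h _ _ _ _ ha₁ hb₁))

/-- The inclusion of the left factor. -/
def inl (A B : Type*) [Ring A] [Algebra Cq A] [SuperAlgebra A] [Ring B] [Algebra Cq B]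
    [SuperAlgebra B] : A →ₐ[Cq] STensor A B :=
  GradedTensorProduct.includeLeft (homog A) (homog B)

/-- The inclusion of the right factor. -/
def inr (A B : Type*) [Ring A] [Algebra Cq A] [SuperAlgebra A] [Ring B] [Algebra Cq B]
    [SuperAlgebra B] : B →ₐ[Cq] STensor A B :=
  GradedTensorProduct.includeRight (homog A) (homog B)

theorem inl_apply (a : A) : inl A B a = st a 1 := rfl

theorem inr_apply (b : B) : inr A B b = st 1 b := rfl

theorem inl_mul_inr (a : A) (b : B) : inl A B a * inr A B b = st a b := by
  rw [inl_apply, inr_apply, st_mul_even _ _ _ hasDeg_one, mul_one, one_mul]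

theorem inr_mul_inl {m n : ℕ} {a : A} {b : B} (ha : HasDeg m a) (hb : HasDeg n b) :
    inr A B b * inl A B a = (-1 : Cq) ^ (m * n) • (inl A B a * inr A B b) := by
  rw [inl_mul_inr, inl_apply, inr_apply, st_mul _ _ hb ha, mul_one, one_mul, mul_comm]

/-- The images of two algebra maps commute in the super sense. -/
def SuperCommMaps {X : Type*} [Ring X] [Algebra Cq X] (f : A →ₐ[Cq] X) (h : B →ₐ[Cq] X) : Prop :=
  ∀ ⦃m n : ℕ⦄ ⦃a : A⦄ ⦃b : B⦄, HasDeg m a → HasDeg n b →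
    h b * f a = (-1 : Cq) ^ (m * n) • (f a * h b)

/-- The universal property of the super tensor product. -/
def slift {X : Type*} [Ring X] [Algebra Cq X] (f : A →ₐ[Cq] X) (h : B →ₐ[Cq] X)
    (H : SuperCommMaps f h) : STensor A B →ₐ[Cq] X :=
  GradedTensorProduct.lift (homog A) (homog B) f h fun i j a b => by
    rw [H (mem_homog_hasDeg a.2) (mem_homog_hasDeg b.2), zmod_sign, smul_smul,
      mul_comm i.val, neg_one_pow_mul_self, one_smul]

theorem slift_st {X : Type*} [Ring X] [Algebra Cq X] (f : A →ₐ[Cq] X) (h : B →ₐ[Cq] X)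
    (H : SuperCommMaps f h) (a : A) (b : B) : slift f h H (st a b) = f a * h b := rfl

/-- Compatibility of an algebra map with the parities. -/
def IsSuperHom (f : A →ₐ[Cq] B) : Prop := ∀ a, f (parity a) = parity (f a)

theorem IsSuperHom.hasDeg {f : A →ₐ[Cq] B} (hf : IsSuperHom f) {n : ℕ} {a : A} (ha : HasDeg n a) :
    HasDeg n (f a) := by
  rw [HasDeg, ← hf, ha, map_smul]

theorem superCommMaps_inl_inr {A' B' : Type*} [Ring A'] [Algebra Cq A'] [SuperAlgebra A']
    [Ring B'] [Algebra Cq B'] [SuperAlgebra B'] {f : A →ₐ[Cq] A'} {h : B →ₐ[Cq] B'}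
    (hf : IsSuperHom f) (hh : IsSuperHom h) :
    SuperCommMaps ((inl A' B').comp f) ((inr A' B').comp h) :=
  fun _ _ _ _ ha hb => inr_mul_inl (hf.hasDeg ha) (hh.hasDeg hb)

theorem isSuperHom_parity : IsSuperHom (parity : A →ₐ[Cq] A) := fun _ => rfl

theorem isSuperHom_id : IsSuperHom (AlgHom.id Cq A) := fun _ => rfl

/-- The tensor product of two maps of superalgebras. -/
def smap {A' B' : Type*} [Ring A'] [Algebra Cq A'] [SuperAlgebra A']
    [Ring B'] [Algebra Cq B'] [SuperAlgebra B'] (f : A →ₐ[Cq] A') (h : B →ₐ[Cq] B')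
    (hf : IsSuperHom f) (hh : IsSuperHom h) : STensor A B →ₐ[Cq] STensor A' B' :=
  slift _ _ (superCommMaps_inl_inr hf hh)

theorem smap_st {A' B' : Type*} [Ring A'] [Algebra Cq A'] [SuperAlgebra A']
    [Ring B'] [Algebra Cq B'] [SuperAlgebra B'] (f : A →ₐ[Cq] A') (h : B →ₐ[Cq] B')
    (hf : IsSuperHom f) (hh : IsSuperHom h) (a : A) (b : B) :
    smap f h hf hh (st a b) = st (f a) (h b) :=
  inl_mul_inr _ _

instance : SuperAlgebra (STensor A B) where
  parity := smap parity parity isSuperHom_parity isSuperHom_parity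
  parity_parity x := by
    induction x using st_induction with
    | h0 => simp
    | hadd x y hx hy => rw [map_add, map_add, hx, hy]
    | h m n a b => rw [smap_st, smap_st, parity_parity, parity_parity]

theorem parity_st (a : A) (b : B) : parity (st a b) = st (parity a) (parity b) := smap_st _ _ _ _ _ _

theorem HasDeg.st {m n : ℕ} {a : A} {b : B} (ha : HasDeg m a) (hb : HasDeg n b) :
    HasDeg (m + n) (st a b) := by
  rw [HasDeg, parity_st, ha, hb, st_smul_left, st_smul_right, smul_smul, pow_add]

theorem isSuperHom_inl : IsSuperHom (inl A B) := fun a => by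
  rw [inl_apply, inl_apply, parity_st, map_one]

theorem isSuperHom_inr : IsSuperHom (inr A B) := fun a => by
  rw [inr_apply, inr_apply, parity_st, map_one]

theorem smap_toLinearMap {f : A →ₐ[Cq] C} {h : B →ₐ[Cq] D}
    (hf : IsSuperHom f) (hh : IsSuperHom h) (x : STensor A B) :
    smap f h hf hh x = (GradedTensorProduct.of Cq (homog C) (homog D))
      (TensorProduct.map f.toLinearMap h.toLinearMap
        ((GradedTensorProduct.of Cq (homog A) (homog B)).symm x)) := by
  induction x using st_induction with
  | h0 => simp
  | hadd x y hx hy => simp only [map_add, hx, hy]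
  | h m n a b => rw [smap_st]; rfl

theorem superCommMaps_assoc_aux :
    SuperCommMaps (inl A (STensor B C)) ((inr A (STensor B C)).comp (inl B C)) :=
  fun _ _ _ _ ha hb => inr_mul_inl ha (isSuperHom_inl.hasDeg hb)

/-- A homogeneous x is not literally a pure tensor, so the sign rule is first proved for every x in
the form that c passes x at the cost of `parity ^ n` applied to x. That form is additive in x;
homogeneity enters only at the end. -/
theorem superCommMaps_assoc : SuperCommMaps (slift (inl A (STensor B C)) _ superCommMaps_assoc_aux)
    ((inr A (STensor B C)).comp (inr B C)) := by
  intro m n x c hx hc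
  have key (x : STensor A B) : inr A (STensor B C) (inr B C c) *
      slift (inl A (STensor B C)) _ superCommMaps_assoc_aux x =
      slift (inl A (STensor B C)) _ superCommMaps_assoc_aux ((parity ^ n : STensor A B →ₐ[Cq] _) x) *
        inr A (STensor B C) (inr B C c) := by
    induction x using st_induction with
    | h0 => simp
    | hadd x y hx hy => simp only [map_add, mul_add, add_mul, hx, hy]
    | h k l a b ha hb =>
      have hp (j : ℕ) : (parity ^ j : STensor A B →ₐ[Cq] _) (st a b) =
          (-1 : Cq) ^ (j * (k + l)) • st a b := by
        induction j with
        | zero => simp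
        | succ j ih =>
          rw [pow_succ, AlgHom.mul_apply, ha.st hb, map_smul, ih, smul_smul, ← pow_add]
          congr 2; ring
      rw [hp, map_smul, slift_st, ← mul_assoc, inr_mul_inl ha (isSuperHom_inr.hasDeg hc),
        smul_mul_assoc, mul_assoc, AlgHom.comp_apply, ← map_mul, inr_mul_inl hb hc, map_smul,
        map_mul, mul_smul_comm, smul_smul, ← mul_assoc, smul_mul_assoc, ← pow_add]
      congr 2; ring
  have hp (j : ℕ) : (parity ^ j : STensor A B →ₐ[Cq] _) x = (-1 : Cq) ^ (m * j) • x := by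
    induction j with
    | zero => simp
    | succ j ih =>
      rw [pow_succ, AlgHom.mul_apply, hx, map_smul, ih, smul_smul, ← pow_add]
      congr 2; ring
  exact (key x).trans (by rw [hp, map_smul, smul_mul_assoc]; rfl)

/-- The associativity of the super tensor product. -/
def sassoc (A B C : Type*) [Ring A] [Algebra Cq A] [SuperAlgebra A] [Ring B] [Algebra Cq B]
    [SuperAlgebra B] [Ring C] [Algebra Cq C] [SuperAlgebra C] :
    STensor (STensor A B) C →ₐ[Cq] STensor A (STensor B C) :=
  slift (slift (inl A (STensor B C)) _ superCommMaps_assoc_aux) _ superCommMaps_assoc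

theorem sassoc_st (a : A) (b : B) (c : C) : sassoc A B C (st (st a b) c) = st a (st b c) := by
  rw [sassoc, slift_st, slift_st, AlgHom.comp_apply, AlgHom.comp_apply, mul_assoc, ← map_mul,
    inl_mul_inr, inl_mul_inr]

end

/-! ### Comultiplication, counit and antipode -/

theorem HasDeg.congr {A : Type*} [Ring A] [Algebra Cq A] [SuperAlgebra A] {m n : ℕ} {a : A}
    (h : HasDeg m a) (hmn : m % 2 = n % 2) : HasDeg n a := by
  rw [HasDeg, h, neg_one_pow_eq_pow_mod_two, hmn, ← neg_one_pow_eq_pow_mod_two]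

theorem hasDeg_g (i j : Fin 5) : HasDeg (p i + p j) (g i j) :=
  HasDeg.congr (m := π i j) (parity_g i j) (by simp [π])

section
variable {X X' : Type*} [Ring X] [Algebra Cq X] [Ring X'] [Algebra Cq X']

theorem IsManin.map {ι : Type*} [LinearOrder ι] {P : ι → ℕ} {T : Matrix ι ι X} (h : IsManin P T)
    (f : X →ₐ[Cq] X') : IsManin P (T.map f) where
  sq i j hij := by simpa using congrArg f (h.sq i j hij)
  row i j l hjl := by simpa only [Matrix.map_apply, map_mul, map_smul] using congrArg f (h.row i j l hjl)
  col i j k hik := by simpa only [Matrix.map_apply, map_mul, map_smul] using congrArg f (h.col i j k hik)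
  anti i j k l h1 h2 := by simpa only [Matrix.map_apply, map_mul, map_smul] using congrArg f (h.anti i j k l h1 h2)
  diag i j k l h1 h2 := by
    simpa only [Matrix.map_apply, map_mul, map_smul, map_sub] using congrArg f (h.diag i j k l h1 h2)

theorem IsPoint.map {T : Matrix (Fin 5) (Fin 5) X} {e : X} (h : IsPoint T e) (f : X →ₐ[Cq] X') :
    IsPoint (T.map f) (f e) where
  manin := h.manin.map f
  zero i j hi hj := by rw [Matrix.map_apply, h.zero i j hi hj, map_zero]
  mul_inv := by rw [Matrix.map_apply, ← map_mul, h.mul_inv, map_one]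
  inv_mul := by rw [Matrix.map_apply, ← map_mul, h.inv_mul, map_one]
  isUnit_x := by
    rw [Matrix.submatrix_map, ← map_qdet]
    exact h.isUnit_x.map f
  isUnit_y := by
    rw [Matrix.submatrix_map, ← map_qdet]
    exact h.isUnit_y.map f
  ber := by
    have : schur (T.map f) (f e) = (schur T e).map f := by
      ext i j; simp [schur]
    rw [this, Matrix.submatrix_map, ← map_qdet, ← map_qdet, ← map_mul, ← map_mul, h.ber, map_one]

/-- The entries of g ⊗ 1 and 1 ⊗ g commute in the super sense by construction of the super tensor
product, so their product is a point by `IsPoint.mul`. -/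
theorem exists_comul : ∃ Δ : Pq →ₐ[Cq] STensor Pq Pq, ∀ i j,
    Δ (g i j) = ∑ k, st (g i k) (g k j) := by
  have hs : SuperCommute p (g.map (inl Pq Pq)) (g.map (inr Pq Pq)) := by
    intro i j k l
    rw [mul_comm (p i + p j)]
    exact inr_mul_inl (hasDeg_g k l) (hasDeg_g i j)
  obtain ⟨k, hk⟩ := (isPoint_g.map (inl Pq Pq)).mul (isPoint_g.map (inr Pq Pq)) hs
  obtain ⟨f, hf⟩ := hk.exists_lift
  refine ⟨f, fun i j => ?_⟩
  rw [hf, Matrix.mul_apply]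
  exact Finset.sum_congr rfl fun k _ => inl_mul_inr _ _

/-- The comultiplication. -/
def comul : Pq →ₐ[Cq] STensor Pq Pq := exists_comul.choose

theorem comul_g (i j : Fin 5) : comul (g i j) = ∑ k, st (g i k) (g k j) :=
  exists_comul.choose_spec i j

theorem exists_counit : ∃ ε : Pq →ₐ[Cq] Cq, ∀ i j, ε (g i j) = if i = j then 1 else 0 := by
  obtain ⟨f, hf⟩ := (isPoint_one (X := Cq)).exists_lift
  exact ⟨f, fun i j => by rw [hf, Matrix.one_apply]⟩

/-- The counit. -/
def counit : Pq →ₐ[Cq] Cq := exists_counit.choose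

theorem counit_g (i j : Fin 5) : counit (g i j) = if i = j then 1 else 0 :=
  exists_counit.choose_spec i j

/-- The inverse of the generating matrix. -/
def ginv : Matrix (Fin 5) (Fin 5) Pq := (isPoint_g.isUnit.unit⁻¹ : (Matrix (Fin 5) (Fin 5) Pq)ˣ)

theorem g_mul_ginv : g * ginv = 1 := isPoint_g.isUnit.mul_val_inv

theorem ginv_mul_g : ginv * g = 1 := isPoint_g.isUnit.val_inv_mul

theorem sum_g_mul_ginv (i j : Fin 5) : ∑ k, g i k * ginv k j = if i = j then 1 else 0 := by
  rw [← Matrix.mul_apply, g_mul_ginv, Matrix.one_apply]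

theorem sum_ginv_mul_g (i j : Fin 5) : ∑ k, ginv i k * g k j = if i = j then 1 else 0 := by
  rw [← Matrix.mul_apply, ginv_mul_g, Matrix.one_apply]

/-- The signed matrix N and the image of `ginv` under the parity are both inverse to the image of g,
so they coincide. -/
theorem parity_ginv (i j : Fin 5) : parity (ginv i j) = (-1 : Cq) ^ (p i + p j) • ginv i j := by
  let N : Matrix (Fin 5) (Fin 5) Pq := Matrix.of fun i j => (-1 : Cq) ^ (p i + p j) • ginv i j
  have h1 : g.map parity * ginv.map (parity : Pq →ₐ[Cq] Pq) = 1 := by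
    rw [← Matrix.map_mul, g_mul_ginv, Matrix.map_one _ (map_zero _) (map_one _)]
  have h2 : N * g.map (parity : Pq →ₐ[Cq] Pq) = 1 := by
    ext i j
    rw [Matrix.mul_apply, Matrix.one_apply]
    have : ∀ k, N i k * g.map (parity : Pq →ₐ[Cq] Pq) k j =
        (-1 : Cq) ^ (p i + p j) • (ginv i k * g k j) := by
      intro k
      have hk := hasDeg_g k j
      rw [HasDeg] at hk
      rw [Matrix.map_apply, hk]
      change (-1 : Cq) ^ (p i + p k) • ginv i k * _ = _
      rw [smul_mul_smul_comm, ← pow_add]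
      congr 1
      rw [show p i + p k + (p k + p j) = p i + p j + (p k + p k) by ring, pow_add, pow_add _ (p k),
        neg_one_pow_mul_self, mul_one]
    simp only [this]
    rw [← Finset.smul_sum, sum_ginv_mul_g]
    split_ifs with h
    · subst h; rw [pow_add, neg_one_pow_mul_self, one_smul]
    · rw [smul_zero]
  have h3 : N = ginv.map parity := left_inv_eq_right_inv h2 h1
  exact (congrFun (congrFun h3 i) j).symm

open MulOpposite

theorem exists_antiHom : ∃ f : Pq →ₐ[Cq] Pqᵐᵒᵖ, ∀ i j,
    f (g i j) = sqrtNegOne ^ ((p i + p j) % 2) • op (ginv i j) := by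
  obtain ⟨k, hk⟩ := isPoint_g.antipode g_mul_ginv ginv_mul_g
  obtain ⟨f, hf⟩ := hk.exists_lift
  exact ⟨f, hf⟩

/-- The antipode up to signs, as a map to the opposite algebra. -/
def antiHom : Pq →ₐ[Cq] Pqᵐᵒᵖ := exists_antiHom.choose

theorem antiHom_g (i j : Fin 5) :
    antiHom (g i j) = sqrtNegOne ^ ((p i + p j) % 2) • op (ginv i j) :=
  exists_antiHom.choose_spec i j

theorem unop_antiHom_parity (a : Pq) : unop (antiHom (parity a)) = parity (unop (antiHom a)) := by
  have : antiHom.comp (parity : Pq →ₐ[Cq] Pq) = (AlgHom.op parity).comp antiHom := by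
    refine Pq.algHom_ext fun i j => ?_
    have h := hasDeg_g i j
    rw [HasDeg] at h
    rw [AlgHom.comp_apply, AlgHom.comp_apply, h, map_smul, antiHom_g, map_smul]
    change _ = _ • op (parity (ginv i j))
    rw [parity_ginv, op_smul, smul_comm]
  exact congrArg unop (DFunLike.congr_fun this a)

/-- The antipode. -/
def antipode : Pq →ₗ[Cq] Pq :=
  (opLinearEquiv Cq).symm.toLinearMap ∘ₗ antiHom.toLinearMap ∘ₗ
    -- This combination is the identity on even elements and multiplication by -√-1 on odd ones; it
    -- removes the factor √-1 built into `antiHom`.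
    ((half * (1 - sqrtNegOne)) • LinearMap.id +
      (half * (1 + sqrtNegOne)) • (parity : Pq →ₐ[Cq] Pq).toLinearMap)

theorem antipode_apply (a : Pq) : antipode a = (half * (1 - sqrtNegOne)) • unop (antiHom a) +
    (half * (1 + sqrtNegOne)) • unop (antiHom (parity a)) := by
  change unop (antiHom ((half * (1 - sqrtNegOne)) • a +
    (half * (1 + sqrtNegOne)) • parity a)) = _
  rw [map_add, map_smul, map_smul, unop_add, unop_smul, unop_smul]

theorem antipode_of_even {a : Pq} (h : HasDeg 0 a) : antipode a = unop (antiHom a) := by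
  rw [antipode_apply, hasDeg_zero_iff.1 h, ← add_smul]
  have : half * (1 - sqrtNegOne) + half * (1 + sqrtNegOne) = half + half := by ring
  rw [this, half_add_half, one_smul]

theorem antipode_of_odd {a : Pq} (h : HasDeg 1 a) :
    antipode a = -(sqrtNegOne • unop (antiHom a)) := by
  rw [antipode_apply, hasDeg_one_iff.1 h, map_neg, unop_neg, smul_neg, ← sub_eq_add_neg, ← sub_smul]
  have : half * (1 - sqrtNegOne) - half * (1 + sqrtNegOne) = -((half + half) * sqrtNegOne) := by ring
  rw [this, half_add_half, one_mul, neg_smul]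

theorem HasDeg.zero_or_one {A : Type*} [Ring A] [Algebra Cq A] [SuperAlgebra A] {n : ℕ} {a : A}
    (h : HasDeg n a) : (HasDeg 0 a ∧ n % 2 = 0) ∨ (HasDeg 1 a ∧ n % 2 = 1) := by
  rcases Nat.mod_two_eq_zero_or_one n with hn | hn
  · exact Or.inl ⟨h.congr (by omega), hn⟩
  · exact Or.inr ⟨h.congr (by omega), hn⟩

/-- `antiHom` reverses products without sign. Two odd factors contribute (-√-1)² = -1, which is the
Koszul sign. -/
theorem antipode_mul {m n : ℕ} {a b : Pq} (ha : HasDeg m a) (hb : HasDeg n b) :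
    antipode (a * b) = (-1 : Cq) ^ (m * n) • (antipode b * antipode a) := by
  have hab := ha.mul hb
  rw [neg_one_pow_eq_pow_mod_two, Nat.mul_mod]
  rcases ha.zero_or_one with ⟨ha, hm⟩ | ⟨ha, hm⟩ <;> rcases hb.zero_or_one with ⟨hb, hn⟩ | ⟨hb, hn⟩
  · rw [antipode_of_even (hab.congr (by omega)), antipode_of_even ha, antipode_of_even hb, hm, hn,
      map_mul, unop_mul]
    simp
  · rw [antipode_of_odd (hab.congr (by omega)), antipode_of_even ha, antipode_of_odd hb, hm, hn,
      map_mul, unop_mul]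
    simp
  · rw [antipode_of_odd (hab.congr (by omega)), antipode_of_odd ha, antipode_of_even hb, hm, hn,
      map_mul, unop_mul]
    simp
  · rw [antipode_of_even (hab.congr (by omega)), antipode_of_odd ha, antipode_of_odd hb, hm, hn,
      map_mul, unop_mul, neg_mul_neg, smul_mul_smul_comm, sqrtNegOne_mul_self]
    simp

theorem antipode_g (i j : Fin 5) : antipode (g i j) = ginv i j := by
  rcases Nat.mod_two_eq_zero_or_one (p i + p j) with h | h
  · rw [antipode_of_even ((hasDeg_g i j).congr (by omega)), antiHom_g, h]
    simp
  · rw [antipode_of_odd ((hasDeg_g i j).congr (by omega)), antiHom_g, h, pow_one, unop_smul,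
      smul_smul, sqrtNegOne_mul_self]
    simp

theorem antipode_one : antipode 1 = 1 := by
  rw [antipode_of_even hasDeg_one, map_one, unop_one]

theorem antipode_parity (a : Pq) : antipode (parity a) = parity (antipode a) := by
  rw [antipode_apply, antipode_apply]
  simp only [unop_antiHom_parity, map_add, map_smul]

theorem counit_parity (a : Pq) : counit (parity a) = counit a := by
  have : counit.comp (parity : Pq →ₐ[Cq] Pq) = counit := by
    refine Pq.algHom_ext fun i j => ?_
    have h := hasDeg_g i j
    rw [HasDeg] at h
    rw [AlgHom.comp_apply, h, map_smul, counit_g]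
    split_ifs with h
    · subst h; rw [pow_add, neg_one_pow_mul_self, one_smul]
    · rw [smul_zero]
  exact DFunLike.congr_fun this a

theorem isSuperHom_comul : IsSuperHom comul := by
  intro a
  have : comul.comp (parity : Pq →ₐ[Cq] Pq) = (parity : STensor Pq Pq →ₐ[Cq] _).comp comul := by
    refine Pq.algHom_ext fun i j => ?_
    have h := hasDeg_g i j
    rw [HasDeg] at h
    rw [AlgHom.comp_apply, AlgHom.comp_apply, h, map_smul, comul_g, map_sum, Finset.smul_sum]
    refine Finset.sum_congr rfl fun k _ => ?_
    refine (((hasDeg_g i k).st (hasDeg_g k j)).congr ?_).symm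
    omega
  exact DFunLike.congr_fun this a

end

/-! ### The Hopf superalgebra structure -/

section
variable {A W X : Type*} [Ring A] [Algebra Cq A] [Ring W] [Algebra Cq W] [AddCommGroup X]
  [Module Cq X]

/-- The elements whose left multiplication is turned by `F` into the multiplication by a scalar. -/
def leftScalar (Δ : A →ₐ[Cq] W) (ε : A →ₐ[Cq] Cq) (F : W →ₗ[Cq] X) : Subalgebra Cq A where
  carrier := {a | ∀ Y, F (Δ a * Y) = ε a • F Y}
  mul_mem' {a b} ha hb Y := by rw [map_mul Δ, mul_assoc, ha, hb, map_mul, smul_smul]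
  add_mem' {a b} ha hb Y := by rw [map_add, add_mul, map_add, ha, hb, map_add, add_smul]
  algebraMap_mem' r Y := by
    rw [AlgHom.commutes, AlgHom.commutes, ← Algebra.smul_def, map_smul]; rfl

/-- The elements whose right multiplication is turned by `F` into the multiplication by a
scalar. -/
def rightScalar (Δ : A →ₐ[Cq] W) (ε : A →ₐ[Cq] Cq) (F : W →ₗ[Cq] X) : Subalgebra Cq A where
  carrier := {a | ∀ Y, F (Y * Δ a) = ε a • F Y}
  mul_mem' {a b} ha hb Y := by
    rw [map_mul Δ, ← mul_assoc, hb, ha, map_mul, smul_smul, mul_comm]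
  add_mem' {a b} ha hb Y := by rw [map_add, mul_add, map_add, ha, hb, map_add, add_smul]
  algebraMap_mem' r Y := by
    rw [AlgHom.commutes, AlgHom.commutes, ← Algebra.commutes, ← Algebra.smul_def, map_smul]; rfl

theorem leftScalar_inv {Δ : A →ₐ[Cq] W} {ε : A →ₐ[Cq] Cq} {F : W →ₗ[Cq] X} {a b : A}
    (hab : a * b = 1) (ha : a ∈ leftScalar Δ ε F) : b ∈ leftScalar Δ ε F := fun Y => by
  have h := ha (Δ b * Y)
  rw [← mul_assoc, ← map_mul, hab, map_one, one_mul] at h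
  rw [h, smul_smul, mul_comm, ← map_mul, hab, map_one, one_smul]

theorem rightScalar_inv {Δ : A →ₐ[Cq] W} {ε : A →ₐ[Cq] Cq} {F : W →ₗ[Cq] X} {a b : A}
    (hba : b * a = 1) (ha : a ∈ rightScalar Δ ε F) : b ∈ rightScalar Δ ε F := fun Y => by
  have h := ha (Y * Δ b)
  rw [mul_assoc, ← map_mul, hba, map_one, mul_one] at h
  rw [h, smul_smul, ← map_mul, hba, map_one, one_smul]

end

section
variable {A B X : Type*} [Ring A] [Algebra Cq A] [SuperAlgebra A] [Ring B] [Algebra Cq B]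
  [SuperAlgebra B] [Ring X] [Algebra Cq X]

/-- The linear map `a ⊗ b ↦ φ a ψ b`. -/
def conv (φ : A →ₗ[Cq] X) (ψ : B →ₗ[Cq] X) : STensor A B →ₗ[Cq] X :=
  LinearMap.mul' Cq X ∘ₗ TensorProduct.map φ ψ ∘ₗ
    (GradedTensorProduct.of Cq (homog A) (homog B)).symm.toLinearMap

theorem conv_st (φ : A →ₗ[Cq] X) (ψ : B →ₗ[Cq] X) (a : A) (b : B) :
    conv φ ψ (st a b) = φ a * ψ b := rfl

end

theorem st_sum_left {A B ι : Type*} [Ring A] [Algebra Cq A] [SuperAlgebra A] [Ring B] [Algebra Cq B]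
    [SuperAlgebra B] (s : Finset ι) (f : ι → A) (b : B) :
    st (∑ i ∈ s, f i) b = ∑ i ∈ s, st (f i) b := TensorProduct.sum_tmul s f b

theorem st_sum_right {A B ι : Type*} [Ring A] [Algebra Cq A] [SuperAlgebra A] [Ring B]
    [Algebra Cq B] [SuperAlgebra B] (s : Finset ι) (a : A) (f : ι → B) :
    st a (∑ i ∈ s, f i) = ∑ i ∈ s, st a (f i) := TensorProduct.tmul_sum a s f

/-- The axiom is not an equality of algebra maps. Its strengthening F(Δ(a) Y) = ε(a) F(Y) for all Y
is stable under products and inverses in a, so it suffices to take a = g i j. There S(g_ik a') = ±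
S(a') S(g_ik) puts `ginv i k` next to g k j, and the sum over k collapses. The axiom is the case Y =
1. -/
theorem conv_antipode_id (a : Pq) :
    conv antipode LinearMap.id (comul a) = algebraMap Cq Pq (counit a) := by
  have h : leftScalar comul counit (conv antipode LinearMap.id) = ⊤ := by
    refine Pq.eq_top_of_mem (fun i j Y => ?_) fun a b hab _ ha => leftScalar_inv hab ha
    induction Y using st_induction with
    | h0 => simp
    | hadd x y hx hy => rw [mul_add, map_add, map_add, hx, hy, smul_add]
    | h m n a b ha hb =>
      rw [comul_g, Finset.sum_mul, map_sum]
      have (k : Fin 5) : conv antipode LinearMap.id (st (g i k) (g k j) * st a b) =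
          (-1 : Cq) ^ (m * (p i + p j)) • (antipode a * (ginv i k * g k j) * b) := by
        rw [st_mul _ _ (hasDeg_g k j) ha, map_smul, conv_st, antipode_mul (hasDeg_g i k) ha,
          smul_mul_assoc, smul_smul, antipode_g, LinearMap.id_apply, ← pow_add]
        rw [show (p k + p j) * m + (p i + p k) * m = m * (p i + p j) + (p k * m + p k * m) by ring,
          pow_add, pow_add _ (p k * m), neg_one_pow_mul_self, mul_one]
        simp only [mul_assoc]
      simp only [this]
      rw [← Finset.smul_sum, ← Finset.sum_mul, ← Finset.mul_sum, sum_ginv_mul_g, counit_g]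
      split_ifs with hij
      · subst hij
        rw [mul_add, pow_add, neg_one_pow_mul_self, mul_one]
        rfl
      · simp
  have ha : a ∈ leftScalar comul counit (conv antipode LinearMap.id) := h ▸ Algebra.mem_top
  have := ha (st 1 1)
  rw [conv_st, antipode_one] at this
  rw [Algebra.algebraMap_eq_smul_one]
  simpa [show (st (1 : Pq) (1 : Pq)) = 1 from rfl] using this

theorem conv_id_antipode_aux {i j : Fin 5} {n : ℕ} {a b : Pq} (hb : HasDeg n b) :
    conv LinearMap.id antipode (st a b * ∑ k, st (g i k) (g k j)) =
      counit (g i j) • conv LinearMap.id antipode (st a b) := by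
  rw [Finset.mul_sum, map_sum]
  have (k : Fin 5) : conv LinearMap.id antipode (st a b * st (g i k) (g k j)) =
      (-1 : Cq) ^ (n * (p i + p j)) • (a * (g i k * ginv k j) * antipode b) := by
    rw [st_mul _ _ hb (hasDeg_g i k), map_smul, conv_st, antipode_mul hb (hasDeg_g k j),
      mul_smul_comm, smul_smul, antipode_g, LinearMap.id_apply, ← pow_add]
    rw [show n * (p i + p k) + n * (p k + p j) = n * (p i + p j) + (n * p k + n * p k) by ring,
      pow_add, pow_add _ (n * p k), neg_one_pow_mul_self, mul_one]
    simp only [mul_assoc]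
  simp only [this]
  rw [← Finset.smul_sum, ← Finset.sum_mul, ← Finset.mul_sum, sum_g_mul_ginv, counit_g]
  split_ifs with hij
  · subst hij
    rw [mul_add, pow_add, neg_one_pow_mul_self, mul_one]
    rfl
  · simp

/-- Mirror image of the previous argument, with Y on the left. It is isolated because the retraction
onto the big cell uses it again. -/
theorem conv_id_antipode_mul (i j : Fin 5) (Y : STensor Pq Pq) :
    conv LinearMap.id antipode (Y * ∑ k, st (g i k) (g k j)) =
      counit (g i j) • conv LinearMap.id antipode Y := by
  induction Y using st_induction with
  | h0 => simp
  | hadd x y hx hy => rw [add_mul, map_add, map_add, hx, hy, smul_add]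
  | h m n a b ha hb => exact conv_id_antipode_aux hb

theorem conv_id_antipode (a : Pq) :
    conv LinearMap.id antipode (comul a) = algebraMap Cq Pq (counit a) := by
  have h : rightScalar comul counit (conv LinearMap.id antipode) = ⊤ := by
    refine Pq.eq_top_of_mem (fun i j Y => ?_) fun a b _ hba ha => rightScalar_inv hba ha
    rw [comul_g, conv_id_antipode_mul]
  have ha : a ∈ rightScalar comul counit (conv LinearMap.id antipode) := h ▸ Algebra.mem_top
  have := ha (st 1 1)
  rw [conv_st, antipode_one] at this
  rw [Algebra.algebraMap_eq_smul_one]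
  simpa [show (st (1 : Pq) (1 : Pq)) = 1 from rfl] using this

theorem comul_coassoc (a : Pq) :
    sassoc Pq Pq Pq (smap comul (AlgHom.id Cq Pq) isSuperHom_comul isSuperHom_id (comul a)) =
      smap (AlgHom.id Cq Pq) comul isSuperHom_id isSuperHom_comul (comul a) := by
  have : ((sassoc Pq Pq Pq).comp
      (smap comul (AlgHom.id Cq Pq) isSuperHom_comul isSuperHom_id)).comp comul =
      (smap (AlgHom.id Cq Pq) comul isSuperHom_id isSuperHom_comul).comp comul := by
    refine Pq.algHom_ext fun i j => ?_
    simp only [AlgHom.comp_apply, comul_g, map_sum, smap_st, st_sum_left, st_sum_right, sassoc_st,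
      AlgHom.id_apply]
    exact Finset.sum_comm
  exact DFunLike.congr_fun this a

section
variable {A B C : Type*} [Ring A] [Algebra Cq A] [SuperAlgebra A] [Ring B] [Algebra Cq B]
  [SuperAlgebra B] [Ring C] [Algebra Cq C] [SuperAlgebra C]

/-- The super tensor product has the same underlying module as the ordinary one, so x and z are one
element seen in two types. This transfers coassociativity from algebra maps to the linear form of
the axiom. -/
theorem sassoc_eq (x : STensor (STensor A B) C) (z : (A ⊗[Cq] B) ⊗[Cq] C) (hxz : x = z) :
    sassoc A B C x = TensorProduct.assoc Cq A B C z := by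
  subst hxz
  refine TensorProduct.induction_on (motive := fun x : (A ⊗[Cq] B) ⊗[Cq] C =>
    sassoc A B C x = TensorProduct.assoc Cq A B C x) x ?_ (fun u c => ?_) ?_
  · rw [map_zero]; exact map_zero (sassoc A B C)
  · refine TensorProduct.induction_on (motive := fun u : A ⊗[Cq] B =>
      sassoc A B C (st (A := STensor A B) u c) = TensorProduct.assoc Cq A B C (u ⊗ₜ c)) u ?_
      (fun a b => ?_) ?_
    · rw [TensorProduct.zero_tmul, map_zero]
      have : st (A := STensor A B) 0 c = 0 := TensorProduct.zero_tmul _ _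
      exact (congrArg _ this).trans (map_zero _)
    · exact sassoc_st a b c
    · intro u v hu hv
      rw [TensorProduct.add_tmul, map_add, ← hu, ← hv]
      exact (congrArg _ (st_add_left (A := STensor A B) u v c)).trans (map_add _ _ _)
  · intro x y hx hy
    rw [map_add, ← hx, ← hy]
    exact map_add (sassoc A B C) x y

end

theorem counit_of_odd {a : Pq} (h : HasDeg 1 a) : counit a = 0 := by
  have h1 := counit_parity a
  rw [hasDeg_one_iff.1 h, map_neg] at h1
  have h2 : counit a + counit a = 0 := by nth_rw 1 [← h1]; simp
  have h2 : half * (counit a + counit a) = 0 := by rw [h2, mul_zero]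
  rwa [← mul_two, mul_left_comm, show half * 2 = half + half by ring, half_add_half, mul_one] at h2

/-- The counit kills odd elements, so every sign that could obstruct commutation is multiplied by
zero. -/
theorem superCommMaps_counit {A : Type*} [Ring A] [Algebra Cq A] [SuperAlgebra A] :
    SuperCommMaps ((Algebra.ofId Cq A).comp counit) (AlgHom.id Cq A) := by
  intro m n a b ha hb
  rw [AlgHom.comp_apply, AlgHom.id_apply, Algebra.ofId_apply, ← Algebra.commutes,
    ← Algebra.smul_def]
  rcases ha.zero_or_one with ⟨ha, hm⟩ | ⟨ha, hm⟩
  · rw [pow_mul, neg_one_pow_eq_pow_mod_two, hm, pow_zero, one_pow, one_smul]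
  · rw [counit_of_odd ha, zero_smul, smul_zero]

theorem superCommMaps_counit_right {A : Type*} [Ring A] [Algebra Cq A] [SuperAlgebra A] :
    SuperCommMaps (AlgHom.id Cq A) ((Algebra.ofId Cq A).comp counit) := by
  intro m n a b ha hb
  rw [AlgHom.comp_apply, AlgHom.id_apply, Algebra.ofId_apply, ← Algebra.commutes,
    ← Algebra.smul_def]
  rcases hb.zero_or_one with ⟨hb, hm⟩ | ⟨hb, hm⟩
  · rw [mul_comm, pow_mul, neg_one_pow_eq_pow_mod_two, hm, pow_zero, one_pow, one_smul]
  · rw [counit_of_odd hb, zero_smul, smul_zero]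

theorem lid_map_counit {A : Type*} [Ring A] [Algebra Cq A] [SuperAlgebra A] (X : STensor Pq A) :
    TensorProduct.lid Cq A (TensorProduct.map counit.toLinearMap LinearMap.id
      ((GradedTensorProduct.of Cq (homog Pq) (homog A)).symm X)) =
      slift _ _ (superCommMaps_counit (A := A)) X := by
  induction X using st_induction with
  | h0 => simp
  | hadd x y hx hy => simp only [map_add, hx, hy]
  | h m n a b => rw [slift_st]; exact Algebra.smul_def _ _

theorem rid_map_counit {A : Type*} [Ring A] [Algebra Cq A] [SuperAlgebra A] (X : STensor A Pq) :
    TensorProduct.rid Cq A (TensorProduct.map LinearMap.id counit.toLinearMap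
      ((GradedTensorProduct.of Cq (homog A) (homog Pq)).symm X)) =
      slift _ _ (superCommMaps_counit_right (A := A)) X := by
  induction X using st_induction with
  | h0 => simp
  | hadd x y hx hy => simp only [map_add, hx, hy]
  | h m n a b => rw [slift_st]; exact (Algebra.smul_def _ _).trans (Algebra.commutes _ _)

theorem isHopfSuperalgebra : IsHopfSuperalgebra comul counit antipode where
  comul_even := LinearMap.ext fun a =>
    (isSuperHom_comul a).trans (smap_toLinearMap isSuperHom_parity isSuperHom_parity (comul a))
  counit_even := LinearMap.ext counit_parity
  antipode_even := LinearMap.ext antipode_parity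
  coassoc := LinearMap.ext fun a => by
    have h := comul_coassoc a
    rw [sassoc_eq _ _ (smap_toLinearMap isSuperHom_comul isSuperHom_id (comul a)),
      smap_toLinearMap isSuperHom_id isSuperHom_comul (comul a)] at h
    exact h
  counit_left := by
    have : (slift _ _ (superCommMaps_counit (A := Pq))).comp comul = AlgHom.id Cq Pq := by
      refine Pq.algHom_ext fun i j => ?_
      simp [comul_g, slift_st, counit_g]
    exact LinearMap.ext fun a => (lid_map_counit (comul a)).trans (DFunLike.congr_fun this a)
  counit_right := by
    have : (slift _ _ (superCommMaps_counit_right (A := Pq))).comp comul = AlgHom.id Cq Pq := by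
      refine Pq.algHom_ext fun i j => ?_
      simp [comul_g, slift_st, counit_g]
    exact LinearMap.ext fun a => (rid_map_counit (comul a)).trans (DFunLike.congr_fun this a)
  antipode_left := LinearMap.ext conv_antipode_id
  antipode_right := LinearMap.ext conv_id_antipode

/-! ### The comultiplication on the big cell -/

theorem isUnit_x : IsUnit x := isPoint_g.isUnit_x'

theorem isUnit_y : IsUnit y := isPoint_g.isUnit_y'

theorem isUnit_d : IsUnit d := isPoint_g.isUnit_d

theorem x_mul_inverse : x * Ring.inverse x = 1 := Ring.mul_inverse_cancel x isUnit_x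

theorem inverse_mul_x : Ring.inverse x * x = 1 := Ring.inverse_mul_cancel x isUnit_x

/-- By block triangularity the upper left block of g⁻¹ is x⁻¹; this is the source of S(x) = x⁻¹. -/
theorem inverse_x : Ring.inverse x = ginv.submatrix ![0, 1] ![0, 1] := by
  have h := isPoint_g.invBlocks g_mul_ginv ginv_mul_g
    (Ring.mul_inverse_cancel y isUnit_y) (Ring.inverse_mul_cancel y isUnit_y)
  exact left_inv_eq_right_inv inverse_mul_x h.x_mul

theorem map_antipode_x : x.map antipode = Ring.inverse x := by
  ext i j
  rw [inverse_x, Matrix.map_apply]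
  exact antipode_g _ _

theorem antipode_x (i j : Fin 2) : antipode (x i j) = Ring.inverse x i j := by
  rw [← map_antipode_x, Matrix.map_apply]

theorem hasDeg_inverse_x (i j : Fin 2) : HasDeg 0 (Ring.inverse x i j) :=
  hasDeg_zero_iff.2 (parity_inverse_x i j)

/-- The column `(a_35, a_45)`. -/
def colB (i : Fin 2) : Pq := g (![2, 3] i) 4

/-- The row `(a_53, a_54)`. -/
def rowC (j : Fin 2) : Pq := g 4 (![2, 3] j)

theorem comul_map_x : x.map comul = x.map (inl Pq Pq) * x.map (inr Pq Pq) := by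
  ext i j
  rw [Matrix.mul_apply, Matrix.map_apply]
  refine (comul_g _ _).trans ?_
  rw [Fin.sum_univ_five, Fin.sum_univ_two]
  simp only [Matrix.map_apply, inl_mul_inr]
  have h (k : Fin 5) (hk : 2 ≤ k) : st (g (![0, 1] i) k) (g k (![0, 1] j)) = 0 := by
    rw [g_zero _ _ (by revert i; decide) hk]
    exact TensorProduct.zero_tmul _ _
  rw [h 2 (by decide), h 3 (by decide), h 4 (by decide), add_zero, add_zero, add_zero]
  rfl

/-- Inverting Δ(x) = (x ⊗ 1)(1 ⊗ x) reverses the factors: 1 ⊗ x⁻¹ comes first, ready to combine with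
the second tensor factor of the preceding entry. -/
theorem comul_map_inverse_x : (Ring.inverse x).map comul =
    (Ring.inverse x).map (inr Pq Pq) * (Ring.inverse x).map (inl Pq Pq) := by
  have h1 : (Ring.inverse x).map comul * x.map comul = 1 := by
    rw [← Matrix.map_mul, inverse_mul_x, Matrix.map_one _ (map_zero _) (map_one _)]
  have h2 : x.map comul * ((Ring.inverse x).map (inr Pq Pq) * (Ring.inverse x).map (inl Pq Pq)) = 1 := by
    have e1 : x.map (inr Pq Pq) * (Ring.inverse x).map (inr Pq Pq) = 1 := by
      rw [← Matrix.map_mul, x_mul_inverse, Matrix.map_one _ (map_zero _) (map_one _)]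
    have e2 : x.map (inl Pq Pq) * (Ring.inverse x).map (inl Pq Pq) = 1 := by
      rw [← Matrix.map_mul, x_mul_inverse, Matrix.map_one _ (map_zero _) (map_one _)]
    rw [comul_map_x, mul_assoc, ← mul_assoc (x.map (inr Pq Pq)), e1, one_mul, e2]
  exact left_inv_eq_right_inv h1 h2

theorem st_mul_inl_inverse (a b : Pq) (i j : Fin 2) :
    inl Pq Pq a * inr Pq Pq b * inl Pq Pq (Ring.inverse x i j) = st (a * Ring.inverse x i j) b := by
  rw [inl_mul_inr, inl_apply, st_mul_st_even _ _ _ (hasDeg_inverse_x i j), mul_one]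

/-- The comultiplication of the rows of `(a_ij) x⁻¹`, `i > 2`, `j ≤ 2`. -/
theorem comul_lower (i : Fin 5) (j : Fin 2) :
    comul (∑ k, g i (![0, 1] k) * Ring.inverse x k j) =
      st (∑ k, g i (![0, 1] k) * Ring.inverse x k j) 1 +
      ∑ a : Fin 2, ∑ b : Fin 2, st (g i (![2, 3] a) * Ring.inverse x b j) (t a b) +
      ∑ b : Fin 2, st (g i 4 * Ring.inverse x b j) (τtilde b) := by
  have hx (k j : Fin 2) : comul (Ring.inverse x k j) =
      ∑ m, inr Pq Pq (Ring.inverse x k m) * inl Pq Pq (Ring.inverse x m j) := by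
    have := congrFun (congrFun comul_map_inverse_x k) j
    rwa [Matrix.mul_apply] at this
  have hg (k : Fin 2) : comul (g i (![0, 1] k)) =
      ∑ l, inl Pq Pq (g i (![0, 1] l)) * inr Pq Pq (x l k) +
      ∑ a, inl Pq Pq (g i (![2, 3] a)) * inr Pq Pq (g (![2, 3] a) (![0, 1] k)) +
      inl Pq Pq (g i 4) * inr Pq Pq (g 4 (![0, 1] k)) := by
    rw [comul_g, Fin.sum_univ_five, Fin.sum_univ_two, Fin.sum_univ_two]
    simp only [inl_mul_inr, ← add_assoc]
    rfl
  have ht (a b : Fin 2) : ∑ k, g (![2, 3] a) (![0, 1] k) * Ring.inverse x k b = t a b := by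
    rw [t, Matrix.mul_apply]; rfl
  have hτ (b : Fin 2) : ∑ k, g 4 (![0, 1] k) * Ring.inverse x k b = τtilde b := rfl
  have hxx (l m : Fin 2) : ∑ k, x l k * Ring.inverse x k m = if l = m then 1 else 0 := by
    rw [← Matrix.mul_apply, x_mul_inverse, Matrix.one_apply]
  -- The sum over k is absorbed into c x⁻¹ in the second tensor factor. The remaining x⁻¹ moves into
  -- the first factor without sign, being even.
  have key (c : Fin 2 → Pq) (u : Pq) (j : Fin 2) :
      ∑ k, inl Pq Pq u * inr Pq Pq (c k) * comul (Ring.inverse x k j) =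
        ∑ m, st (u * Ring.inverse x m j) (∑ k, c k * Ring.inverse x k m) := by
    simp only [hx, Finset.mul_sum]
    rw [Finset.sum_comm]
    refine Finset.sum_congr rfl fun m _ => ?_
    rw [← st_mul_inl_inverse, map_sum, Finset.mul_sum, Finset.sum_mul]
    refine Finset.sum_congr rfl fun k _ => ?_
    simp only [map_mul, mul_assoc]
  have e1 : ∑ k, ∑ l, inl Pq Pq (g i (![0, 1] l)) * inr Pq Pq (x l k) *
      comul (Ring.inverse x k j) = st (∑ k, g i (![0, 1] k) * Ring.inverse x k j) 1 := by
    rw [Finset.sum_comm, st_sum_left]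
    simp only [key, hxx]
    refine Finset.sum_congr rfl fun l _ => ?_
    rw [Finset.sum_eq_single l]
    · rw [if_pos rfl]
    · intro m _ hm
      rw [if_neg (Ne.symm hm)]
      exact TensorProduct.tmul_zero _ _
    · simp
  have e2 : ∑ k, ∑ a, inl Pq Pq (g i (![2, 3] a)) * inr Pq Pq (g (![2, 3] a) (![0, 1] k)) *
      comul (Ring.inverse x k j) =
      ∑ a : Fin 2, ∑ b : Fin 2, st (g i (![2, 3] a) * Ring.inverse x b j) (t a b) := by
    rw [Finset.sum_comm]
    simp only [key, ht]
  rw [map_sum]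
  simp only [map_mul, hg, add_mul, Finset.sum_add_distrib, Finset.sum_mul]
  rw [e1, e2, key]
  simp only [hτ]

theorem comul_t (i j : Fin 2) : comul (t i j) = st (t i j) 1 +
    ∑ a : Fin 2, ∑ b : Fin 2, st (y i a * Ring.inverse x b j) (t a b) +
    ∑ b : Fin 2, st (colB i * Ring.inverse x b j) (τtilde b) := by
  have ht : t i j = ∑ k, g (![2, 3] i) (![0, 1] k) * Ring.inverse x k j := by
    rw [t, Matrix.mul_apply]; rfl
  rw [ht]
  exact comul_lower _ j

theorem comul_τtilde (j : Fin 2) : comul (τtilde j) = st (τtilde j) 1 +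
    ∑ a : Fin 2, ∑ b : Fin 2, st (rowC a * Ring.inverse x b j) (t a b) +
    ∑ b : Fin 2, st (d * Ring.inverse x b j) (τtilde b) :=
  comul_lower 4 j

/-! ### The retraction onto the big cell -/

/-- The generating matrix with its lower left block removed. -/
def gDiag : Matrix (Fin 5) (Fin 5) Pq := Matrix.of fun i j => if 2 ≤ i ∧ j < 2 then 0 else g i j

theorem gDiag_of_not {i j : Fin 5} (h : ¬(2 ≤ i ∧ j < 2)) : gDiag i j = g i j := if_neg h

theorem gDiag_of {i j : Fin 5} (h : 2 ≤ i ∧ j < 2) : gDiag i j = 0 := if_pos h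

theorem isManin_gDiag : IsManin p gDiag where
  sq i j hij := by
    by_cases h : 2 ≤ i ∧ j < 2
    · rw [gDiag_of h, mul_zero]
    · rw [gDiag_of_not h, isManin_g.sq i j hij]
  row i j l hjl := by
    by_cases h : 2 ≤ i ∧ j < 2
    · rw [gDiag_of h, mul_zero, zero_mul, smul_zero]
    by_cases h' : 2 ≤ i ∧ l < 2
    · rw [gDiag_of h', mul_zero, zero_mul, smul_zero]
    rw [gDiag_of_not h, gDiag_of_not h', isManin_g.row i j l hjl]
  col i j k hik := by
    by_cases h : 2 ≤ i ∧ j < 2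
    · rw [gDiag_of h, mul_zero, zero_mul, smul_zero]
    by_cases h' : 2 ≤ k ∧ j < 2
    · rw [gDiag_of h', mul_zero, zero_mul, smul_zero]
    rw [gDiag_of_not h, gDiag_of_not h', isManin_g.col i j k hik]
  anti i j k l hik hlj := by
    by_cases h : 2 ≤ i ∧ j < 2
    · rw [gDiag_of h, mul_zero, zero_mul, smul_zero]
    by_cases h' : 2 ≤ k ∧ l < 2
    · rw [gDiag_of h', mul_zero, zero_mul, smul_zero]
    rw [gDiag_of_not h, gDiag_of_not h', isManin_g.anti i j k l hik hlj]
  diag i j k l hik hjl := by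
    by_cases h : 2 ≤ k ∧ j < 2
    · rw [gDiag_of h, zero_mul, smul_zero]
      by_cases hi : 2 ≤ i
      · rw [gDiag_of ⟨hi, h.2⟩, zero_mul, mul_zero, smul_zero, sub_zero]
      by_cases hl : l < 2
      · rw [gDiag_of ⟨h.1, hl⟩, zero_mul, mul_zero, smul_zero, sub_zero]
      -- Here i < 2 ≤ k and j < 2 ≤ l: the left side keeps its block diagonal products, and the
      -- right side vanishes already for g because g i l = 0.
      rw [gDiag_of_not fun h => hi h.1, gDiag_of_not fun h => hl h.2,
        isManin_g.diag i j k l hik hjl, g_zero i l (not_le.1 hi) (not_lt.1 hl), mul_zero, smul_zero]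
    · rw [gDiag_of_not h, gDiag_of_not fun h' => h ⟨h'.1.trans hik.le, h'.2⟩,
        gDiag_of_not fun h' => h ⟨h'.1, hjl.trans h'.2⟩,
        gDiag_of_not fun h' => h ⟨h'.1.trans hik.le, hjl.trans h'.2⟩,
        isManin_g.diag i j k l hik hjl]

theorem isPoint_gDiag : IsPoint gDiag dinv := by
  have k1 (i : Fin 2) : ¬ 2 ≤ (![0, 1] i : Fin 5) := by revert i; decide
  have hx : gDiag.submatrix ![0, 1] ![0, 1] = g.submatrix ![0, 1] ![0, 1] := by
    ext i j
    exact gDiag_of_not fun h => k1 i h.1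
  have hh {i j : Fin 5} (hj : ¬ j < 2) : gDiag i j = g i j := gDiag_of_not fun h => hj h.2
  have k2 (j : Fin 2) : ¬ (![2, 3] j : Fin 5) < 2 := by revert j; decide
  have k4 : ¬ (4 : Fin 5) < 2 := by decide
  have hy : gDiag.submatrix ![2, 3] ![2, 3] = g.submatrix ![2, 3] ![2, 3] := by
    ext i j
    exact hh (k2 j)
  have hs : schur gDiag dinv = schur g dinv := by
    ext i j
    simp only [schur, Matrix.of_apply, hh (k2 j), hh k4]
  refine ⟨isManin_gDiag, ?_, ?_, ?_, ?_, ?_, ?_⟩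
  · intro i j hi hj
    rw [hh (not_lt.2 hj), g_zero i j hi hj]
  · rw [hh k4, isPoint_g.mul_inv]
  · rw [hh k4, isPoint_g.inv_mul]
  · rw [hx]; exact isPoint_g.isUnit_x
  · rw [hy]; exact isPoint_g.isUnit_y
  · rw [hx, hs]; exact isPoint_g.ber

/-- The projection to the block diagonal part. -/
def proj : Pq →ₐ[Cq] Pq := isPoint_gDiag.exists_lift.choose

theorem proj_g (i j : Fin 5) : proj (g i j) = if 2 ≤ i ∧ j < 2 then 0 else g i j :=
  isPoint_gDiag.exists_lift.choose_spec i j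

theorem isSuperHom_proj : IsSuperHom proj := by
  have : proj.comp (parity : Pq →ₐ[Cq] Pq) = (parity : Pq →ₐ[Cq] Pq).comp proj := by
    refine Pq.algHom_ext fun i j => ?_
    rw [AlgHom.comp_apply, AlgHom.comp_apply, parity_g, map_smul, proj_g]
    split_ifs
    · simp
    · rw [parity_g]
  exact DFunLike.congr_fun this

theorem proj_t (i j : Fin 2) : proj (t i j) = 0 := by
  rw [t, Matrix.mul_apply, map_sum]
  refine Finset.sum_eq_zero fun k _ => ?_
  rw [map_mul, Matrix.submatrix_apply, proj_g, if_pos, zero_mul]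
  exact ⟨by revert i; decide, by revert k; decide⟩

theorem proj_τtilde (j : Fin 2) : proj (τtilde j) = 0 := by
  rw [τtilde, Matrix.vecMul, dotProduct, map_sum]
  refine Finset.sum_eq_zero fun k _ => ?_
  rw [map_mul, proj_g, if_pos, zero_mul]
  exact ⟨by decide, by revert k; decide⟩

/-- The comultiplication followed by the projection of the second factor. -/
def comulProj : Pq →ₐ[Cq] STensor Pq Pq :=
  (smap (AlgHom.id Cq Pq) proj isSuperHom_id isSuperHom_proj).comp comul

theorem st_zero_right {A B : Type*} [Ring A] [Algebra Cq A] [SuperAlgebra A] [Ring B] [Algebra Cq B]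
    [SuperAlgebra B] (a : A) : st a (0 : B) = 0 := TensorProduct.tmul_zero _ _

theorem st_zero_left {A B : Type*} [Ring A] [Algebra Cq A] [SuperAlgebra A] [Ring B] [Algebra Cq B]
    [SuperAlgebra B] (b : B) : st (0 : A) b = 0 := TensorProduct.zero_tmul _ _

/-- In Δ(t) and Δ(τ̃) every term but the first has t or τ̃ on the right and is killed by `proj`. The
big cell thus consists of coinvariants for the block diagonal quotient. -/
theorem comulProj_of_mem_U {u : Pq} (hu : u ∈ U) : comulProj u = st u 1 := by
  have : U ≤ AlgHom.equalizer comulProj (inl Pq Pq) := by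
    refine Algebra.adjoin_le ?_
    rintro _ (⟨⟨i, j⟩, rfl⟩ | ⟨j, rfl⟩)
    · change smap (AlgHom.id Cq Pq) proj isSuperHom_id isSuperHom_proj (comul (t i j)) = st (t i j) 1
      simp [comul_t, smap_st, proj_t, proj_τtilde, st_zero_right]
    · change smap (AlgHom.id Cq Pq) proj isSuperHom_id isSuperHom_proj (comul (τtilde j)) = st (τtilde j) 1
      simp [comul_τtilde, smap_st, proj_t, proj_τtilde, st_zero_right]
  exact this hu

/-- The generators of the block diagonal part. -/
def diagGen : Set Pq :=
  {a | (∃ i j, ((i < 2 ∧ j < 2) ∨ (2 ≤ i ∧ 2 ≤ j)) ∧ a = g i j) ∨ a = D1inv ∨ a = dinv}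

/-- The block diagonal part. -/
def H : Subalgebra Cq Pq := Algebra.adjoin Cq diagGen

theorem g_mem_H {i j : Fin 5} (h : (i < 2 ∧ j < 2) ∨ (2 ≤ i ∧ 2 ≤ j)) : g i j ∈ H :=
  Algebra.subset_adjoin (Or.inl ⟨i, j, h, rfl⟩)

theorem D1inv_mem_H : D1inv ∈ H := Algebra.subset_adjoin (Or.inr (Or.inl rfl))

theorem dinv_mem_H : dinv ∈ H := Algebra.subset_adjoin (Or.inr (Or.inr rfl))

theorem qdet_mem {X : Type*} [Ring X] [Algebra Cq X] {S : Subalgebra Cq X}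
    {M : Matrix (Fin 2) (Fin 2) X} (h : ∀ i j, M i j ∈ S) : qdet M ∈ S := by
  rw [qdet_fin_two]
  exact S.sub_mem (S.mul_mem (h _ _) (h _ _)) (S.smul_mem (S.mul_mem (h _ _) (h _ _)) _)

/-- For block diagonal (i, j) the projection leaves ∑ g_ik ⊗ g_kj unchanged: whenever it kills g_kj,
the factor g_ik is already zero. The antipode computation then applies verbatim, and inverses are
covered by `rightScalar_inv`. -/
theorem H_le_rightScalar :
    H ≤ rightScalar comulProj counit (conv LinearMap.id antipode) := by
  have hg {i j : Fin 5} (h : (i < 2 ∧ j < 2) ∨ (2 ≤ i ∧ 2 ≤ j)) :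
      g i j ∈ rightScalar comulProj counit (conv LinearMap.id antipode) := by
    intro Y
    have : comulProj (g i j) = ∑ k, st (g i k) (g k j) := by
      rw [comulProj, AlgHom.comp_apply, comul_g, map_sum]
      refine Finset.sum_congr rfl fun k _ => ?_
      rw [smap_st, proj_g, AlgHom.id_apply]
      split_ifs with hk
      · rcases h with h | h
        · rw [g_zero i k h.1 hk.1, st_zero_left, st_zero_left]
        · exact absurd hk.2 (not_lt.2 h.2)
      · rfl
    rw [this, conv_id_antipode_mul]
  refine Algebra.adjoin_le ?_
  rintro _ (⟨i, j, h, rfl⟩ | rfl | rfl)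
  · exact hg h
  · refine rightScalar_inv D1inv_mul_ofFree_fD1 ?_
    rw [ofFree_fD1]
    refine Subalgebra.mul_mem _ (qdet_mem fun i j => hg (Or.inl ?_))
      (qdet_mem fun i j => hg (Or.inr ?_))
    · exact ⟨by revert i; decide, by revert j; decide⟩
    · exact ⟨by revert i; decide, by revert j; decide⟩
  · exact rightScalar_inv isPoint_g.inv_mul (hg (Or.inr ⟨by decide, by decide⟩))

/-- The retraction onto the big cell. -/
def retr : Pq →ₗ[Cq] Pq := conv LinearMap.id antipode ∘ₗ comulProj.toLinearMap

/-- This formula determines `retr` once the whole algebra is known to be U·H; in particular `retr`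
then takes values in U and is the identity there. -/
theorem retr_mul {u h : Pq} (hu : u ∈ U) (hh : h ∈ H) : retr (u * h) = counit h • u := by
  change conv LinearMap.id antipode (comulProj (u * h)) = _
  rw [map_mul, H_le_rightScalar hh, comulProj_of_mem_U hu, conv_st, antipode_one, mul_one]
  rfl

/-- The span of the entries of the lower left block. -/
def lowerSpan : Submodule Cq Pq := Submodule.span Cq {a | ∃ k l, (2 ≤ k ∧ l < 2) ∧ a = g k l}

theorem g_mem_lowerSpan {k l : Fin 5} (hk : 2 ≤ k) (hl : l < 2) : g k l ∈ lowerSpan :=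
  Submodule.subset_span ⟨k, l, ⟨hk, hl⟩, rfl⟩

/-- The products of an entry of the lower left block and of a block diagonal element. -/
def lowerH : Submodule Cq Pq := lowerSpan * Subalgebra.toSubmodule H

theorem mul_mem_lowerH {n h : Pq} (hn : n ∈ lowerH) (hh : h ∈ H) : n * h ∈ lowerH := by
  have : lowerH * Subalgebra.toSubmodule H = lowerH := by
    rw [lowerH, mul_assoc, (Subalgebra.isIdempotentElem_toSubmodule H).eq]
  rw [← this]
  exact Submodule.mul_mem_mul hn hh

theorem g_mul_mem_lowerH {k l : Fin 5} {h : Pq} (hk : 2 ≤ k) (hl : l < 2) (hh : h ∈ H) :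
    g k l * h ∈ lowerH := Submodule.mul_mem_mul (g_mem_lowerSpan hk hl) hh

/-- Straightening: each Manin relation moves the lower left entry to the left, and the extra term of
the diagonal relation again has one lower left entry followed by a block diagonal one. -/
theorem g_mul_g_mem_lowerH {i j k l : Fin 5} (hij : (i < 2 ∧ j < 2) ∨ (2 ≤ i ∧ 2 ≤ j))
    (hk : 2 ≤ k) (hl : l < 2) : g i j * g k l ∈ lowerH := by
  have hm := g_mul_mem_lowerH hk hl (g_mem_H hij)
  rcases hij with ⟨hi, hj⟩ | ⟨hi, hj⟩
  · have hik := hi.trans_le hk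
    rcases lt_trichotomy j l with h | rfl | h
    · rw [sub_eq_iff_eq_add.1 (isManin_g.diag i j k l hik h)]
      exact lowerH.add_mem (lowerH.smul_mem _
        (g_mul_mem_lowerH hk hj (g_mem_H (Or.inl ⟨hi, hl⟩)))) (lowerH.smul_mem _ hm)
    · rw [isManin_g.col i j k hik]
      exact lowerH.smul_mem _ hm
    · rw [isManin_g.anti i j k l hik h]
      exact lowerH.smul_mem _ hm
  · have hlj := hl.trans_le hj
    rcases lt_trichotomy i k with h | rfl | h
    · rw [isManin_g.anti i j k l h hlj]
      exact lowerH.smul_mem _ hm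
    · have h := isManin_g.row i l j hlj
      rw [h] at hm
      have hs := lowerH.smul_mem ((-1) ^ ((p i + p l) % 2 * ((p i + p j) % 2)) *
        qpow (-(-1) ^ (p i + 1))) hm
      rw [smul_smul, mul_mul_mul_comm, neg_one_pow_mul_self, one_mul, qpow, qpow,
        ← LaurentPolynomial.T_add, neg_add_cancel, LaurentPolynomial.T_zero, one_smul] at hs
      exact hs
    · have h := isManin_g.diag k l i j h hlj
      have e : g i j * g k l = (-1 : Cq) ^ ((p k + p l) % 2 * ((p i + p j) % 2)) •
          (g k l * g i j - ((-1) ^ ((p k + p l) % 2 * ((p i + p l) % 2)) *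
            (qpow (-1) - qpow 1)) • (g i l * g k j)) := by
        rw [← h, sub_sub_cancel, smul_smul, neg_one_pow_mul_self, one_smul]
      rw [e]
      exact lowerH.smul_mem _ (lowerH.sub_mem hm (lowerH.smul_mem _
        (g_mul_mem_lowerH hi hl (g_mem_H (Or.inr ⟨hk, hj⟩)))))

theorem inv_mul_of_smul_comm {X : Type*} [Ring X] [Algebra Cq X] {a b c : X} {r : Cq}
    (hab : a * b = 1) (hba : b * a = 1) (h : c * a = r • (a * c)) : b * c = r • (c * b) := by
  calc b * c = b * (c * a) * b := by rw [mul_assoc, mul_assoc, hab, mul_one]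
    _ = _ := by rw [h, mul_smul_comm, ← mul_assoc, hba, one_mul, smul_mul_assoc]

/-- In the last row g_4l commutes with d up to a scalar. For the other rows the diagonal relation
between g_kl and d is multiplied by d⁻¹ on both sides, which reduces to the last row. -/
theorem dinv_mul_g_mem_lowerH {k l : Fin 5} (hk : 2 ≤ k) (hl : l < 2) :
    dinv * g k l ∈ lowerH := by
  have hl4 : l < 4 := hl.trans_le (by decide)
  have h4 : dinv * g 4 l ∈ lowerH := by
    rw [inv_mul_of_smul_comm isPoint_g.mul_inv isPoint_g.inv_mul (isManin_g.row 4 l 4 hl4)]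
    exact lowerH.smul_mem _ (g_mul_mem_lowerH (by decide) hl dinv_mem_H)
  rcases (show k ≤ 4 from Fin.le_last k).eq_or_lt with rfl | hk4
  · exact h4
  · have h := congrArg (fun a => dinv * a * dinv) (isManin_g.diag k l 4 4 hk4 hl4)
    simp only [mul_sub, sub_mul, mul_smul_comm, smul_mul_assoc] at h
    rw [mul_assoc dinv (g k l * g 4 4), mul_assoc (g k l), isPoint_g.mul_inv, mul_one,
      ← mul_assoc dinv (g 4 4), isPoint_g.inv_mul, one_mul, ← mul_assoc dinv (g 4 l), mul_assoc _ _ dinv,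
      sub_eq_iff_eq_add] at h
    rw [h]
    exact lowerH.add_mem (lowerH.smul_mem _ (mul_mem_lowerH h4
      (H.mul_mem (g_mem_H (Or.inr ⟨hk, by decide⟩)) dinv_mem_H)))
      (lowerH.smul_mem _ (g_mul_mem_lowerH hk hl dinv_mem_H))

/-! ### The factorization through the big cell -/

theorem qRow_x {k : Fin 5} (hk : 2 ≤ k) : QRow x fun l => g k (![0, 1] l) := by
  have hi (i : Fin 2) : (![0, 1] i : Fin 5) < k :=
    lt_of_lt_of_le (by revert i; decide) hk
  have hp (i : Fin 2) : p (![0, 1] i) = 0 := by revert i; decide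
  have h01 : (![0, 1] (0 : Fin 2) : Fin 5) < ![0, 1] (1 : Fin 2) := by decide
  refine ⟨fun i j => ?_, fun i => ?_, fun i => ?_⟩
  · have := isManin_g.col (![0, 1] i) (![0, 1] j) k (hi i)
    simp only [hp, zero_add, Nat.zero_mod, zero_mul, pow_zero, one_mul, pow_one] at this
    exact this
  · have := isManin_g.anti (![0, 1] i) (![0, 1] 1) k (![0, 1] 0) (hi i) h01
    simp only [hp, zero_add, Nat.zero_mod, zero_mul, pow_zero, one_smul] at this
    exact this
  · have := isManin_g.diag (![0, 1] i) (![0, 1] 0) k (![0, 1] 1) (hi i) h01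
    simp only [hp, zero_add, Nat.zero_mod, zero_mul, pow_zero, one_mul, one_smul] at this
    exact sub_eq_iff_eq_add'.1 this

/-- An even column on the left of a quantum matrix quasi-commutes with the determinant. -/
theorem QMat.left_col_mul_qdet {X : Type*} [Ring X] [Algebra Cq X] {Y : Matrix (Fin 2) (Fin 2) X}
    {c : Fin 2 → X} (hY : QMat Y) (hrow : ∀ i j, c i * Y i j = qpow (-1) • (Y i j * c i))
    (hanti : ∀ j, c 1 * Y 0 j = Y 0 j * c 1)
    (hdiag : ∀ j, c 0 * Y 1 j = Y 1 j * c 0 + (qpow (-1) - qpow 1) • (c 1 * Y 0 j)) (i : Fin 2) :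
    c i * qdet Y = qpow (-1) • (qdet Y * c i) := by
  have hq := qpow_mul_qpow_neg
  fin_cases i <;>
    simp [qdet_fin_two, mul_assoc, hrow, hanti, hdiag, reassoc (hrow _ _), reassoc (hanti _),
      reassoc (hdiag _), mul_sub, sub_mul, add_mul, mul_add, smul_smul, hY.row, reassoc (hY.row _)] <;>
    match_scalars <;> grind

theorem qMat_x : QMat x := isManin_g.qMat (by decide) (by decide) (by decide)

theorem qMat_y : QMat y := isManin_g.qMat (by decide) (by decide) (by decide)

theorem g_mul_qdet_x {k l : Fin 5} (hk : 2 ≤ k) (hl : l < 2) :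
    g k l * qdet x = qpow 1 • (qdet x * g k l) := by
  have h := (qRow_x hk).mul_qdet qMat_x
  fin_cases l
  · exact h 0
  · exact h 1
  all_goals exact absurd hl (by decide)

/-- The scalar is q⁻¹ in the rows of y and 1 in the last row. Only its existence matters: together
with `g_mul_qdet_x`, it lets D₁⁻¹ move past g k l. -/
theorem exists_g_mul_qdet_y {k l : Fin 5} (hk : 2 ≤ k) (hl : l < 2) :
    ∃ r : Cq, g k l * qdet y = r • (qdet y * g k l) := by
  have hp (i : Fin 2) : p (![2, 3] i) = 0 := by revert i; decide
  have hpl : p l = 0 := if_neg (hl.trans (by decide)).ne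
  have h01 : (![2, 3] (0 : Fin 2) : Fin 5) < ![2, 3] (1 : Fin 2) := by decide
  have hlj (j : Fin 2) : l < ![2, 3] j := hl.trans_le (by revert j; decide)
  have h := qMat_y.left_col_mul_qdet (c := fun i => g (![2, 3] i) l)
    (fun i j => by
      have := isManin_g.row (![2, 3] i) l (![2, 3] j) (hlj j)
      simp only [hp, zero_add, Nat.zero_mod, hpl, zero_mul, pow_zero, one_mul, pow_one] at this
      exact this)
    (fun j => by
      have := isManin_g.anti (![2, 3] 0) (![2, 3] j) (![2, 3] 1) l h01 (hlj j)
      simp only [hp, zero_add, Nat.zero_mod, hpl, zero_mul, pow_zero, one_smul] at this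
      exact this.symm)
    (fun j => by
      have := isManin_g.diag (![2, 3] 0) l (![2, 3] 1) (![2, 3] j) h01 (hlj j)
      simp only [hp, zero_add, Nat.zero_mod, hpl, zero_mul, pow_zero, one_mul, one_smul] at this
      exact sub_eq_iff_eq_add'.1 this)
  have h4 : Commute (qdet y) (g 4 l) := commute_qdet fun i j => by
    have := isManin_g.anti (![2, 3] i) (![2, 3] j) 4 l (by revert i; decide) (hlj j)
    simp only [hp, zero_add, Nat.zero_mod, hpl, zero_mul, pow_zero, one_smul] at this
    exact this
  fin_cases k
  · exact absurd hk (by decide)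
  · exact absurd hk (by decide)
  · exact ⟨_, h 0⟩
  · exact ⟨_, h 1⟩
  · exact ⟨1, by rw [one_smul]; exact h4.eq.symm⟩

theorem D1inv_mul_g_mem_lowerH {k l : Fin 5} (hk : 2 ≤ k) (hl : l < 2) :
    D1inv * g k l ∈ lowerH := by
  obtain ⟨r, hr⟩ := exists_g_mul_qdet_y hk hl
  have h : g k l * Pq.ofFree fD1 = (qpow 1 * r) • (Pq.ofFree fD1 * g k l) := by
    rw [ofFree_fD1, ← mul_assoc, g_mul_qdet_x hk hl, smul_mul_assoc, mul_assoc, hr, mul_smul_comm,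
      smul_smul, mul_assoc]
  rw [inv_mul_of_smul_comm ofFree_fD1_mul_D1inv D1inv_mul_ofFree_fD1 h]
  exact lowerH.smul_mem _ (g_mul_mem_lowerH hk hl D1inv_mem_H)

theorem mul_mem_lowerH_of_forall {a n : Pq}
    (ha : ∀ {k l : Fin 5}, 2 ≤ k → l < 2 → a * g k l ∈ lowerH) (hn : n ∈ lowerH) :
    a * n ∈ lowerH := by
  rw [lowerH] at hn
  refine Submodule.mul_induction_on hn (fun c hc h hh => ?_) fun b c hb hc => ?_
  · rw [← mul_assoc]
    refine mul_mem_lowerH ?_ hh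
    induction hc using Submodule.span_induction with
    | mem c hc =>
      obtain ⟨k, l, ⟨hk, hl⟩, rfl⟩ := hc
      exact ha hk hl
    | zero => rw [mul_zero]; exact lowerH.zero_mem
    | add b c _ _ hb hc => rw [mul_add]; exact lowerH.add_mem hb hc
    | smul r c _ hc => rw [mul_smul_comm]; exact lowerH.smul_mem r hc
  · rw [mul_add]
    exact lowerH.add_mem hb hc

theorem H_mul_mem_lowerH {a n : Pq} (ha : a ∈ H) (hn : n ∈ lowerH) : a * n ∈ lowerH := by
  rw [H] at ha
  induction ha using Algebra.adjoin_induction generalizing n with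
  | mem a ha =>
    refine mul_mem_lowerH_of_forall (fun hk hl => ?_) hn
    rcases ha with ⟨i, j, h, rfl⟩ | rfl | rfl
    · exact g_mul_g_mem_lowerH h hk hl
    · exact D1inv_mul_g_mem_lowerH hk hl
    · exact dinv_mul_g_mem_lowerH hk hl
  | algebraMap r =>
    rw [Algebra.algebraMap_eq_smul_one, smul_mul_assoc, one_mul]
    exact lowerH.smul_mem r hn
  | add a b _ _ ha hb => rw [add_mul]; exact lowerH.add_mem (ha hn) (hb hn)
  | mul a b _ _ ha hb => rw [mul_assoc]; exact ha (hb hn)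

/-- The products of an element of the big cell and of a block diagonal element. -/
def UH : Submodule Cq Pq := Subalgebra.toSubmodule U * Subalgebra.toSubmodule H

theorem mul_mem_UH {u h : Pq} (hu : u ∈ U) (hh : h ∈ H) : u * h ∈ UH :=
  Submodule.mul_mem_mul hu hh

theorem UH_mul_mem {n h : Pq} (hn : n ∈ UH) (hh : h ∈ H) : n * h ∈ UH := by
  have : UH * Subalgebra.toSubmodule H = UH := by
    rw [UH, mul_assoc, (Subalgebra.isIdempotentElem_toSubmodule H).eq]
  rw [← this]
  exact Submodule.mul_mem_mul hn hh

theorem U_mul_mem_UH {u n : Pq} (hu : u ∈ U) (hn : n ∈ UH) : u * n ∈ UH := by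
  have : Subalgebra.toSubmodule U * UH = UH := by
    rw [UH, ← mul_assoc, (Subalgebra.isIdempotentElem_toSubmodule U).eq]
  rw [← this]
  exact Submodule.mul_mem_mul hu hn

theorem x_mem_H (i j : Fin 2) : x i j ∈ H :=
  g_mem_H (Or.inl ⟨by revert i; decide, by revert j; decide⟩)

theorem t_mul_x : t * x = g.submatrix ![2, 3] ![0, 1] := by
  rw [t, mul_assoc, inverse_mul_x, mul_one]

theorem τtilde_vecMul_x : Matrix.vecMul τtilde x = fun j => g 4 (![0, 1] j) := by
  rw [τtilde, Matrix.vecMul_vecMul, inverse_mul_x, Matrix.vecMul_one]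

theorem g_mem_UH {k l : Fin 5} (hk : 2 ≤ k) (hl : l < 2) : g k l ∈ UH := by
  have h1 (i j : Fin 2) : g (![2, 3] i) (![0, 1] j) ∈ UH := by
    have := congrFun (congrFun t_mul_x i) j
    rw [Matrix.submatrix_apply] at this
    rw [← this, Matrix.mul_apply]
    exact Submodule.sum_mem _ fun b _ => mul_mem_UH (t_mem i b) (x_mem_H b j)
  have h2 (j : Fin 2) : g 4 (![0, 1] j) ∈ UH := by
    rw [← congrFun τtilde_vecMul_x j, Matrix.vecMul, dotProduct]
    exact Submodule.sum_mem _ fun b _ => mul_mem_UH (τtilde_mem b) (x_mem_H b j)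
  fin_cases l
  · fin_cases k
    · exact absurd hk (by decide)
    · exact absurd hk (by decide)
    · exact h1 0 0
    · exact h1 1 0
    · exact h2 0
  · fin_cases k
    · exact absurd hk (by decide)
    · exact absurd hk (by decide)
    · exact h1 0 1
    · exact h1 1 1
    · exact h2 1
  all_goals exact absurd hl (by decide)

theorem lowerH_le_UH : lowerH ≤ UH := by
  refine Submodule.mul_le.2 fun c hc h hh => UH_mul_mem ?_ hh
  refine (Submodule.span_le (p := UH)).2 ?_ hc
  rintro _ ⟨k, l, ⟨hk, hl⟩, rfl⟩
  exact g_mem_UH hk hl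

theorem UH_mul_mem_of_forall {a n : Pq} (ha : ∀ h ∈ H, h * a ∈ UH) (hn : n ∈ UH) :
    n * a ∈ UH := by
  refine Submodule.mul_induction_on (C := fun n => n * a ∈ UH) hn (fun u hu h hh => ?_)
    fun b c hb hc => ?_
  · rw [mul_assoc]
    exact U_mul_mem_UH hu (ha h hh)
  · rw [add_mul]
    exact UH.add_mem hb hc

/-- The right stabilizer of `UH`. -/
def rightStabilizer : Subalgebra Cq Pq where
  carrier := {a | ∀ n ∈ UH, n * a ∈ UH}
  mul_mem' ha hb n hn := by
    rw [← mul_assoc]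
    exact hb _ (ha n hn)
  add_mem' ha hb n hn := by
    rw [mul_add]
    exact UH.add_mem (ha n hn) (hb n hn)
  algebraMap_mem' r n hn := by
    rw [Algebra.algebraMap_eq_smul_one, mul_smul_comm, mul_one]
    exact UH.smul_mem r hn

/-- All generators are zero or in H, except the lower left entries; for those H g_ij ⊆ lowerH ⊆ UH.
So UH is a right ideal, and containing 1 it is everything. -/
theorem rightStabilizer_eq_top : rightStabilizer = ⊤ := by
  have hH {h : Pq} (hh : h ∈ H) : h ∈ rightStabilizer := fun n hn => UH_mul_mem hn hh
  refine Pq.eq_top_of_gen_mem (fun i j => ?_) (hH D1inv_mem_H) (hH dinv_mem_H)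
  rcases lt_or_ge i 2 with hi | hi <;> rcases lt_or_ge j 2 with hj | hj
  · exact hH (g_mem_H (Or.inl ⟨hi, hj⟩))
  · rw [g_zero i j hi hj]
    exact rightStabilizer.zero_mem
  · exact fun n hn => UH_mul_mem_of_forall (fun h hh => lowerH_le_UH
      (H_mul_mem_lowerH hh (mul_one (g i j) ▸ g_mul_mem_lowerH hi hj H.one_mem))) hn
  · exact hH (g_mem_H (Or.inr ⟨hi, hj⟩))

theorem mem_UH (a : Pq) : a ∈ UH := by
  have h1 : (1 : Pq) ∈ UH := by
    rw [← one_mul (1 : Pq)]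
    exact mul_mem_UH U.one_mem H.one_mem
  have h : a ∈ rightStabilizer := rightStabilizer_eq_top ▸ Algebra.mem_top
  rw [← one_mul a]
  exact h 1 h1

theorem retr_mem (a : Pq) : retr a ∈ U := by
  refine Submodule.mul_induction_on (C := fun a => retr a ∈ U) (mem_UH a) (fun u hu h hh => ?_)
    fun b c hb hc => ?_
  · rw [retr_mul hu hh]
    exact U.smul_mem hu _
  · rw [map_add]
    exact U.add_mem hb hc

/-- The retraction of `O(P_{l,q})` onto the big cell. -/
def retrU : Pq →ₗ[Cq] U := retr.codRestrict (Subalgebra.toSubmodule U) retr_mem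

theorem retrU_coe (u : U) : retrU u = u := by
  refine Subtype.ext ?_
  change retr (u : Pq) = u
  rw [← mul_one (u : Pq), retr_mul u.2 H.one_mem, map_one, one_smul, mul_one]

/-! ### The coaction -/

theorem isSuperHom_val : IsSuperHom U.val := fun _ => rfl

/-- The inclusion of `O(P_{l,q}) ⊗ U` into `O(P_{l,q}) ⊗ O(P_{l,q})`. -/
def inclU : STensor Pq U →ₐ[Cq] STensor Pq Pq :=
  smap (AlgHom.id Cq Pq) U.val isSuperHom_id isSuperHom_val

theorem inclU_st (a : Pq) (u : U) : inclU (st a u) = st a (u : Pq) := smap_st _ _ _ _ _ _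

theorem retrU_comp_val : retrU ∘ₗ U.val.toLinearMap = LinearMap.id := LinearMap.ext retrU_coe

/-- Over `Cq`, which is not a field, injectivity need not survive tensoring with an arbitrary M; it
does here because the inclusion of U is split by `retrU`. -/
theorem map_val_injective {M : Type*} [AddCommGroup M] [Module Cq M] :
    Function.Injective (TensorProduct.map (LinearMap.id : M →ₗ[Cq] M) U.val.toLinearMap) :=
  Function.LeftInverse.injective (g := TensorProduct.map LinearMap.id retrU) fun z => by
    rw [← LinearMap.comp_apply, ← TensorProduct.map_comp, retrU_comp_val, LinearMap.id_comp,
      TensorProduct.map_id, LinearMap.id_apply]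

theorem map_map_val_injective {M N : Type*} [AddCommGroup M] [Module Cq M] [AddCommGroup N]
    [Module Cq N] : Function.Injective (TensorProduct.map (LinearMap.id : M →ₗ[Cq] M)
      (TensorProduct.map (LinearMap.id : N →ₗ[Cq] N) U.val.toLinearMap)) :=
  Function.LeftInverse.injective
    (g := TensorProduct.map LinearMap.id (TensorProduct.map LinearMap.id retrU)) fun z => by
      rw [← LinearMap.comp_apply, ← TensorProduct.map_comp, ← TensorProduct.map_comp,
        retrU_comp_val, LinearMap.id_comp, LinearMap.id_comp, TensorProduct.map_id,
        TensorProduct.map_id, LinearMap.id_apply]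

theorem inclU_injective : Function.Injective inclU := fun a b h => by
  rw [inclU, smap_toLinearMap, smap_toLinearMap] at h
  exact map_val_injective h

theorem sum_y_mul_η (i : Fin 2) : ∑ a, y i a * η a = colB i := by
  have : Matrix.mulVec y η = fun i => g (![2, 3] i) 4 := by
    rw [η, Matrix.mulVec_mulVec, Ring.mul_inverse_cancel y isUnit_y, Matrix.one_mulVec]
  exact congrFun this i

theorem d_mul_τ (j : Fin 2) : d * τ j = g 4 (![0, 1] j) := by
  rw [τ, ← mul_assoc, Ring.mul_inverse_cancel d isUnit_d, one_mul]

theorem d_mul_ξ (j : Fin 2) : d * ξ j = rowC j := by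
  rw [ξ, ← mul_assoc, Ring.mul_inverse_cancel d isUnit_d, one_mul, rowC]

/-- The explicit form of the coaction on `t`. -/
def coactT (i j : Fin 2) : STensor Pq U :=
  st (t i j) 1 + ∑ a, ∑ b, st (y i a * Ring.inverse x b j) (tU a b) +
    ∑ a, ∑ b, st (y i a * η a * Ring.inverse x b j) (τU b)

/-- The explicit form of the coaction on `τ̃`. -/
def coactτ (j : Fin 2) : STensor Pq U :=
  ∑ a, (st (d * τ a * Ring.inverse x a j) 1 +
    ∑ b, st (d * ξ b * Ring.inverse x a j) (tU b a) + st (d * Ring.inverse x a j) (τU a))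

theorem inclU_coactT (i j : Fin 2) : inclU (coactT i j) = comul (t i j) := by
  rw [comul_t, coactT]
  simp only [map_add, map_sum, inclU_st]
  congr 1
  rw [Finset.sum_comm]
  refine Finset.sum_congr rfl fun b _ => ?_
  rw [← st_sum_left, ← Finset.sum_mul, sum_y_mul_η]
  rfl

theorem inclU_coactτ (j : Fin 2) : inclU (coactτ j) = comul (τtilde j) := by
  rw [comul_τtilde, coactτ]
  simp only [map_add, map_sum, inclU_st, Finset.sum_add_distrib, d_mul_τ, d_mul_ξ]
  congr 1
  congr 1
  · rw [← st_sum_left]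
    rfl
  · exact Finset.sum_comm

theorem comul_mem_range_inclU (u : U) : comul (u : Pq) ∈ inclU.range := by
  have : U ≤ inclU.range.comap comul := by
    conv_lhs => rw [U]
    refine Algebra.adjoin_le ?_
    rintro _ (⟨⟨i, j⟩, rfl⟩ | ⟨j, rfl⟩)
    · exact ⟨_, inclU_coactT i j⟩
    · exact ⟨_, inclU_coactτ j⟩
  exact this u.2

/-- The coaction of `O(P_{l,q})` on the quantum big cell. -/
def coaction : U →ₐ[Cq] STensor Pq U :=
  ((AlgEquiv.ofInjective inclU inclU_injective).symm : inclU.range →ₐ[Cq] STensor Pq U).comp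
    ((comul.comp U.val).codRestrict inclU.range comul_mem_range_inclU)

theorem inclU_coaction (u : U) : inclU (coaction u) = comul (u : Pq) :=
  congrArg Subtype.val ((AlgEquiv.ofInjective inclU inclU_injective).apply_symm_apply
    ⟨comul (u : Pq), comul_mem_range_inclU u⟩)

theorem map_lin_coaction (u : U) :
    TensorProduct.map LinearMap.id U.val.toLinearMap (lin coaction u) = lin comul (u : Pq) := by
  have h := inclU_coaction u
  rw [inclU, smap_toLinearMap] at h
  exact h

theorem map_comp_lin_coaction : TensorProduct.map LinearMap.id U.val.toLinearMap ∘ₗ lin coaction =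
    lin comul ∘ₗ U.val.toLinearMap := LinearMap.ext map_lin_coaction

/-- For parity and coassociativity the axiom is pushed through an injective inclusion, where the
coaction becomes Δ and the Hopf axiom on elements of U applies. The counit axiom is compared
directly in O(P_{l,q}). -/
theorem isSuperCoaction : IsSuperCoaction comul counit coaction where
  even := by
    refine LinearMap.ext fun u => map_val_injective ?_
    have h := DFunLike.congr_fun isHopfSuperalgebra.comul_even (u : Pq)
    simp only [LinearMap.comp_apply] at h ⊢
    rw [map_lin_coaction]
    refine h.trans ?_
    have e (z : Pq ⊗[Cq] U) :
        TensorProduct.map (par Pq) (par Pq) (TensorProduct.map LinearMap.id U.val.toLinearMap z) =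
          TensorProduct.map LinearMap.id U.val.toLinearMap
            (TensorProduct.map (par Pq) (par U) z) := by
      rw [← LinearMap.comp_apply, ← LinearMap.comp_apply, ← TensorProduct.map_comp,
        ← TensorProduct.map_comp]
      rfl
    rw [← map_lin_coaction, e]
  coassoc := by
    refine LinearMap.ext fun u => map_map_val_injective ?_
    have h := DFunLike.congr_fun isHopfSuperalgebra.coassoc (u : Pq)
    simp only [LinearMap.comp_apply, LinearEquiv.coe_coe] at h ⊢
    have e (z : (Pq ⊗[Cq] Pq) ⊗[Cq] U) :
        TensorProduct.map LinearMap.id (TensorProduct.map LinearMap.id U.val.toLinearMap)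
          (TensorProduct.assoc Cq Pq Pq U z) = TensorProduct.assoc Cq Pq Pq Pq
            (TensorProduct.map LinearMap.id U.val.toLinearMap z) := by
      have := DFunLike.congr_fun (TensorProduct.map_map_comp_assoc_eq
        (LinearMap.id : Pq →ₗ[Cq] Pq) (LinearMap.id : Pq →ₗ[Cq] Pq) U.val.toLinearMap) z
      rw [TensorProduct.map_id] at this
      exact this
    rw [e, ← LinearMap.comp_apply (TensorProduct.map LinearMap.id _) (TensorProduct.map _ _),
      ← TensorProduct.map_comp,
      ← LinearMap.comp_apply (TensorProduct.map LinearMap.id (TensorProduct.map _ _)),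
      ← TensorProduct.map_comp, map_comp_lin_coaction, LinearMap.id_comp, LinearMap.comp_id]
    rw [← map_lin_coaction, ← LinearMap.comp_apply (TensorProduct.map _ _),
      ← LinearMap.comp_apply (TensorProduct.map _ _), ← TensorProduct.map_comp,
      ← TensorProduct.map_comp] at h
    exact h
  counit := by
    refine LinearMap.ext fun u => Subtype.ext ?_
    have h := DFunLike.congr_fun isHopfSuperalgebra.counit_left (u : Pq)
    simp only [LinearMap.comp_apply, LinearEquiv.coe_coe] at h ⊢
    have e (z : Cq ⊗[Cq] U) : ((TensorProduct.lid Cq U z : U) : Pq) = TensorProduct.lid Cq Pq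
        (TensorProduct.map LinearMap.id U.val.toLinearMap z) := by
      induction z using TensorProduct.induction_on with
      | zero => simp
      | tmul r u => rfl
      | add a b ha hb => simp only [map_add, ← ha, ← hb]; rfl
    rw [e, ← LinearMap.comp_apply, ← TensorProduct.map_comp]
    rw [← map_lin_coaction, ← LinearMap.comp_apply (TensorProduct.map _ _),
      ← TensorProduct.map_comp] at h
    exact h

theorem coaction_tU (i j : Fin 2) : coaction (tU i j) = coactT i j :=
  inclU_injective ((inclU_coaction _).trans (inclU_coactT i j).symm)

theorem coaction_τU (j : Fin 2) : coaction (τU j) = coactτ j :=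
  inclU_injective ((inclU_coaction _).trans (inclU_coactτ j).symm)

/-- No signs arise in the products: the elements that have to be exchanged are 1 and the even
entries of x⁻¹. -/
theorem coactτ_eq (j : Fin 2) : coactτ j = ∑ a : Fin 2, st d 1 *
    (st (τ a) 1 + ∑ b : Fin 2, st (ξ b) (tU b a) + st 1 (τU a)) * st (Ring.inverse x a j) 1 := by
  refine Finset.sum_congr rfl fun a _ => ?_
  have hd (c : Pq) (u : U) : st d (1 : U) * st c u * st (Ring.inverse x a j) 1 =
      st (d * c * Ring.inverse x a j) u := by
    rw [st_mul_even _ _ _ hasDeg_one, one_mul, st_mul_st_even _ _ _ (hasDeg_inverse_x a j), mul_one]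
  simp only [mul_add, add_mul, Finset.mul_sum, Finset.sum_mul, hd, mul_one]

/-! ### Evaluation of the coaction on points -/

section
variable {C : Type*} [Ring C] [Algebra Cq C]

/-- The pairing of a pair of points with the super tensor product. -/
def pairing (f : Pq →ₐ[Cq] C) (u : U →ₐ[Cq] C) : STensor Pq U →ₗ[Cq] C :=
  LinearMap.mul' Cq C ∘ₗ TensorProduct.map f.toLinearMap u.toLinearMap ∘ₗ
    (GradedTensorProduct.of Cq (homog Pq) (homog U)).symm.toLinearMap

theorem pairing_st (f : Pq →ₐ[Cq] C) (u : U →ₐ[Cq] C) (a : Pq) (v : U) :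
    pairing f u (st a v) = f a * u v := rfl

theorem act_eq_pairing (f : Pq →ₐ[Cq] C) (u : U →ₐ[Cq] C) (δ : U →ₐ[Cq] STensor Pq U) (v : U) :
    act f u δ v = pairing f u (δ v) := rfl

variable [SuperAlgebra C] {f : Pq →ₐ[Cq] C} {u : U →ₐ[Cq] C}

/-- In the coaction x⁻¹ sits in the first tensor factor, hence to the left of the value of u. Its
image under f is even, so it can be moved to the right end, as in the formula for the action. -/
theorem commute_point_inverse_x (hC : IsSuperCommutative C)
    (hf : f.toLinearMap ∘ₗ par _ = par C ∘ₗ f.toLinearMap)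
    (hu : u.toLinearMap ∘ₗ par _ = par C ∘ₗ u.toLinearMap) {v : U} {i : ZMod 2}
    (hv : v ∈ homog U i) (a b : Fin 2) :
    f (Ring.inverse x a b) * u v = u v * f (Ring.inverse x a b) := by
  have h1 : f (Ring.inverse x a b) ∈ homog C 0 := by
    have := DFunLike.congr_fun hf (Ring.inverse x a b)
    rw [mem_homog_zero]
    refine this.symm.trans ?_
    exact congrArg f (parity_inverse_x a b)
  have h2 : u v ∈ homog C i := by
    rw [mem_homog] at hv ⊢
    refine (DFunLike.congr_fun hu v).symm.trans ?_
    rw [← map_smul, ← hv]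
    rfl
  simpa using hC 0 i _ _ h1 h2

theorem tU_mem_homog (i j : Fin 2) : tU i j ∈ homog U 0 :=
  mem_homog_zero.2 (Subtype.ext (parity_t i j))

theorem τU_mem_homog (j : Fin 2) : τU j ∈ homog U 1 :=
  mem_homog_one.2 (Subtype.ext (parity_τtilde j))

theorem act_tU (hC : IsSuperCommutative C)
    (hf : f.toLinearMap ∘ₗ par _ = par C ∘ₗ f.toLinearMap)
    (hu : u.toLinearMap ∘ₗ par _ = par C ∘ₗ u.toLinearMap) (i j : Fin 2) :
    act f u coaction (tU i j) = ∑ a : Fin 2, ∑ b : Fin 2, f (y i a) *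
      (u (tU a b) + f (η a) * u (τU b)) * f (Ring.inverse x b j) + f (t i j) := by
  rw [act_eq_pairing, coaction_tU, coactT]
  simp only [map_add, map_sum, pairing_st, map_mul, map_one, mul_one]
  rw [add_assoc, add_comm, ← Finset.sum_add_distrib]
  congr 1
  refine Finset.sum_congr rfl fun a _ => ?_
  rw [← Finset.sum_add_distrib]
  refine Finset.sum_congr rfl fun b _ => ?_
  rw [mul_assoc, mul_assoc _ _ (u (τU b)), commute_point_inverse_x hC hf hu (tU_mem_homog a b),
    commute_point_inverse_x hC hf hu (τU_mem_homog b)]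
  simp only [mul_add, add_mul, mul_assoc]

theorem act_τU (hC : IsSuperCommutative C)
    (hf : f.toLinearMap ∘ₗ par _ = par C ∘ₗ f.toLinearMap)
    (hu : u.toLinearMap ∘ₗ par _ = par C ∘ₗ u.toLinearMap) (j : Fin 2) :
    act f u coaction (τU j) = ∑ a : Fin 2, f d *
      (u (τU a) + f (τ a) + ∑ b : Fin 2, f (ξ b) * u (tU b a)) * f (Ring.inverse x a j) := by
  rw [act_eq_pairing, coaction_τU, coactτ]
  simp only [map_add, map_sum, pairing_st, map_mul, map_one, mul_one]
  refine Finset.sum_congr rfl fun a _ => ?_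
  have h (b : Fin 2) := commute_point_inverse_x hC hf hu (tU_mem_homog b a) a j
  simp only [mul_assoc, h, commute_point_inverse_x hC hf hu (τU_mem_homog a), mul_add, add_mul,
    Finset.mul_sum, Finset.sum_mul]
  abel

end

end QuantumBigCell

end

theorem mainTheorem5 :
    -- the change of variables makes sense
    IsUnit x ∧ IsUnit y ∧ IsUnit d ∧
    ∃ (Δ : Pq →ₐ[Cq]
        STensor Pq Pq)
      (ε : Pq →ₐ[Cq] Cq)
      (S : Pq →ₗ[Cq] Pq)
      (δ : U →ₐ[Cq]
        STensor Pq U),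
      -- the Hopf superalgebra structure of `O(P_{l,q})`, with the matrix comultiplication
      IsHopfSuperalgebra Δ ε S ∧
      (∀ i j : Fin 5, Δ (g i j) =
        ∑ k : Fin 5, st (g i k) (g k j)) ∧
      (∀ i j : Fin 5, ε (g i j) = if i = j then 1 else 0) ∧
      x.map S = Ring.inverse x ∧
      -- `δ` is the restriction of `Δ` to the big cell, and it is a coaction
      (∀ u : U,
        TensorProduct.map LinearMap.id U.val.toLinearMap
          (lin δ u) = lin Δ (u : Pq)) ∧
      IsSuperCoaction Δ ε δ ∧
      -- the explicit form of the coaction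
      (∀ i j : Fin 2, δ (tU i j) =
        st (t i j) 1 +
        ∑ a : Fin 2, ∑ b : Fin 2,
          st (y i a * S (x b j))
            (tU a b) +
        ∑ a : Fin 2, ∑ b : Fin 2,
          st
            (y i a * η a * S (x b j))
            (τU b)) ∧
      (∀ j : Fin 2, δ (τU j) =
        ∑ a : Fin 2, st d 1 *
          (st (τ a) 1 +
            ∑ b : Fin 2, st (ξ b) (tU b a) +
            st 1 (τU a)) *
          st (S (x a j)) 1) ∧
      -- `δ` is dual to the action of the supergroup on the big cell: on points with values in a
      -- commutative superalgebra it is `(A, α) ↦ (y (A + η α) x⁻¹ + t, d (α + τ + ξ A) x⁻¹)`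
      (∀ (C : Type*) [Ring C] [Algebra Cq C] [SuperAlgebra C],
        IsSuperCommutative C →
        ∀ (f : Pq →ₐ[Cq] C)
          (u : U →ₐ[Cq] C),
          f.toLinearMap ∘ₗ par _ = par C ∘ₗ f.toLinearMap →
          u.toLinearMap ∘ₗ par _ = par C ∘ₗ u.toLinearMap →
          (∀ i j : Fin 2, act f u δ (tU i j) =
            ∑ a : Fin 2, ∑ b : Fin 2, f (y i a) *
              (u (tU a b) +
                f (η a) * u (τU b)) *
              f (Ring.inverse x b j) + f (t i j)) ∧
          (∀ j : Fin 2, act f u δ (τU j) =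
            ∑ a : Fin 2, f d *
              (u (τU a) + f (τ a) +
                ∑ b : Fin 2, f (ξ b) * u (tU b a)) *
              f (Ring.inverse x a j))) := by
  refine ⟨isUnit_x, isUnit_y, isUnit_d, comul, counit, antipode, coaction, isHopfSuperalgebra,
    comul_g, counit_g, map_antipode_x, map_lin_coaction, isSuperCoaction, fun i j => ?_, fun j => ?_,
    fun C _ _ _ hC f u hf hu => ⟨act_tU hC hf hu, act_τU hC hf hu⟩⟩
  · simp only [coaction_tU, coactT, antipode_x]
  · simp only [coaction_τU, coactτ_eq, antipode_x]
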